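/- **Conventions.** A class $\mathbf T$ of functions $\mathbb N\to\mathbb N$ is either $\{f\}$ or $\mathrm{poly}f(n)=\{p(f(n)) : p \text{ a polynomial with coefficients in } \mathbb N\}$; $O(\mathbf T)=\bigcup_{g\in\mathbf T}O(g)$, $\Theta(\mathbf T)=\bigcup_{g\in\mathbf T}\Theta(g)$, and $h\in\omega(\mathbf T)$ means $g=o(h)$ for every $g\in\mathbf T$. A function $\eta:\mathbb N\to[0,\infty)$ is *$\mathbf T$-negligible*, $\eta\in\mathrm{negl}_{\mathbf T}$, if for every $g\in\Theta(\mathbf T)$, $\eta(n)<1/g(n)$ for all but finitely many $n$ (no condition where $g(n)=0$). Circuits are over the gates NOT, $H$, $T$, CNOT, Toffoli; running time is the number of gates, an oracle query counting as one gate. Observers are arbitrary (non-uniform) families of circuits with a measured output bit and ancillas initialized to $|0\rangle$. A circuit family with a key register is *uniform* if its key length and its list of gates can be computed from $1^n$ in time polynomial in $n$. **Primitives.** Let $F_k:\{0,1\}^n\to\{0,1\}$, $k\in\{0,1\}^{l_F(n)}$, and permutations $\sigma_k$ of $\{0,1\}^n$, $k\in\{0,1\}^{l_\sigma(n)}$,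 be keyed families with key lengths in $O(\mathbf T)$. $F$ is a *$\mathbf T$-QPRPF* if $|k\rangle|x\rangle|y\rangle|0\rangle\mapsto|k\rangle|x\rangle|y\oplus F_k(x)\rangle|0\rangle$ is performed by a uniform circuit family with $O(\mathbf T(n))$ gates and, for every family of oracle circuits $\mathcal A$ with $O(\mathbf T(n))$ gates, $$\Big|\Pr_{k}[\mathcal A^{F_k}(1^n)=1]-\Pr_{r}[\mathcal A^{r}(1^n)=1]\Big|\in\mathrm{negl}_{\mathbf T},$$ with $k$ uniform and $r$ a uniformly random function $\{0,1\}^n\to\{0,1\}$. $\sigma$ is a *$\mathbf T$-QPRP* if both $\sigma_k$ and $\sigma_k^{-1}$ are computable in this sense with $O(\mathbf T(n))$ gates, and the same holds with oracle access to $\sigma_k,\sigma_k^{-1}$ against a uniformly random permutation of $\{0,1\}^n$ and its inverse. **$\mathbf T$-PRS.** An ensemble of $n$-qubit states $|\psi_k\rangle$, $k\in\{0,1\}^{l(n)}$, is a *$\mathbf T$-PRS given numbers of copies $t\in\mathbf C$, with repeat functions $\mathbf R$*, if 1. $l\in O(\mathbf T)$, and a uniform circuit family with polynomially many gates maps $|k\rangle|0^n\rangle|0\rangle$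 to $|k\rangle|\psi_k\rangle|0\rangle$; 2. for every family $(\mathcal A_N)$ of circuits on $N$ input qubits with at most $s(N)$ gates, where $s\in O(\mathbf T)$, and every $t\in\mathbf C$ with $s(n\,t(n))\in O(\mathbf T(n))$, there is $\eta\in\mathrm{negl}_{\mathbf T}$ with $$\Big|\Pr_{k}[\mathcal A(|\psi_k\rangle^{\otimes t(n)})=1]-\Pr_{\varphi}[\mathcal A(|\varphi\rangle^{\otimes t(n)})=1]\Big|<\eta(n)\quad\text{for all } n,$$ where $k$ is uniform, $\varphi$ is a Haar-random $n$-qubit state and $\mathcal A=\mathcal A_{n t(n)}$; 3. $\mathrm{negl}_{\mathbf T}$ is closed under sums and under multiplication by functions in $\mathbf R$, and $rs\in O(\mathbf T)$ for all $r\in\mathbf R$, $s\in O(\mathbf T)$. **Theorem.** Let $f:\mathbb N\to\mathbb N$ be non-decreasing and at most polynomially growing. Let $m(n)\le n$ be such that $1^n\mapsto1^{m(n)}$ is computable in polynomial time. For keyed families $F,\sigma$ as above consider the ensemble, keyed by independent uniform keys $(k_1,k_2)\in\{0,1\}^{l_F(n)}\times\{0,1\}^{l_\sigma(n)}$, of the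 subset phase states $$|\psi_{k_1,k_2}\rangle=\frac1{\sqrt{2^{m(n)}}}\sum_{x\in\{0,1\}^{m(n)}}(-1)^{F_{k_1}(\sigma_{k_2}(x0^{n-m(n)}))}\,|\sigma_{k_2}(x0^{n-m(n)})\rangle ,$$ with subset size $|S|=2^{m(n)}$. 1. If $2^{m(n)}\in\omega(f(n))$, $F$ is an $f(n)$-QPRPF and $\sigma$ is an $f(n)$-QPRP, then the ensemble is an $f(n)$-PRS given numbers of copies $t(n)\in O(1)$, with repeat functions $O(1)$. 2. If $2^{m(n)}\in\omega(\mathrm{poly}f(n))$, $F$ is a $\mathrm{poly}f(n)$-QPRPF and $\sigma$ is a $\mathrm{poly}f(n)$-QPRP, then the ensemble is a $\mathrm{poly}f(n)$-PRS given numbers of copies $t(n)\in O(\mathrm{poly}f(n))$, with repeat functions $O(\mathrm{poly}f(n))$. -/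

import Mathlib

open scoped BigOperators

noncomputable section

namespace TPRS

/-! ### Asymptotic classes of functions `ℕ → ℕ` -/

/-- `O(𝐓)` for a class `𝐓` of functions: the union of the classes `O(g)`, `g ∈ 𝐓`. -/
def bigO (T : Set (ℕ → ℕ)) : Set (ℕ → ℕ) :=
  {s | ∃ g ∈ T, (fun n => (s n : ℝ)) =O[Filter.atTop] fun n => (g n : ℝ)}

/-- `Θ(𝐓)`: the union of the classes `Θ(g)`, `g ∈ 𝐓`. -/
def bigTheta (T : Set (ℕ → ℕ)) : Set (ℕ → ℕ) :=
  {s | ∃ g ∈ T, (fun n => (s n : ℝ)) =Θ[Filter.atTop] fun n => (g n : ℝ)}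

/-- `ω(𝐓)`: the functions that grow strictly faster than every `g ∈ 𝐓`. -/
def littleOmega (T : Set (ℕ → ℕ)) : Set (ℕ → ℕ) :=
  {s | ∀ g ∈ T, (fun n => (g n : ℝ)) =o[Filter.atTop] fun n => (s n : ℝ)}

/-- The class `poly f(n)` of all polynomials in `f(n)`. -/
def polyOf (f : ℕ → ℕ) : Set (ℕ → ℕ) :=
  {g | ∃ p : Polynomial ℕ, g = fun n => p.eval (f n)}

/-- `poly n`. -/
def poly : Set (ℕ → ℕ) := polyOf id

/-- `O(1)`. -/
def bigOOne : Set (ℕ → ℕ) := bigO {fun _ => 1}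

/-- `negl_𝐓`. The inequality `η n < 1 / g n` is cleared of its denominator, so that it imposes
nothing at arguments where `g n = 0`. -/
def negl (T : Set (ℕ → ℕ)) : Set (ℕ → ℝ) :=
  {η | (∀ n, 0 ≤ η n) ∧ ∀ g ∈ bigTheta T, ∀ᶠ n in Filter.atTop, (g n : ℝ) * η n < 1}

/-- Closure of a set `N` of error functions under sums and under multiplication by repeat
functions from `R`. -/
def ClosureProperties (N : Set (ℕ → ℝ)) (R : Set (ℕ → ℕ)) : Prop :=
  (∀ η₁ ∈ N, ∀ η₂ ∈ N, (fun n => η₁ n + η₂ n) ∈ N) ∧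
    ∀ η ∈ N, ∀ r ∈ R, (fun n => (r n : ℝ) * η n) ∈ N

/-- The repeat functions `R` are consistent with `𝐓`. -/
def RepetitionConsistent (R T : Set (ℕ → ℕ)) : Prop :=
  ∀ s ∈ bigO T, ∀ r ∈ R, (fun n => r n * s n) ∈ bigO T

/-! ### Quantum circuits -/

/-- Bit strings of length `n`. -/
abbrev BitStr (n : ℕ) : Type := Fin n → Bool

/-- Elementary gates on wires labelled by `W`: NOT, Hadamard, `T = diag(1, e^{iπ/4})`, CNOT
(control, target) and Toffoli (control, control, target). -/
inductive Gate (W : Type) : Type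
  | X (i : W)
  | H (i : W)
  | T (i : W)
  | CX (i j : W)
  | CCX (i j k : W)

namespace Gate

/-- Relabelling of the wires. -/
def map {V W : Type} (e : V → W) : Gate V → Gate W
  | X i => X (e i)
  | H i => H (e i)
  | T i => T (e i)
  | CX i j => CX (e i) (e j)
  | CCX i j k => CCX (e i) (e j) (e k)

end Gate

/-- Pure states (as vectors of amplitudes) of a system with one qubit for each element of `W`. -/
abbrev State (W : Type) : Type := (W → Bool) → ℂ

section circuits

variable {W : Type} [DecidableEq W]

/-- Flip the bit on wire `i`. -/
def flipBit (z : W → Bool) (i : W) : W → Bool := Function.update z i (!z i)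

/-- Action of an elementary gate on a state. A controlled gate whose target coincides with one of
its controls acts as the identity. -/
def Gate.act : Gate W → State W → State W
  | .X i, ψ => fun z => ψ (flipBit z i)
  | .H i, ψ => fun z =>
      (ψ (Function.update z i false) + (if z i then -1 else 1) * ψ (Function.update z i true))
        / (Real.sqrt 2 : ℂ)
  | .T i, ψ => fun z => (if z i then Complex.exp (Complex.I * Real.pi / 4) else 1) * ψ z
  | .CX i j, ψ => fun z => if i ≠ j ∧ z i = true then ψ (flipBit z j) else ψ z
  | .CCX i j k, ψ => fun z =>
      if i ≠ k ∧ j ≠ k ∧ z i = true ∧ z j = true then ψ (flipBit z k) else ψ z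

/-- Run a list of gates, first gate first. -/
def runGates (C : List (Gate W)) (ψ : State W) : State W := C.foldl (fun φ g => g.act φ) ψ

/-- The computational basis state `|z⟩`. -/
def ket (z : W → Bool) : State W := fun z' => open Classical in if z' = z then 1 else 0

/-- Probability that measuring wire `out` in the computational basis gives `1`. -/
def probOne [Fintype W] (out : W) (ψ : State W) : ℝ :=
  ∑ z : W → Bool, if z out = true then ‖ψ z‖ ^ 2 else 0

/-- Gates of a circuit with oracles `F i : {0,1}ᵃ → {0,1}ᵇ`, `i ∈ ι`: elementary gates and
queries; `query i e` uses the wires `e (inl ·)` as query and `e (inr ·)` as answer register. -/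
inductive OracleGate (ι : Type) (a b : ℕ) (W : Type) : Type
  | elem (g : Gate W)
  | query (i : ι) (e : Fin a ⊕ Fin b ↪ W)

/-- The basis permutation `|x⟩|y⟩ ↦ |x⟩|y ⊕ G x⟩` on the registers selected by `e`. -/
def xorInto {a b : ℕ} (G : BitStr a → BitStr b) (e : Fin a ⊕ Fin b ↪ W) (z : W → Bool) :
    W → Bool :=
  fun w => if ∃ j, e (Sum.inr j) = w ∧ G (fun i => z (e (Sum.inl i))) j = true
    then !z w else z w

/-- Action of a gate of an oracle circuit; a query is the unitary
`|x⟩|y⟩ ↦ |x⟩|y ⊕ F i x⟩`, which is its own inverse. -/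
def OracleGate.act {ι : Type} {a b : ℕ} (F : ι → BitStr a → BitStr b) :
    OracleGate ι a b W → State W → State W
  | .elem g, ψ => g.act ψ
  | .query i e, ψ => fun z => ψ (xorInto (F i) e z)

/-- Run a list of gates of an oracle circuit, first gate first. -/
def runOracleGates {ι : Type} {a b : ℕ} (F : ι → BitStr a → BitStr b)
    (C : List (OracleGate ι a b W)) (ψ : State W) : State W :=
  C.foldl (fun φ g => g.act F φ) ψ

end circuits

/-! ### Observers -/

/-- A quantum circuit with a one-bit output on `N` input qubits and `anc` ancillas in state
`|0⟩`. -/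
structure Distinguisher (N : ℕ) where
  anc : ℕ
  gates : List (Gate (Fin N ⊕ Fin anc))
  out : Fin N ⊕ Fin anc

/-- The running time is the number of gates. -/
def Distinguisher.size {N : ℕ} (A : Distinguisher N) : ℕ := A.gates.length

/-- `Pr[A(|ψ⟩) = 1]`. -/
def Distinguisher.prob {N : ℕ} (A : Distinguisher N) (ψ : State (Fin N)) : ℝ :=
  probOne A.out (runGates A.gates fun z =>
    if ∀ j, z (Sum.inr j) = false then ψ (fun i => z (Sum.inl i)) else 0)

/-- A quantum oracle circuit for `n`-bit oracles `F i : {0,1}ⁿ → {0,1}ᵇ`, `i ∈ ι`, with a one-bit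
output, started on the input `1ⁿ` and `anc` ancillas in state `|0⟩`. -/
structure OracleCircuit (ι : Type) (n b : ℕ) where
  anc : ℕ
  gates : List (OracleGate ι n b (Fin n ⊕ Fin anc))
  out : Fin n ⊕ Fin anc

/-- The running time is the number of gates, a query counting as one gate. -/
def OracleCircuit.size {ι : Type} {n b : ℕ} (A : OracleCircuit ι n b) : ℕ := A.gates.length

/-- `Pr[A^F(1ⁿ) = 1]`. -/
def OracleCircuit.prob {ι : Type} {n b : ℕ} (A : OracleCircuit ι n b)
    (F : ι → BitStr n → BitStr b) : ℝ :=
  probOne A.out (runOracleGates F A.gates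
    (ket (Sum.elim (fun _ => true) (fun _ => false))))

/-! ### Uniform circuit families -/

/-- The four registers of a keyed circuit. -/
inductive Block : Type
  | key
  | input
  | output
  | anc

/-- A circuit with an `l`-qubit key register, a `p`-qubit input register, a `q`-qubit output
register and `anc` ancillas. -/
structure KeyedCircuit (l p q : ℕ) where
  anc : ℕ
  gates : List (Gate (Fin l ⊕ Fin p ⊕ Fin q ⊕ Fin anc))

/-- The number of gates. -/
def KeyedCircuit.size {l p q : ℕ} (C : KeyedCircuit l p q) : ℕ := C.gates.length

/-- The name of a wire: its register and its position in the register. -/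
def wireName {l p q a : ℕ} : Fin l ⊕ Fin p ⊕ Fin q ⊕ Fin a → Block × ℕ
  | .inl i => (.key, i)
  | .inr (.inl i) => (.input, i)
  | .inr (.inr (.inl i)) => (.output, i)
  | .inr (.inr (.inr i)) => (.anc, i)

/-- The basis assignment `k, x, y, 0`. -/
def assign {l p q a : ℕ} (k : BitStr l) (x : BitStr p) (y : BitStr q) :
    Fin l ⊕ Fin p ⊕ Fin q ⊕ Fin a → Bool :=
  Sum.elim k (Sum.elim x (Sum.elim y fun _ => false))

/-- Programs of a deterministic machine with finitely many stacks of bits (numbered by `ℕ`) and an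
output tape on which it prints gates. `cond r p q s` runs `p`, `q` or `s` according as the top of
stack `r` is `true`, is `false`, or the stack is empty; `loop r p` repeats `p` as long as stack `r`
is non-empty; `print g` prints the gate `g`, where a wire of `g` is given by its register and a list
of stacks, whose total height is the position of the wire in the register. -/
inductive Prog : Type
  | skip
  | push (r : ℕ) (b : Bool)
  | pop (r : ℕ)
  | print (g : Gate (Block × List ℕ))
  | seq (p q : Prog)
  | cond (r : ℕ) (p q s : Prog)
  | loop (r : ℕ) (p : Prog)

/-- Contents of the stacks, top first. -/
abbrev Store : Type := ℕ → List Bool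

/-- The wire denoted by a wire expression of a program. -/
def wireVal (st : Store) (w : Block × List ℕ) : Block × ℕ :=
  (w.1, (w.2.map fun r => (st r).length).sum)

/-- `Run P st st' out c`: started with stacks `st`, the program `P` halts after `c` steps with
stacks `st'`, having printed `out`. -/
inductive Run : Prog → Store → Store → List (Gate (Block × ℕ)) → ℕ → Prop
  | skip (st : Store) : Run .skip st st [] 1
  | push (st : Store) (r : ℕ) (b : Bool) :
      Run (.push r b) st (Function.update st r (b :: st r)) [] 1
  | pop (st : Store) (r : ℕ) : Run (.pop r) st (Function.update st r (st r).tail) [] 1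
  | print (st : Store) (g : Gate (Block × List ℕ)) :
      Run (.print g) st st [g.map (wireVal st)] 1
  | seq {p q : Prog} {st st' st'' : Store} {o o' : List (Gate (Block × ℕ))} {c c' : ℕ} :
      Run p st st' o c → Run q st' st'' o' c' → Run (.seq p q) st st'' (o ++ o') (c + c')
  | cond_true {r : ℕ} {p q s : Prog} {st st' : Store} {o : List (Gate (Block × ℕ))} {c : ℕ} :
      (st r).head? = some true → Run p st st' o c → Run (.cond r p q s) st st' o (c + 1)
  | cond_false {r : ℕ} {p q s : Prog} {st st' : Store} {o : List (Gate (Block × ℕ))} {c : ℕ} :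
      (st r).head? = some false → Run q st st' o c → Run (.cond r p q s) st st' o (c + 1)
  | cond_empty {r : ℕ} {p q s : Prog} {st st' : Store} {o : List (Gate (Block × ℕ))} {c : ℕ} :
      st r = [] → Run s st st' o c → Run (.cond r p q s) st st' o (c + 1)
  | loop_done {r : ℕ} {p : Prog} {st : Store} : st r = [] → Run (.loop r p) st st [] 1
  | loop_step {r : ℕ} {p : Prog} {st st' st'' : Store} {o o' : List (Gate (Block × ℕ))}
      {c c' : ℕ} :
      st r ≠ [] → Run p st st' o c → Run (.loop r p) st' st'' o' c' →
        Run (.loop r p) st st'' (o ++ o') (c + c' + 1)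

/-- The initial stacks on input `1ⁿ`: stack `0` holds the input, the others are empty. -/
def unaryStore (n : ℕ) : Store := fun r => if r = 0 then List.replicate n true else []

/-- On input `1ⁿ` a program computes, in time polynomial in `n`, the number `a n` (in unary, as the
height of stack `1`) and prints the list of gates `C n`. -/
def PolyTime (a : ℕ → ℕ) (C : ℕ → List (Gate (Block × ℕ))) : Prop :=
  ∃ (P : Prog) (τ : Polynomial ℕ), ∀ n, ∃ (st : Store) (c : ℕ),
    Run P (unaryStore n) st (C n) c ∧ (st 1).length = a n ∧ c ≤ τ.eval n

/-- `1ⁿ ↦ 1^{a(n)}` is computable in polynomial time. -/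
def PolyTimeLength (a : ℕ → ℕ) : Prop := PolyTime a fun _ => []

/-- A (polynomial-time) uniform family of circuits: its key length and its list of gates can be
computed from `1ⁿ` in polynomial time. -/
def Uniform {l p q : ℕ → ℕ} (C : ∀ n, KeyedCircuit (l n) (p n) (q n)) : Prop :=
  PolyTime l fun n => (C n).gates.map (Gate.map wireName)

/-- The keyed functions `F n k : {0,1}ⁿ → {0,1}^{q(n)}` are computable in time `O(𝐓(n))`: a uniform
family of circuits with `O(𝐓(n))` gates maps `|k⟩|x⟩|y⟩|0⟩` to `|k⟩|x⟩|y ⊕ F n k x⟩|0⟩`. -/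
def ComputableInTime (T : Set (ℕ → ℕ)) (l q : ℕ → ℕ)
    (F : ∀ n, BitStr (l n) → BitStr n → BitStr (q n)) : Prop :=
  ∃ C : ∀ n, KeyedCircuit (l n) n (q n),
    Uniform C ∧ (fun n => (C n).size) ∈ bigO T ∧
      ∀ n k x y, runGates (C n).gates (ket (assign k x y)) =
        ket (assign k x fun j => xor (y j) (F n k x j))

/-! ### Pseudorandom phase functions and permutations -/

/-- The oracle of a phase function. -/
def phaseOracle {n : ℕ} (f : BitStr n → Bool) : Unit → BitStr n → BitStr 1 :=
  fun _ x _ => f x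

/-- The oracles of a permutation: `true` is `σ`, `false` is `σ⁻¹`. -/
def permOracle {n : ℕ} (σ : Equiv.Perm (BitStr n)) : Bool → BitStr n → BitStr n :=
  fun i x => if i then σ x else σ.symm x

/-- `𝐓`-quantum-secure pseudorandom phase functions with keys in `{0,1}^{l(n)}`. -/
def IsQPRPF (T : Set (ℕ → ℕ)) (l : ℕ → ℕ) (F : ∀ n, BitStr (l n) → BitStr n → Bool) : Prop :=
  l ∈ bigO T ∧
  ComputableInTime T l (fun _ => 1) (fun n k x _ => F n k x) ∧
  ∀ A : ∀ n, OracleCircuit Unit n 1, (fun n => (A n).size) ∈ bigO T →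
    (fun n => |(𝔼 k : BitStr (l n), (A n).prob (phaseOracle (F n k))) -
      𝔼 r : BitStr n → Bool, (A n).prob (phaseOracle r)|) ∈ negl T

/-- `𝐓`-quantum-secure pseudorandom permutations with keys in `{0,1}^{l(n)}`; the permutations and
their inverses are computable in time `O(𝐓(n))`. -/
def IsQPRP (T : Set (ℕ → ℕ)) (l : ℕ → ℕ)
    (σ : ∀ n, BitStr (l n) → Equiv.Perm (BitStr n)) : Prop :=
  l ∈ bigO T ∧
  ComputableInTime T l id (fun n k x => σ n k x) ∧
  ComputableInTime T l id (fun n k x => (σ n k).symm x) ∧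
  ∀ A : ∀ n, OracleCircuit Bool n n, (fun n => (A n).size) ∈ bigO T →
    (fun n => |(𝔼 k : BitStr (l n), (A n).prob (permOracle (σ n k))) -
      𝔼 r : Equiv.Perm (BitStr n), (A n).prob (permOracle r)|) ∈ negl T

/-! ### Haar-random and pseudorandom states -/

/-- The unit sphere of the `n`-qubit Hilbert space. -/
abbrev UnitStates (n : ℕ) : Type := Metric.sphere (0 : EuclideanSpace ℂ (BitStr n)) 1

/-- The Haar-random `n`-qubit state: the normalized surface measure on the unit sphere. -/
def haarState (n : ℕ) : MeasureTheory.Measure (UnitStates n) :=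
  let S : MeasureTheory.Measure (UnitStates n) :=
    (MeasureTheory.volume : MeasureTheory.Measure (EuclideanSpace ℂ (BitStr n))).toSphere
  (S Set.univ)⁻¹ • S

/-- `|ψ⟩^{⊗ t}`; qubit `j` of copy `i` has number `j + n * i`. -/
def copies {n : ℕ} (t : ℕ) (ψ : State (Fin n)) : State (Fin (t * n)) :=
  fun z => ∏ i : Fin t, ψ fun j => z (finProdFinEquiv (i, j))

/-- `𝐓`-indistinguishability of the ensemble `ψ n k`, with uniform key `k ∈ {0,1}^{l(n)}`, from
Haar-random states, for numbers of copies in the class `copyFns`. -/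
def HaarIndistinguishable (T copyFns : Set (ℕ → ℕ)) (l : ℕ → ℕ)
    (ψ : ∀ n, BitStr (l n) → State (Fin n)) : Prop :=
  ∀ (A : ∀ N, Distinguisher N) (s : ℕ → ℕ), s ∈ bigO T → (∀ N, (A N).size ≤ s N) →
    ∀ t ∈ copyFns, (fun n => s (t n * n)) ∈ bigO T →
      ∃ η ∈ negl T, ∀ n,
        |(𝔼 k : BitStr (l n), (A (t n * n)).prob (copies (t n) (ψ n k))) -
          ∫ φ, (A (t n * n)).prob (copies (t n) (φ : EuclideanSpace ℂ (BitStr n)).ofLp)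
            ∂(haarState n)| < η n

/-- `𝐓`-pseudorandom states with keys in `{0,1}^{l(n)}`, given numbers of copies in the class
`copyFns`, with repeat functions `R`. -/
structure IsPRS (T copyFns R : Set (ℕ → ℕ)) (l : ℕ → ℕ)
    (ψ : ∀ n, BitStr (l n) → State (Fin n)) : Prop where
  /-- the vectors are states -/
  normalized : ∀ n k, ∑ z, ‖ψ n k z‖ ^ 2 = 1
  /-- the key length -/
  keyLength : l ∈ bigO T
  /-- a uniform polynomial-size circuit family maps `|k⟩|0⟩|0⟩` to `|k⟩|ψ_k⟩|0⟩` -/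
  generator : ∃ G : ∀ n, KeyedCircuit (l n) 0 n,
    Uniform G ∧ (fun n => (G n).size) ∈ bigO poly ∧
      ∀ n k, runGates (G n).gates (ket (assign k Fin.elim0 fun _ => false)) =
        ∑ z, ψ n k z • ket (assign k Fin.elim0 z)
  indistinguishable : HaarIndistinguishable T copyFns l ψ
  closure : ClosureProperties (negl T) R
  consistent : RepetitionConsistent R T

/-! ### Subset phase states -/

/-- The string `x 0^{n-m}`. -/
def pad {m : ℕ} (n : ℕ) (x : BitStr m) : BitStr n :=
  fun i => if h : (i : ℕ) < m then x ⟨i, h⟩ else false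

/-- `2^{-m/2} ∑_{x ∈ {0,1}^m} (-1)^{f(σ(x 0^{n-m}))} |σ(x 0^{n-m})⟩`, the subset phase state of the
subset `S = {σ(x 0^{n-m})}`, of size `2^m` if `m ≤ n`. -/
def subsetPhaseState {n : ℕ} (m : ℕ) (f : BitStr n → Bool) (σ : Equiv.Perm (BitStr n)) :
    State (Fin n) :=
  ∑ x : BitStr m, ((if f (σ (pad n x)) then -1 else 1) / (Real.sqrt (2 ^ m) : ℂ)) •
    ket (σ (pad n x))

/-- The ensemble of subset phase states of `F` and `σ`, keyed by a key of `F` followed by a key of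
`σ`. -/
def subsetPhaseEnsemble (m lF lσ : ℕ → ℕ) (F : ∀ n, BitStr (lF n) → BitStr n → Bool)
    (σ : ∀ n, BitStr (lσ n) → Equiv.Perm (BitStr n)) (n : ℕ) (k : BitStr (lF n + lσ n)) :
    State (Fin n) :=
  subsetPhaseState (m n) (F n fun i => k (Fin.castAdd (lσ n) i))
    (σ n fun i => k (Fin.natAdd (lF n) i))

end TPRS

end

open TPRS

/-!
An observer receives `t` copies of a keyed subset phase state. Its view is replaced in three steps
by that of an observer of `t` copies of a Haar-random state. In between stand mixtures of the
symmetric vectors `symVec y`, the sums of the reorderings of tuples `y` of `t` distinct basis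
states.

*Random phases.* For a fixed key of the permutation, the copies can be prepared by an oracle circuit
that queries the phase function: superpose the strings `x`, compute `σ (x0…0)`, erase `x` with the
circuit for `σ⁻¹`, and kick back the phase (`runLin_prepGates`). Hardcoding the best key gives an
adversary against the phase functions (`exists_phaseAdversary_expect`), so these may be replaced by
random functions. Averaging over random signs destroys the coherence between tuples with different
parities of occurrences, and a parity class that contains a tuple without repetitions consists of
the reorderings of that tuple (`parity_eq_iff`). By the birthday bound the result is, up to
`t² / 2ᵐ`, the uniform mixture of the symmetric vectors of the tuples of distinct points of the
subset (`abs_expect_phases_sub_le`).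

*Random permutation.* The number `2ᵐ` of points of the subset exceeds the running times in `𝐓`, so
the adversary against the permutations works with a small part of it. With indices of `κ` bits,
`2 ^ κ ≈ 2t²`, and a hardcoded table `X` of strings `x0…0`, the adversary superposes all tuples of
indices, records their parities and flags their collisions, looks up `X`, applies `σ`, erases the
indices and, with `σ⁻¹`, the arguments, and runs the observer. If no collision is flagged, which has
probability at least `1/2`, the recorded parities leave exactly the symmetric vector of a tuple of
distinct points (`exists_permAdversary`). On average over the tables these points are uniform in the
subset, so the best table distinguishes at least half as well as the observer does
(`exists_permAdversary_subsetAverage`). For a random permutation the points are uniform among all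
distinct tuples, and `m` no longer matters.

*Haar-random states.* The Haar measure is invariant under sign changes of the coordinates, so the
same averaging over signs applies to Haar-random states. Permutations of the coordinates then give
the uniform mixture of all symmetric vectors, up to the collision probability. Invariance under a
rotation of two coordinates bounds the fourth moments of the amplitudes by three times their mixed
moments, whence the error is at most `3t² / 2ⁿ` (`haar_copies`).

The adversaries have size `O(𝐓)`: a circuit that computes a permutation of `n`-bit strings must have
a gate on every output wire (`le_size_of_computes`), so that `n ∈ O(𝐓)`, and the other factors are
polynomials in `t`. The properties of `𝐓` and of the repeat functions that are used are collected in
`Admissible`, and both pairs of classes have them.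

The generator prepares one copy in the same way. The program that prints it runs the given programs
as subroutines on disjoint families of stacks (`Run.subroutine`). The wires of the permutation's key
come after those of the phase function's key, so the program for the latter is first run without
output to find the key length (`run_genProg`).
-/

set_option linter.unusedSectionVars false

/-! ### Asymptotic classes -/

namespace TPRS

open Filter Topology Asymptotics

/-- Negligibility means that the product with every `g ∈ 𝐓` tends to zero: `Θ(𝐓)` contains all
constant multiples of `g`. -/
theorem mem_negl_iff {T : Set (ℕ → ℕ)} {η : ℕ → ℝ} :
    η ∈ negl T ↔ (∀ n, 0 ≤ η n) ∧ ∀ g ∈ T, Tendsto (fun n => (g n : ℝ) * η n) atTop (𝓝 0) := by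
  refine and_congr_right fun h0 => ⟨fun h g hg => ?_, fun h g ⟨g', hg', hθ⟩ => ?_⟩
  · rw [Metric.tendsto_atTop']
    intro ε hε
    obtain ⟨C, hC⟩ := exists_nat_gt (1 / ε)
    have hCpos : (0 : ℝ) < C := lt_trans (by positivity) hC
    have hmem : (fun n => C * g n) ∈ bigTheta T := by
      refine ⟨g, hg, ?_⟩
      simp only [Nat.cast_mul]
      exact (isTheta_const_mul_left hCpos.ne').2 (isTheta_refl _ _)
    obtain ⟨N, hN⟩ := eventually_atTop.1 (h _ hmem)
    refine ⟨N, fun n hn => ?_⟩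
    have h1 := hN n hn.le
    push_cast at h1
    have h2 : 0 ≤ (g n : ℝ) * η n := mul_nonneg (Nat.cast_nonneg _) (h0 n)
    rw [Real.dist_eq, sub_zero, abs_of_nonneg h2]
    rw [div_lt_iff₀ hε] at hC
    by_contra! hcon
    nlinarith [mul_le_mul_of_nonneg_left hcon hCpos.le]
  · have hO : (fun n => (g n : ℝ) * η n) =O[atTop] fun n => (g' n : ℝ) * η n :=
      hθ.1.mul (isBigO_refl _ _)
    exact (hO.trans_tendsto (h g' hg')).eventually (gt_mem_nhds one_pos)

theorem negl_add {T : Set (ℕ → ℕ)} {η₁ η₂ : ℕ → ℝ} (h₁ : η₁ ∈ negl T) (h₂ : η₂ ∈ negl T) :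
    (fun n => η₁ n + η₂ n) ∈ negl T := by
  rw [mem_negl_iff] at *
  refine ⟨fun n => add_nonneg (h₁.1 n) (h₂.1 n), fun g hg => ?_⟩
  simpa [mul_add] using (h₁.2 g hg).add (h₂.2 g hg)

/-- The hypotheses on a class `𝐓` of running times and a class `𝐑` of repeat functions (and
numbers of copies) under which the security proof goes through. -/
structure Admissible (T R : Set (ℕ → ℕ)) : Prop where
  directed : ∀ g ∈ T, ∀ g' ∈ T, ∃ h ∈ T, ((fun n => (g n : ℝ)) =O[atTop] fun n => (h n : ℝ)) ∧
    (fun n => (g' n : ℝ)) =O[atTop] fun n => (h n : ℝ)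
  absorb : ∀ r ∈ R, ∀ g ∈ T, ∃ h ∈ T,
    (fun n => (r n : ℝ) * g n) =O[atTop] fun n => (h n : ℝ)
  const_mem : ∀ c : ℕ, (fun _ => c) ∈ R
  add_mem : ∀ r ∈ R, ∀ r' ∈ R, (fun n => r n + r' n) ∈ R
  mul_mem : ∀ r ∈ R, ∀ r' ∈ R, (fun n => r n * r' n) ∈ R

namespace Admissible

variable {T R : Set (ℕ → ℕ)} (hTR : Admissible T R)
include hTR

theorem negl_mul {η : ℕ → ℝ} (hη : η ∈ negl T) {r : ℕ → ℕ} (hr : r ∈ R) :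
    (fun n => (r n : ℝ) * η n) ∈ negl T := by
  rw [mem_negl_iff] at *
  refine ⟨fun n => mul_nonneg (Nat.cast_nonneg _) (hη.1 n), fun g hg => ?_⟩
  obtain ⟨h, hh, hO⟩ := hTR.absorb r hr g hg
  have : (fun n => (g n : ℝ) * (r n * η n)) =O[atTop] fun n => (h n : ℝ) * η n := by
    simpa only [mul_left_comm, mul_assoc, mul_comm] using hO.mul (isBigO_refl η atTop)
  exact this.trans_tendsto (hη.2 h hh)

theorem closure : ClosureProperties (negl T) R :=
  ⟨fun _ h₁ _ h₂ => negl_add h₁ h₂, fun _ hη _ hr => hTR.negl_mul hη hr⟩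

theorem consistent : RepetitionConsistent R T := by
  rintro s ⟨g, hg, hs⟩ r hr
  obtain ⟨h, hh, hO⟩ := hTR.absorb r hr g hg
  refine ⟨h, hh, ?_⟩
  simp only [Nat.cast_mul]
  exact ((isBigO_refl _ _).mul hs).trans hO

theorem bigO_add {s s' : ℕ → ℕ} (hs : s ∈ bigO T) (hs' : s' ∈ bigO T) :
    (fun n => s n + s' n) ∈ bigO T := by
  obtain ⟨g, hg, hsg⟩ := hs
  obtain ⟨g', hg', hsg'⟩ := hs'
  obtain ⟨h, hh, h₁, h₂⟩ := hTR.directed g hg g' hg'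
  refine ⟨h, hh, ?_⟩
  simp only [Nat.cast_add]
  exact (hsg.trans h₁).add (hsg'.trans h₂)

end Admissible

theorem bigO_of_eventually_le {T : Set (ℕ → ℕ)} {s s' : ℕ → ℕ} (h : ∀ᶠ n in atTop, s n ≤ s' n)
    (hs' : s' ∈ bigO T) : s ∈ bigO T := by
  obtain ⟨g, hg, hO⟩ := hs'
  refine ⟨g, hg, IsBigO.trans (IsBigO.of_bound 1 ?_) hO⟩
  filter_upwards [h] with n hn
  simpa using hn

theorem bigO_of_le {T : Set (ℕ → ℕ)} {s s' : ℕ → ℕ} (h : ∀ n, s n ≤ s' n)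
    (hs' : s' ∈ bigO T) : s ∈ bigO T :=
  bigO_of_eventually_le (Eventually.of_forall h) hs'

theorem inv_two_pow_mem_negl {T : Set (ℕ → ℕ)} {m : ℕ → ℕ}
    (h : (fun n => 2 ^ m n) ∈ littleOmega T) : (fun n => 1 / (2 : ℝ) ^ m n) ∈ negl T := by
  rw [mem_negl_iff]
  refine ⟨fun n => by positivity, fun g hg => ?_⟩
  have := (h g hg).tendsto_div_nhds_zero
  simpa [div_eq_mul_inv] using this

theorem admissible_singleton (f : ℕ → ℕ) : Admissible {f} bigOOne where
  directed := by
    rintro g rfl g' rfl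
    exact ⟨g', rfl, isBigO_refl _ _, isBigO_refl _ _⟩
  absorb := by
    rintro r ⟨_, rfl, hr⟩ g rfl
    exact ⟨g, rfl, by simpa using hr.mul (isBigO_refl (fun n => (g n : ℝ)) atTop)⟩
  const_mem c := ⟨_, rfl, by
    simpa only [Nat.cast_one] using isBigO_const_const (c : ℝ) (one_ne_zero (α := ℝ)) _⟩
  add_mem := by
    rintro r ⟨_, rfl, hr⟩ r' ⟨_, rfl, hr'⟩
    exact ⟨_, rfl, by simpa using hr.add hr'⟩
  mul_mem := by
    rintro r ⟨_, rfl, hr⟩ r' ⟨_, rfl, hr'⟩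
    exact ⟨_, rfl, by simpa using hr.mul hr'⟩

theorem admissible_polyOf (f : ℕ → ℕ) : Admissible (polyOf f) (bigO (polyOf f)) where
  directed := by
    rintro _ ⟨p, rfl⟩ _ ⟨q, rfl⟩
    refine ⟨_, ⟨p + q, rfl⟩, IsBigO.of_bound 1 (Eventually.of_forall fun n => ?_),
      IsBigO.of_bound 1 (Eventually.of_forall fun n => ?_)⟩ <;>
    · simp only [Polynomial.eval_add, Real.norm_natCast, one_mul]
      exact_mod_cast by omega
  absorb := by
    rintro r ⟨_, ⟨p, rfl⟩, hr⟩ _ ⟨q, rfl⟩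
    exact ⟨_, ⟨p * q, rfl⟩, by simpa using hr.mul (isBigO_refl _ atTop)⟩
  const_mem c := ⟨_, ⟨Polynomial.C c, rfl⟩, by simp only [Polynomial.eval_C]; exact isBigO_refl _ _⟩
  add_mem := by
    rintro r ⟨_, ⟨p, rfl⟩, hr⟩ r' ⟨_, ⟨q, rfl⟩, hr'⟩
    refine ⟨_, ⟨p + q, rfl⟩, ?_⟩
    simp only [Nat.cast_add, Polynomial.eval_add]
    refine (hr.trans (IsBigO.of_bound 1 (Eventually.of_forall fun n => ?_))).add
      (hr'.trans (IsBigO.of_bound 1 (Eventually.of_forall fun n => ?_))) <;>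
    · rw [Real.norm_natCast, one_mul, Real.norm_of_nonneg (by positivity)]
      simp
  mul_mem := by
    rintro r ⟨_, ⟨p, rfl⟩, hr⟩ r' ⟨_, ⟨q, rfl⟩, hr'⟩
    exact ⟨_, ⟨p * q, rfl⟩, by simpa using hr.mul hr'⟩

end TPRS

/-! ### Effects and averages over random signs -/

namespace TPRS

open Finset

/-- A function of the form `ψ ↦ ‖L ψ‖²` with a linear contraction `L`: the probability, as a
function of the (possibly unnormalized) input vector, that a measurement gives a fixed outcome. -/
def IsEffect {X : Type} [Fintype X] (Q : (X → ℂ) → ℝ) : Prop :=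
  ∃ (Y : Type) (_ : Fintype Y) (L : (X → ℂ) →ₗ[ℂ] (Y → ℂ)),
    (∀ ψ, Q ψ = ∑ y, ‖L ψ y‖ ^ 2) ∧ ∀ ψ, Q ψ ≤ ∑ x, ‖ψ x‖ ^ 2

namespace IsEffect

variable {X : Type} [Fintype X] {Q : (X → ℂ) → ℝ}

theorem nonneg (hQ : IsEffect Q) (ψ : X → ℂ) : 0 ≤ Q ψ := by
  obtain ⟨Y, _, L, hL, -⟩ := hQ
  rw [hL]
  positivity

theorem le (hQ : IsEffect Q) (ψ : X → ℂ) : Q ψ ≤ ∑ x, ‖ψ x‖ ^ 2 := by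
  obtain ⟨Y, _, L, -, h⟩ := hQ
  exact h ψ

theorem smul (hQ : IsEffect Q) (c : ℂ) (ψ : X → ℂ) : Q (c • ψ) = ‖c‖ ^ 2 * Q ψ := by
  obtain ⟨Y, _, L, hL, -⟩ := hQ
  simp [hL, mul_pow, mul_sum]

/-- Averaging over a family of orthonormal signs `χ c` destroys the coherence between the different
classes `cl x = c` of basis states. -/
theorem expect_signs (hQ : IsEffect Q) {C Ω : Type} [Fintype C] [DecidableEq C] [Fintype Ω]
    (χ : C → Ω → ℝ)
    (horth : ∀ c c', (𝔼 r, χ c r * χ c' r) = if c = c' then 1 else 0) (cl : X → C) (ψ : X → ℂ) :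
    (𝔼 r, Q fun x => (χ (cl x) r : ℂ) * ψ x) = ∑ c, Q fun x => if cl x = c then ψ x else 0 := by
  obtain ⟨Y, _, L, hL, -⟩ := hQ
  set φ : C → Y → ℂ := fun c => L fun x => if cl x = c then ψ x else 0 with hφ
  have h1 : ∀ r, (L fun x => (χ (cl x) r : ℂ) * ψ x) = ∑ c, (χ c r : ℂ) • φ c := by
    intro r
    simp only [hφ, ← map_smul, ← map_sum]
    congr 1
    ext x
    simp [Finset.sum_apply]
  have h2 : ∀ r y, ‖L (fun x => (χ (cl x) r : ℂ) * ψ x) y‖ ^ 2 =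
      ∑ c, ∑ c', χ c r * χ c' r * ((φ c y).re * (φ c' y).re + (φ c y).im * (φ c' y).im) := by
    intro r y
    rw [h1, ← Complex.normSq_eq_norm_sq, Complex.normSq_apply]
    simp only [Finset.sum_apply, Pi.smul_apply, smul_eq_mul, Complex.re_sum, Complex.im_sum,
      Complex.re_ofReal_mul, Complex.im_ofReal_mul, Finset.sum_mul_sum, ← Finset.sum_add_distrib]
    refine sum_congr rfl fun c _ => sum_congr rfl fun c' _ => ?_
    ring
  simp only [hL, h2]
  rw [expect_sum_comm]
  simp_rw [expect_sum_comm, ← expect_mul, horth]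
  simp only [ite_mul, one_mul, zero_mul, sum_ite_eq, mem_univ, if_true]
  rw [sum_comm]
  refine sum_congr rfl fun c _ => sum_congr rfl fun y _ => ?_
  rw [← Complex.normSq_eq_norm_sq, Complex.normSq_apply]

end IsEffect

/-- The sign `(-1)^b`. -/
def sgn (b : Bool) : ℝ := if b then -1 else 1

theorem sgn_mul_self (b : Bool) : sgn b * sgn b = 1 := by cases b <;> simp [sgn]

theorem sgn_sq (b : Bool) : sgn b ^ 2 = 1 := by rw [sq, sgn_mul_self]

variable {Z : Type} [Fintype Z] [DecidableEq Z]

/-- The character `r ↦ (-1)^{c · r}`. -/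
def signChar (c r : Z → Bool) : ℝ := ∏ z, if c z then sgn (r z) else 1

theorem expect_signChar_mul (c c' : Z → Bool) :
    (𝔼 r, signChar c r * signChar c' r) = if c = c' then 1 else 0 := by
  have h1 : ∀ r : Z → Bool, signChar c r * signChar c' r =
      ∏ z, ((if c z then sgn (r z) else 1) * if c' z then sgn (r z) else 1) := fun r => by
    rw [signChar, signChar, prod_mul_distrib]
  have h2 : (∑ r : Z → Bool, signChar c r * signChar c' r) =
      ∏ z, ∑ b : Bool, ((if c z then sgn b else 1) * if c' z then sgn b else 1) := by
    rw [Finset.prod_univ_sum, Fintype.piFinset_univ]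
    exact sum_congr rfl fun r _ => h1 r
  have h3 : ∀ z, (∑ b : Bool, ((if c z then sgn b else 1) * if c' z then sgn b else 1)) =
      if c z = c' z then 2 else 0 := by
    intro z
    cases c z <;> cases c' z <;> norm_num [sgn]
  rw [Fintype.expect_eq_sum_div_card, h2]
  simp only [h3]
  split_ifs with h
  · subst h
    simp
  · obtain ⟨z, hz⟩ := Function.ne_iff.1 h
    rw [prod_eq_zero (mem_univ z) (by simp [hz]), zero_div]

variable {t : ℕ}

/-- The parities of the numbers of occurrences of the points of `Z` in a tuple. -/
def parity (y : Fin t → Z) (z : Z) : Bool := decide (Odd #{a | y a = z})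

theorem prod_sgn_eq_signChar (y : Fin t → Z) (r : Z → Bool) :
    ∏ a, sgn (r (y a)) = signChar (parity y) r := by
  rw [Finset.prod_comp (fun z => sgn (r z)) y, signChar]
  have : ∏ z, (if parity y z then sgn (r z) else 1) = ∏ z, sgn (r z) ^ #{a | y a = z} := by
    refine prod_congr rfl fun z _ => ?_
    rcases Nat.even_or_odd #{a | y a = z} with h | h
    · have h' : parity y z = false := by simpa [parity] using h
      obtain ⟨k, hk⟩ := h
      rw [h', hk, ← two_mul, pow_mul, sgn_sq]
      simp
    · have h' : parity y z = true := by simpa [parity] using h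
      obtain ⟨k, hk⟩ := h
      rw [h', hk, pow_succ, pow_mul, sgn_sq]
      simp
  rw [this]
  refine prod_subset (subset_univ _) fun z _ hz => ?_
  have : #{a | y a = z} = 0 := by
    rw [card_eq_zero, filter_eq_empty_iff]
    intro a _ ha
    exact hz (mem_image.2 ⟨a, mem_univ _, ha⟩)
  rw [this, pow_zero]

theorem parity_of_injective {y : Fin t → Z} (hy : Function.Injective y) (z : Z) :
    parity y z = true ↔ ∃ a, y a = z := by
  rw [parity, decide_eq_true_iff]
  constructor
  · intro h
    by_contra! hne
    rw [filter_false_of_mem fun a _ => hne a] at h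
    simp at h
  · rintro ⟨a, rfl⟩
    have : ({b | y b = y a} : Finset (Fin t)) = {a} := by
      ext b
      simp [hy.eq_iff]
    rw [this]
    simp

theorem parity_comp_perm (y : Fin t → Z) (π : Equiv.Perm (Fin t)) : parity (y ∘ π) = parity y := by
  ext z
  simp only [parity, Function.comp]
  rw [show #{a | y (π a) = z} = #{a | y a = z} from
    card_bij (fun a _ => π a) (by simp) (by simp) fun b hb =>
      ⟨π.symm b, by simpa using hb, by simp⟩]

/-- A tuple with the same parities as an injective tuple is a reordering of it. -/
theorem parity_eq_iff {y : Fin t → Z} (hy : Function.Injective y) (x : Fin t → Z) :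
    parity x = parity y ↔ ∃ π : Equiv.Perm (Fin t), y ∘ π = x := by
  constructor
  · intro h
    have h1 : ∀ a, ∃ b, x b = y a := by
      intro a
      have ha : parity x (y a) = true := by rw [h, parity_of_injective hy]; exact ⟨a, rfl⟩
      by_contra! hne
      rw [parity, filter_false_of_mem fun b _ => hne b] at ha
      simp at ha
    choose g hg using h1
    have hginj : Function.Injective g := fun a b hab => hy (by rw [← hg, ← hg, hab])
    refine ⟨(Equiv.ofBijective g (Finite.injective_iff_bijective.1 hginj)).symm, ?_⟩
    ext b
    simp only [Function.comp]
    rw [← hg]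
    congr 1
    exact (Equiv.ofBijective g (Finite.injective_iff_bijective.1 hginj)).apply_symm_apply b
  · rintro ⟨π, rfl⟩
    exact parity_comp_perm y π

/-- The injective `t`-tuples. -/
def injTuples (t : ℕ) (Z : Type) [Fintype Z] [DecidableEq Z] : Finset (Fin t → Z) :=
  open Classical in {y | Function.Injective y}

@[simp] theorem mem_injTuples {y : Fin t → Z} : y ∈ injTuples t Z ↔ Function.Injective y := by
  simp [injTuples]

theorem sum_perm_ne_zero {y : Fin t → Z} (hy : Function.Injective y) {M : Type*} [AddCommMonoid M]
    (g : (Fin t → Z) → M) :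
    ∑ x, (if parity x = parity y then g x else 0) = ∑ π : Equiv.Perm (Fin t), g (y ∘ π) := by
  rw [← sum_filter]
  symm
  refine sum_bij (fun π _ => y ∘ π) (by simp [parity_comp_perm]) ?_ ?_ (by simp)
  · intro π _ π' _ h
    ext a
    exact congrArg Fin.val (hy (congrFun h a))
  · intro x hx
    obtain ⟨π, hπ⟩ := (parity_eq_iff hy x).1 (by simpa using hx)
    exact ⟨π, mem_univ _, hπ⟩

/-- The unnormalized symmetric vector `∑_π |y ∘ π⟩` of a tuple `y`. -/
def symVec (y : Fin t → Z) : (Fin t → Z) → ℂ := fun x =>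
  ∑ π : Equiv.Perm (Fin t), if x = y ∘ π then 1 else 0

theorem symVec_of_injective {y : Fin t → Z} (hy : Function.Injective y) (x : Fin t → Z) :
    symVec y x = if parity x = parity y then 1 else 0 := by
  have := sum_perm_ne_zero hy fun x' => if x = x' then (1 : ℂ) else 0
  rw [symVec, ← this]
  have h : ∀ x', (if parity x' = parity y then if x = x' then (1 : ℂ) else 0 else 0) =
      if x = x' then (if parity x = parity y then 1 else 0) else 0 := by
    intro x'
    by_cases hx : x = x'
    · subst hx; simp
    · simp [hx]
  simp [h]

/-- The value of an effect on the normalized symmetric vector of an injective tuple. -/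
noncomputable def symWeight (Q : ((Fin t → Z) → ℂ) → ℝ) (y : Fin t → Z) : ℝ :=
  Q (symVec y) / (Nat.factorial t)

/-- The average of `symWeight` over all injective tuples. -/
noncomputable def symAverage (Q : ((Fin t → Z) → ℂ) → ℝ) : ℝ := 𝔼 y ∈ injTuples t Z, symWeight Q y

theorem symWeight_nonneg {Q : ((Fin t → Z) → ℂ) → ℝ} (hQ : IsEffect Q) (y : Fin t → Z) :
    0 ≤ symWeight Q y := div_nonneg (hQ.nonneg _) (by positivity)

theorem symWeight_le_one {Q : ((Fin t → Z) → ℂ) → ℝ} (hQ : IsEffect Q) {y : Fin t → Z}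
    (hy : Function.Injective y) : symWeight Q y ≤ 1 := by
  rw [symWeight, div_le_one (by positivity)]
  refine (hQ.le _).trans (le_of_eq ?_)
  have h : ∀ x, ‖symVec y x‖ ^ 2 = if parity x = parity y then (1 : ℝ) else 0 := by
    intro x
    rw [symVec_of_injective hy]
    split_ifs <;> simp
  simp only [h]
  rw [sum_perm_ne_zero hy fun _ => (1 : ℝ)]
  simp [Fintype.card_perm]

theorem symAverage_nonneg {Q : ((Fin t → Z) → ℂ) → ℝ} (hQ : IsEffect Q) : 0 ≤ symAverage Q :=
  expect_nonneg fun _ _ => symWeight_nonneg hQ _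

theorem symAverage_le_one {Q : ((Fin t → Z) → ℂ) → ℝ} (hQ : IsEffect Q) : symAverage Q ≤ 1 := by
  rcases (injTuples t Z).eq_empty_or_nonempty with h | h
  · simp [symAverage, h]
  · exact expect_le h fun y hy => symWeight_le_one hQ (mem_injTuples.1 hy)

/-- The sum of a function of the parities over the classes that contain an injective tuple. -/
theorem sum_image_parity (g : (Z → Bool) → ℝ) :
    ∑ c ∈ (injTuples t Z).image parity, g c =
      ∑ y ∈ injTuples t Z, g (parity y) / (Nat.factorial t) := by
  rw [Finset.sum_comp (fun c => g c / (Nat.factorial t)) parity]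
  refine sum_congr rfl fun c hc => ?_
  obtain ⟨y, hy, rfl⟩ := mem_image.1 hc
  have hy' := mem_injTuples.1 hy
  have : #{x ∈ injTuples t Z | parity x = parity y} = Nat.factorial t := by
    have h := sum_perm_ne_zero hy' fun _ => (1 : ℕ)
    rw [← sum_filter] at h
    simp only [sum_const, smul_eq_mul, mul_one, card_univ, Fintype.card_perm,
      Fintype.card_fin] at h
    rw [← h]
    congr 1
    ext x
    simp only [mem_filter, mem_injTuples, mem_univ, true_and, and_iff_right_iff_imp]
    intro hx
    obtain ⟨π, rfl⟩ := (parity_eq_iff hy' x).1 hx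
    exact hy'.comp π.injective
  rw [this, nsmul_eq_mul]
  field_simp

/-- The part of an effect on a product vector that comes from the parity classes of injective
tuples. -/
theorem sum_parity_injective {Q : ((Fin t → Z) → ℂ) → ℝ} (hQ : IsEffect Q) (α : Z → ℂ) :
    ∑ c ∈ (injTuples t Z).image parity,
        Q (fun x => if parity x = c then ∏ a, α (x a) else 0) =
      ∑ y ∈ injTuples t Z, (∏ a, ‖α (y a)‖ ^ 2) * symWeight Q y := by
  rw [sum_image_parity]
  refine sum_congr rfl fun y hy => ?_
  have hy' := mem_injTuples.1 hy
  have : (fun x => if parity x = parity y then ∏ a, α (x a) else 0) =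
      (∏ a, α (y a)) • symVec y := by
    ext x
    rw [Pi.smul_apply, symVec_of_injective hy']
    split_ifs with h
    · obtain ⟨π, rfl⟩ := (parity_eq_iff hy' x).1 h
      simp only [Function.comp, smul_eq_mul, mul_one]
      exact Equiv.prod_comp π fun a => α (y a)
    · simp
  rw [this, hQ.smul, symWeight, norm_prod, ← prod_pow, mul_div_assoc]

/-- With random signs, `t` copies of a vector are, up to the weight of the tuples with repetitions,
a mixture of symmetric vectors of injective tuples. -/
theorem expect_sign_copies {Q : ((Fin t → Z) → ℂ) → ℝ} (hQ : IsEffect Q) (α : Z → ℂ)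
    (hα : ∑ z, ‖α z‖ ^ 2 = 1) :
    let E := 𝔼 r : Z → Bool, Q fun x => ∏ a, ((sgn (r (x a)) : ℂ) * α (x a))
    let D := ∑ y ∈ injTuples t Z, (∏ a, ‖α (y a)‖ ^ 2) * symWeight Q y
    D ≤ E ∧ E ≤ D + (1 - ∑ y ∈ injTuples t Z, ∏ a, ‖α (y a)‖ ^ 2) := by
  intro E D
  have hE : E = ∑ c, Q fun x : Fin t → Z => if parity x = c then ∏ a, α (x a) else 0 := by
    rw [← hQ.expect_signs signChar expect_signChar_mul parity fun x => ∏ a, α (x a)]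
    refine expect_congr rfl fun r _ => ?_
    congr 1
    ext x
    rw [prod_mul_distrib, ← prod_sgn_eq_signChar]
    push_cast
    rfl
  rw [← sum_add_sum_compl ((injTuples t Z).image parity), sum_parity_injective hQ] at hE
  rw [hE]
  refine ⟨le_add_of_nonneg_right (sum_nonneg fun c _ => hQ.nonneg _), ?_⟩
  refine add_le_add le_rfl ?_
  have htot : ∑ y : Fin t → Z, ∏ a, ‖α (y a)‖ ^ 2 = 1 := by
    rw [← Fintype.piFinset_univ, ← Finset.prod_univ_sum (fun _ => univ) fun _ z => ‖α z‖ ^ 2]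
    simp [hα]
  rw [← htot, ← sum_compl_add_sum (injTuples t Z), add_sub_cancel_right]
  refine (sum_le_sum fun c _ => hQ.le _).trans ?_
  rw [sum_comm, ← sum_compl_add_sum (injTuples t Z)]
  have hz : ∀ x ∈ injTuples t Z, ∑ c ∈ ((injTuples t Z).image parity)ᶜ,
      ‖(if parity x = c then ∏ a, α (x a) else 0 : ℂ)‖ ^ 2 = 0 := by
    intro x hx
    refine sum_eq_zero fun c hc => ?_
    rw [if_neg, norm_zero, sq, zero_mul]
    rintro rfl
    exact (mem_compl.1 hc) (mem_image_of_mem _ hx)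
  rw [sum_eq_zero hz, add_zero]
  refine sum_le_sum fun x _ => ?_
  refine (sum_le_univ_sum_of_nonneg fun c => by positivity).trans (le_of_eq ?_)
  have : ∀ c, ‖(if parity x = c then ∏ a, α (x a) else 0 : ℂ)‖ ^ 2 =
      if parity x = c then ∏ a, ‖α (x a)‖ ^ 2 else 0 := by
    intro c
    split_ifs
    · rw [norm_prod, prod_pow]
    · simp
  simp [this]

/-- The birthday bound: the probability that `t` independent samples are not distinct. -/
theorem collision_bound (p : Z → ℝ) (hp : ∀ z, 0 ≤ p z) (hsum : ∑ z, p z = 1) :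
    1 - ∑ y ∈ injTuples t Z, ∏ a, p (y a) ≤ (t : ℝ) ^ 2 * ∑ z, p z ^ 2 := by
  have htot : ∑ y : Fin t → Z, ∏ a, p (y a) = 1 := by
    rw [← Fintype.piFinset_univ, ← Finset.prod_univ_sum (fun _ => univ) fun _ z => p z]
    simp [hsum]
  rw [← htot, ← sum_compl_add_sum (injTuples t Z), add_sub_cancel_right]
  have hpair : ∀ a b : Fin t, a ≠ b →
      ∑ y : Fin t → Z, (if y a = y b then ∏ c, p (y c) else 0) = ∑ z, p z ^ 2 := by
    intro a b hab
    have h1 : ∀ y : Fin t → Z, (if y a = y b then ∏ c, p (y c) else 0) =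
        ∑ z, ∏ c, (if c = a ∨ c = b then (if y c = z then p (y c) else 0) else p (y c)) := by
      intro y
      split_ifs with h
      · rw [sum_eq_single (y a)]
        · refine prod_congr rfl fun c _ => ?_
          split_ifs with h1 h2
          · rfl
          · rcases h1 with rfl | rfl
            · exact absurd rfl h2
            · exact absurd h.symm h2
          · rfl
        · intro z _ hz
          exact prod_eq_zero (mem_univ a) (by simp [hz.symm])
        · simp
      · symm
        refine sum_eq_zero fun z _ => ?_
        by_cases hz : y a = z
        · exact prod_eq_zero (mem_univ b) (by simp [← hz, Ne.symm h])
        · exact prod_eq_zero (mem_univ a) (by simp [hz])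
    simp only [h1]
    rw [sum_comm]
    refine sum_congr rfl fun z _ => ?_
    rw [← Fintype.piFinset_univ, ← Finset.prod_univ_sum (fun _ => univ)
      fun c u => if c = a ∨ c = b then (if u = z then p u else 0) else p u]
    rw [← mul_prod_erase _ _ (mem_univ a),
      ← mul_prod_erase _ _ (mem_erase.2 ⟨hab.symm, mem_univ b⟩),
      prod_eq_one]
    · simp [sq]
    · intro c hc
      simp only [mem_erase, mem_univ, and_true] at hc
      simp [hc.1, hc.2, hsum]
  calc ∑ y ∈ (injTuples t Z)ᶜ, ∏ a, p (y a)
      ≤ ∑ y ∈ (injTuples t Z)ᶜ, ∑ q ∈ (univ : Finset (Fin t)).offDiag,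
          (if y q.1 = y q.2 then ∏ c, p (y c) else 0) := by
        refine sum_le_sum fun y hy => ?_
        have : ¬ Function.Injective y := by simpa using hy
        simp only [Function.Injective, not_forall] at this
        obtain ⟨a, b, hab, hne⟩ := this
        have hnn : ∀ q ∈ (univ : Finset (Fin t)).offDiag,
            0 ≤ (if y q.1 = y q.2 then ∏ c, p (y c) else 0) := by
          intro q _
          split_ifs
          · exact prod_nonneg fun c _ => hp _
          · exact le_rfl
        refine le_trans (le_of_eq ?_) (single_le_sum hnn (show (a, b) ∈ _ by simpa using hne))
        simp [hab]
    _ ≤ ∑ y : Fin t → Z, ∑ q ∈ (univ : Finset (Fin t)).offDiag,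
          (if y q.1 = y q.2 then ∏ c, p (y c) else 0) := by
        refine sum_le_univ_sum_of_nonneg fun y => sum_nonneg fun q _ => ?_
        split_ifs
        · exact prod_nonneg fun c _ => hp _
        · exact le_rfl
    _ = ∑ q ∈ (univ : Finset (Fin t)).offDiag, ∑ z, p z ^ 2 := by
        rw [sum_comm]
        exact sum_congr rfl fun q hq => hpair q.1 q.2 (by simpa using hq)
    _ ≤ (t : ℝ) ^ 2 * ∑ z, p z ^ 2 := by
        rw [sum_const, nsmul_eq_mul]
        refine mul_le_mul_of_nonneg_right ?_ (sum_nonneg fun z _ => sq_nonneg _)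
        rw [offDiag_card]
        have : t * t - t ≤ t ^ 2 := by rw [sq]; exact Nat.sub_le _ _
        simpa using (Nat.cast_le (α := ℝ)).2 this

/-- The average over a random permutation of a function of the image of an injective tuple. -/
theorem expect_perm_comp {y : Fin t → Z} (hy : Function.Injective y) (h : (Fin t → Z) → ℝ) :
    (𝔼 ρ : Equiv.Perm Z, h (ρ ∘ y)) = 𝔼 x ∈ injTuples t Z, h x := by
  have key : ∀ x ∈ injTuples t Z,
      (𝔼 ρ : Equiv.Perm Z, h (ρ ∘ x)) = 𝔼 ρ : Equiv.Perm Z, h (ρ ∘ y) := by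
    intro x hx
    obtain ⟨g, hg⟩ := (Equiv.Perm.isMultiplyPretransitive Z t).exists_smul_eq
      ⟨y, hy⟩ ⟨x, mem_injTuples.1 hx⟩
    refine Fintype.expect_equiv (Equiv.mulRight g) _ _ fun ρ => ?_
    congr 1
    ext a
    have := congrArg (fun f : Fin t ↪ Z => f a) hg
    simp only [Function.Embedding.smul_apply, Equiv.Perm.smul_def,
      Function.Embedding.coeFn_mk] at this
    simp [this]
  have hne : (injTuples t Z).Nonempty := ⟨y, mem_injTuples.2 hy⟩
  rw [← expect_const hne (𝔼 ρ : Equiv.Perm Z, h (ρ ∘ y)), ← expect_congr rfl key, expect_comm]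
  rw [← Fintype.expect_const (ι := Equiv.Perm Z) (𝔼 x ∈ injTuples t Z, h x)]
  refine expect_congr rfl fun ρ _ => ?_
  refine expect_equiv (Equiv.arrowCongr (Equiv.refl _) ρ) ?_ ?_
  · intro x
    simp [Equiv.arrowCongr, ρ.injective.of_comp_iff]
  · intro x _
    rfl

end TPRS

/-! ### Moments of Haar-random states -/

namespace TPRS

open Finset MeasureTheory

section sphere

variable {E : Type*} [NormedAddCommGroup E] [InnerProductSpace ℝ E] [FiniteDimensional ℝ E]
  [MeasurableSpace E] [BorelSpace E]

/-- The action of a linear isometry on the unit sphere. -/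
def sphereMap (U : E ≃ₗᵢ[ℝ] E) (x : Metric.sphere (0 : E) 1) : Metric.sphere (0 : E) 1 :=
  ⟨U x, by simp⟩

theorem continuous_sphereMap (U : E ≃ₗᵢ[ℝ] E) : Continuous (sphereMap U) :=
  (U.continuous.comp continuous_subtype_val).subtype_mk _

/-- The surface measure of the sphere is invariant under isometries. -/
theorem measurePreserving_sphereMap (U : E ≃ₗᵢ[ℝ] E) :
    MeasurePreserving (sphereMap U) (volume : Measure E).toSphere
      (volume : Measure E).toSphere := by
  refine ⟨(continuous_sphereMap U).measurable, ?_⟩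
  ext s hs
  have hpre : MeasurableSet (sphereMap U ⁻¹' s) := (continuous_sphereMap U).measurable hs
  rw [Measure.map_apply (continuous_sphereMap U).measurable hs, Measure.toSphere_apply' _ hs,
    Measure.toSphere_apply' _ hpre]
  congr 1
  refine Eq.trans (congrArg _ ?_)
    (U.measurePreserving.measure_preimage_emb U.toHomeomorph.measurableEmbedding _)
  ext x
  simp only [Set.mem_smul, Set.mem_image, Set.mem_preimage]
  constructor
  · rintro ⟨c, hc, _, ⟨y, hy, rfl⟩, rfl⟩
    exact ⟨c, hc, U y, ⟨sphereMap U y, hy, rfl⟩, by simp⟩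
  · rintro ⟨c, hc, _, ⟨y, hy, rfl⟩, hx⟩
    refine ⟨c, hc, U.symm y, ⟨sphereMap U.symm y, ?_, rfl⟩, ?_⟩
    · have : sphereMap U (sphereMap U.symm y) = y := Subtype.ext (U.apply_symm_apply _)
      rwa [this]
    · rw [← map_smul, hx, U.symm_apply_apply]

end sphere

variable {n : ℕ}

/-- The `n`-qubit Hilbert space. -/
abbrev Qubits (n : ℕ) : Type := EuclideanSpace ℂ (BitStr n)

instance isProbabilityMeasure_haarState (n : ℕ) : IsProbabilityMeasure (haarState n) := by
  constructor
  have h0 : (volume : Measure (Qubits n)).toSphere Set.univ ≠ 0 := by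
    rw [Ne, Measure.measure_univ_eq_zero]
    exact Measure.toSphere_ne_zero _
  simp only [haarState, Measure.smul_apply, smul_eq_mul]
  exact ENNReal.inv_mul_cancel h0 (measure_ne_top _ _)

/-- Haar-random states are invariant under isometries. -/
theorem integral_haarState_isometry (U : Qubits n ≃ₗᵢ[ℝ] Qubits n) (f : UnitStates n → ℝ) :
    ∫ φ, f (sphereMap U φ) ∂haarState n = ∫ φ, f φ ∂haarState n := by
  have hemb : MeasurableEmbedding (sphereMap U) := by
    refine (Homeomorph.mk ⟨sphereMap U, sphereMap U.symm, fun x => Subtype.ext ?_,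
      fun x => Subtype.ext ?_⟩ ?_ ?_ : UnitStates n ≃ₜ UnitStates n).measurableEmbedding
    · exact U.symm_apply_apply _
    · exact U.apply_symm_apply _
    · exact continuous_sphereMap U
    · exact continuous_sphereMap U.symm
  have h := measurePreserving_sphereMap U
  have h' : MeasurePreserving (sphereMap U) (haarState n) (haarState n) :=
    ⟨h.measurable, by rw [haarState, Measure.map_smul, h.map_eq]⟩
  exact h'.integral_comp hemb f

theorem integrable_haarState {f : UnitStates n → ℝ} (hf : Continuous f) :
    Integrable f (haarState n) := by
  rw [← integrableOn_univ]
  exact hf.continuousOn.integrableOn_compact isCompact_univ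

theorem continuous_amplitude (z : BitStr n) :
    Continuous fun φ : UnitStates n => (φ : Qubits n).ofLp z := by
  have : Continuous fun φ : Qubits n => φ.ofLp z := by fun_prop
  exact this.comp continuous_subtype_val

theorem sum_norm_sq_unit (φ : UnitStates n) : ∑ z, ‖(φ : Qubits n).ofLp z‖ ^ 2 = 1 := by
  have h := EuclideanSpace.norm_sq_eq (φ : Qubits n)
  rw [norm_eq_of_mem_sphere φ] at h
  simpa using h.symm

/-- The rotation `(a, b) ↦ ((a + b)/√2, (a - b)/√2)` of two coordinates. -/
noncomputable def rotatePair {z w : BitStr n} (hzw : z ≠ w) : Qubits n ≃ₗᵢ[ℝ] Qubits n :=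
  have hs : (Real.sqrt 2 : ℂ) ^ 2 = 2 := by
    rw [← Complex.ofReal_pow, Real.sq_sqrt (by norm_num)]; norm_num
  have hs0 : (Real.sqrt 2 : ℂ) ≠ 0 := by simp
  let f : Qubits n →ₗ[ℝ] Qubits n :=
    { toFun := fun φ => WithLp.toLp 2 fun u =>
        if u = z then (φ.ofLp z + φ.ofLp w) / (Real.sqrt 2 : ℂ)
        else if u = w then (φ.ofLp z - φ.ofLp w) / (Real.sqrt 2 : ℂ) else φ.ofLp u
      map_add' := fun φ ψ => by
        ext u
        simp only [PiLp.add_apply]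
        split_ifs <;> ring
      map_smul' := fun c φ => by
        ext u
        simp only [PiLp.smul_apply, RingHom.id_apply, Complex.real_smul]
        split_ifs <;> ring }
  have hf : Function.Involutive f := fun φ => by
    ext u
    simp only [f, LinearMap.coe_mk, AddHom.coe_mk, if_true, hzw.symm, if_false]
    split_ifs with h1 h2
    · subst h1
      field_simp
      rw [hs]; ring
    · subst h2
      field_simp
      rw [hs]; ring
    · rfl
  { LinearEquiv.ofInvolutive f hf with
    norm_map' := fun φ => by
      change ‖f φ‖ = ‖φ‖
      rw [← sq_eq_sq₀ (norm_nonneg _) (norm_nonneg _), EuclideanSpace.norm_sq_eq,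
        EuclideanSpace.norm_sq_eq]
      have hmem : w ∈ univ.erase z := mem_erase.2 ⟨hzw.symm, mem_univ _⟩
      rw [← add_sum_erase _ _ (mem_univ z), ← add_sum_erase _ _ hmem,
        ← add_sum_erase _ _ (mem_univ z), ← add_sum_erase _ _ hmem]
      rw [← add_assoc, ← add_assoc]
      congr 1
      · simp only [f, LinearMap.coe_mk, AddHom.coe_mk, if_true, hzw.symm, if_false]
        rw [norm_div, norm_div, Complex.norm_real, Real.norm_of_nonneg (Real.sqrt_nonneg _),
          div_pow, div_pow, Real.sq_sqrt (by norm_num)]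
        have := parallelogram_law_with_norm ℝ (φ.ofLp z) (φ.ofLp w)
        linarith
      · refine sum_congr rfl fun u hu => ?_
        simp only [mem_erase, mem_univ, and_true] at hu
        simp [f, hu.1, hu.2] }

theorem rotatePair_apply {z w : BitStr n} (hzw : z ≠ w) (φ : Qubits n) (u : BitStr n) :
    (rotatePair hzw φ).ofLp u =
      if u = z then (φ.ofLp z + φ.ofLp w) / (Real.sqrt 2 : ℂ)
      else if u = w then (φ.ofLp z - φ.ofLp w) / (Real.sqrt 2 : ℂ) else φ.ofLp u := rfl

/-- Rotating two coordinates compares the fourth moments with the mixed moment. -/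
theorem fourth_moment_pair {z w : BitStr n} (hzw : z ≠ w) :
    (∫ φ, ‖(φ : Qubits n).ofLp z‖ ^ 4 ∂haarState n) +
        ∫ φ, ‖(φ : Qubits n).ofLp w‖ ^ 4 ∂haarState n ≤
      6 * ∫ φ, ‖(φ : Qubits n).ofLp z‖ ^ 2 * ‖(φ : Qubits n).ofLp w‖ ^ 2 ∂haarState n := by
  have hc : ∀ (u : BitStr n) (k : ℕ),
      Continuous fun φ : UnitStates n => ‖(φ : Qubits n).ofLp u‖ ^ k :=
    fun u k => (continuous_amplitude u).norm.pow k
  have hz := integrable_haarState (hc z 4)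
  have hw := integrable_haarState (hc w 4)
  have hmix : Integrable (fun φ : UnitStates n =>
      ‖(φ : Qubits n).ofLp z‖ ^ 2 * ‖(φ : Qubits n).ofLp w‖ ^ 2) (haarState n) :=
    integrable_haarState ((hc z 2).mul (hc w 2))
  have hsum : Integrable (fun φ : UnitStates n =>
      ‖(φ : Qubits n).ofLp z‖ ^ 4 + ‖(φ : Qubits n).ofLp w‖ ^ 4) (haarState n) := hz.add hw
  have h1 := integral_haarState_isometry (rotatePair hzw) fun φ =>
    ‖(φ : Qubits n).ofLp z‖ ^ 4 + ‖(φ : Qubits n).ofLp w‖ ^ 4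
  have hcont : Continuous fun φ : UnitStates n =>
      ‖(φ : Qubits n).ofLp z‖ ^ 4 + ‖(φ : Qubits n).ofLp w‖ ^ 4 := (hc z 4).add (hc w 4)
  have hrot := integrable_haarState (hcont.comp (continuous_sphereMap (rotatePair hzw)))
  have h2 : ∫ φ, (fun φ : UnitStates n => ‖(φ : Qubits n).ofLp z‖ ^ 4 +
      ‖(φ : Qubits n).ofLp w‖ ^ 4) (sphereMap (rotatePair hzw) φ) ∂haarState n ≤
      ∫ φ, ((1 / 2 : ℝ) * (‖(φ : Qubits n).ofLp z‖ ^ 4 + ‖(φ : Qubits n).ofLp w‖ ^ 4) +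
        3 * (‖(φ : Qubits n).ofLp z‖ ^ 2 * ‖(φ : Qubits n).ofLp w‖ ^ 2)) ∂haarState n := by
    refine integral_mono hrot ((hsum.const_mul _).add (hmix.const_mul _)) fun φ => ?_
    simp only [sphereMap, rotatePair_apply, if_true, hzw.symm, if_false]
    rw [norm_div, norm_div, Complex.norm_real, Real.norm_of_nonneg (Real.sqrt_nonneg _)]
    set u := (φ : Qubits n).ofLp z
    set v := (φ : Qubits n).ofLp w
    have e4 : ∀ x : ℂ, (‖x‖ / Real.sqrt 2) ^ 4 = (‖x‖ ^ 2) ^ 2 / 4 := by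
      intro x
      rw [div_pow, show (Real.sqrt 2) ^ 4 = (Real.sqrt 2 ^ 2) ^ 2 by ring,
        Real.sq_sqrt (by norm_num)]
      ring
    have e4' : ∀ x : ℂ, ‖x‖ ^ 4 = (‖x‖ ^ 2) ^ 2 := fun x => by ring
    simp only [e4, e4', ← Complex.normSq_eq_norm_sq, Complex.normSq_apply, Complex.add_re,
      Complex.add_im, Complex.sub_re, Complex.sub_im]
    -- `|u + v|⁴ + |u - v|⁴ = 2 (|u|² + |v|²)² + 8 (Re ūv)²` and `(Re ūv)² ≤ |u|² |v|²`
    nlinarith [sq_nonneg (u.re * v.im - u.im * v.re)]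
  rw [h1] at h2
  rw [integral_add (hsum.const_mul _) (hmix.const_mul _), integral_const_mul,
    integral_const_mul, integral_add hz hw] at h2
  linarith

/-- The comparison of the fourth moments with the mixed moments, summed over all pairs of
coordinates; the moments of order `2 + 2` of all pairs add up to one. -/
theorem integral_sum_fourth_le :
    ∫ φ, ∑ z, (‖(φ : Qubits n).ofLp z‖ ^ 2) ^ 2 ∂haarState n ≤ 3 / 2 ^ n := by
  have hc : ∀ (u : BitStr n) (k : ℕ),
      Continuous fun φ : UnitStates n => ‖(φ : Qubits n).ofLp u‖ ^ k :=
    fun u k => (continuous_amplitude u).norm.pow k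
  set b : BitStr n → BitStr n → ℝ := fun z w =>
    ∫ φ, ‖(φ : Qubits n).ofLp z‖ ^ 2 * ‖(φ : Qubits n).ofLp w‖ ^ 2 ∂haarState n with hb
  have hA : ∫ φ, ∑ z, (‖(φ : Qubits n).ofLp z‖ ^ 2) ^ 2 ∂haarState n = ∑ z, b z z := by
    rw [integral_finsetSum]
    · simp only [hb, sq (‖_‖ ^ 2)]
    · intro z _
      exact integrable_haarState ((hc z 2).pow 2)
  have htot : ∑ z, ∑ w, b z w = 1 := by
    have h1 : ∫ φ : UnitStates n, ∑ z, ∑ w,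
        ‖(φ : Qubits n).ofLp z‖ ^ 2 * ‖(φ : Qubits n).ofLp w‖ ^ 2 ∂haarState n = 1 := by
      simp only [← sum_mul_sum, sum_norm_sq_unit]
      simp
    rw [← h1, integral_finsetSum]
    · refine sum_congr rfl fun z _ => ?_
      rw [integral_finsetSum]
      intro w _
      exact integrable_haarState ((hc z 2).mul (hc w 2))
    · intro z _
      exact integrable_haarState (continuous_finsetSum _ fun w _ => (hc z 2).mul (hc w 2))
  have h4 : ∀ z, ∫ φ, ‖(φ : Qubits n).ofLp z‖ ^ 4 ∂haarState n = b z z := by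
    intro z
    simp only [hb, ← pow_add]
  -- the correction on the diagonal turns `6 * b z z` into the exact value `2 * b z z`
  have hpair : ∀ z w, b z z + b w w ≤ 6 * b z w + if z = w then -4 * b z z else 0 := by
    intro z w
    by_cases h : z = w
    · subst h
      simp only [if_true]
      linarith
    · have := fourth_moment_pair h
      rw [h4, h4] at this
      simpa [h] using this
  have hs := sum_le_sum fun z (_ : z ∈ (univ : Finset (BitStr n))) =>
    sum_le_sum fun w (_ : w ∈ (univ : Finset (BitStr n))) => hpair z w
  have hcard : (Fintype.card (BitStr n) : ℝ) = 2 ^ n := by simp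
  simp only [sum_add_distrib, sum_const, card_univ, nsmul_eq_mul, ← mul_sum, sum_ite_eq, mem_univ,
    if_true, htot, hcard] at hs
  rw [hA, le_div_iff₀ (by positivity)]
  have hnn : 0 ≤ ∑ z, b z z := sum_nonneg fun z _ => integral_nonneg fun φ => by positivity
  nlinarith

theorem IsEffect.continuous {X : Type} [Fintype X] {Q : (X → ℂ) → ℝ} (hQ : IsEffect Q) :
    Continuous Q := by
  obtain ⟨Y, _, L, hL, -⟩ := hQ
  have : Q = fun ψ => ∑ y, ‖L ψ y‖ ^ 2 := funext hL
  rw [this]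
  have hc : Continuous L := L.continuous_of_finiteDimensional
  fun_prop

/-- Flipping the signs of coordinates. -/
noncomputable def signFlip (r : BitStr n → Bool) : Qubits n ≃ₗᵢ[ℝ] Qubits n :=
  LinearIsometryEquiv.piLpCongrRight 2 fun z =>
    if r z then LinearIsometryEquiv.neg ℝ else LinearIsometryEquiv.refl ℝ ℂ

theorem signFlip_apply (r : BitStr n → Bool) (φ : Qubits n) (z : BitStr n) :
    (signFlip r φ).ofLp z = (sgn (r z) : ℂ) * φ.ofLp z := by
  by_cases h : r z <;> simp [signFlip, sgn, h]

/-- The probability that an observer accepts `t` copies of a Haar-random state is close to the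
probability for a random symmetric vector of distinct basis states. -/
theorem haar_copies {t : ℕ} {Q : ((Fin t → BitStr n) → ℂ) → ℝ} (hQ : IsEffect Q) :
    |(∫ φ, Q (fun x => ∏ a, (φ : Qubits n).ofLp (x a)) ∂haarState n) - symAverage Q| ≤
      3 * (t : ℝ) ^ 2 / 2 ^ n := by
  set G : UnitStates n → ℝ := fun φ => Q fun x => ∏ a, (φ : Qubits n).ofLp (x a) with hG
  have hGc : Continuous G := by
    refine hQ.continuous.comp (continuous_pi fun x => ?_)
    exact continuous_finsetProd _ fun a _ => continuous_amplitude _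
  set W : (Fin t → BitStr n) → UnitStates n → ℝ := fun y φ =>
    ∏ a, ‖(φ : Qubits n).ofLp (y a)‖ ^ 2 with hW
  have hWc : ∀ y, Continuous (W y) := fun y =>
    continuous_finsetProd _ fun a _ => (continuous_amplitude _).norm.pow 2
  set D : UnitStates n → ℝ := fun φ => ∑ y ∈ injTuples t (BitStr n), W y φ * symWeight Q y with hD
  have hDc : Continuous D := continuous_finsetSum _ fun y _ => (hWc y).mul continuous_const
  set w : UnitStates n → ℝ := fun φ => ∑ y ∈ injTuples t (BitStr n), W y φ with hw
  have hwc : Continuous w := continuous_finsetSum _ fun y _ => hWc y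
  set G' : UnitStates n → ℝ := fun φ => 𝔼 r, G (sphereMap (signFlip r) φ) with hG'
  have hG'c : Continuous G' := by
    simp only [hG', Fintype.expect_eq_sum_div_card]
    exact (continuous_finsetSum _ fun r _ =>
      hGc.comp (continuous_sphereMap (signFlip r))).div_const _
  have hGG' : ∫ φ, G' φ ∂haarState n = ∫ φ, G φ ∂haarState n := by
    simp only [hG', Fintype.expect_eq_sum_div_card]
    rw [integral_div, integral_finsetSum]
    · simp only [integral_haarState_isometry]
      simp
    · intro r _
      exact integrable_haarState (hGc.comp (continuous_sphereMap (signFlip r)))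
  -- averaging over signs does not change the integral, and can be evaluated for each state
  have hbd : ∀ φ, D φ ≤ G' φ ∧ G' φ ≤ D φ + (1 - w φ) := by
    intro φ
    have := expect_sign_copies hQ (fun z => (φ : Qubits n).ofLp z) (sum_norm_sq_unit φ)
    simpa only [hG', hG, sphereMap, signFlip_apply] using this
  -- exchangeability: the weight of an injective tuple has the same mean for all tuples
  have hconst : ∀ y ∈ injTuples t (BitStr n), ∀ y' ∈ injTuples t (BitStr n),
      ∫ φ, W y φ ∂haarState n = ∫ φ, W y' φ ∂haarState n := by
    intro y hy y' hy'
    obtain ⟨g, hg⟩ := (Equiv.Perm.isMultiplyPretransitive (BitStr n) t).exists_smul_eq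
      ⟨y, mem_injTuples.1 hy⟩ ⟨y', mem_injTuples.1 hy'⟩
    rw [← integral_haarState_isometry (LinearIsometryEquiv.piLpCongrLeft 2 ℝ ℂ g) (W y')]
    congr 1
    ext φ
    simp only [hW, sphereMap]
    refine prod_congr rfl fun a _ => ?_
    have := congrArg (fun f : Fin t ↪ BitStr n => f a) hg
    simp only [Function.Embedding.smul_apply, Equiv.Perm.smul_def,
      Function.Embedding.coeFn_mk] at this
    simp [← this, LinearIsometryEquiv.piLpCongrLeft_apply, Equiv.piCongrLeft'_apply]
  have hDint : ∫ φ, D φ ∂haarState n = (∫ φ, w φ ∂haarState n) * symAverage Q := by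
    simp only [hD, hw]
    rw [integral_finsetSum _ fun y _ => (integrable_haarState (hWc y)).mul_const _,
      integral_finsetSum _ fun y _ => integrable_haarState (hWc y)]
    simp only [integral_mul_const]
    rcases (injTuples t (BitStr n)).eq_empty_or_nonempty with he | ⟨y₀, hy₀⟩
    · simp [he]
    · rw [sum_congr rfl fun y hy => by rw [hconst y hy y₀ hy₀],
        sum_congr (s₁ := injTuples t (BitStr n)) rfl fun y hy => hconst y hy y₀ hy₀, ← mul_sum,
        sum_const, nsmul_eq_mul, symAverage, mul_right_comm, card_mul_expect, mul_comm]
  have hwint : 1 - ∫ φ, w φ ∂haarState n ≤ 3 * (t : ℝ) ^ 2 / 2 ^ n := by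
    have hone : ∫ _ : UnitStates n, (1 : ℝ) ∂haarState n = 1 := by simp
    have hsub : 1 - ∫ φ, w φ ∂haarState n = ∫ φ, (1 - w φ) ∂haarState n := by
      rw [integral_sub (integrable_const _) (integrable_haarState hwc), hone]
    rw [hsub]
    have h4c : Continuous fun φ : UnitStates n => ∑ z, (‖(φ : Qubits n).ofLp z‖ ^ 2) ^ 2 :=
      continuous_finsetSum _ fun z _ => ((continuous_amplitude z).norm.pow 2).pow 2
    refine (integral_mono ((integrable_const _).sub (integrable_haarState hwc))
      ((integrable_haarState h4c).const_mul ((t : ℝ) ^ 2)) fun φ => ?_).trans ?_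
    · exact collision_bound (fun z => ‖(φ : Qubits n).ofLp z‖ ^ 2) (fun z => by positivity)
        (sum_norm_sq_unit φ)
    · rw [integral_const_mul]
      calc (t : ℝ) ^ 2 * _ ≤ (t : ℝ) ^ 2 * (3 / 2 ^ n) :=
            mul_le_mul_of_nonneg_left integral_sum_fourth_le (by positivity)
        _ = _ := by ring
  have hint : Integrable (fun φ => 1 - w φ) (haarState n) :=
    (integrable_const (1 : ℝ)).sub (integrable_haarState hwc)
  have hlow := integral_mono (integrable_haarState hDc) (integrable_haarState hG'c)
    fun φ => (hbd φ).1
  have hupp := integral_mono (integrable_haarState hG'c)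
    ((integrable_haarState hDc).add hint)
    fun φ => (hbd φ).2
  have hsplit : ∫ φ, (D + fun φ => 1 - w φ) φ ∂haarState n =
      (∫ φ, D φ ∂haarState n) + (1 - ∫ φ, w φ ∂haarState n) := by
    have := integral_add (integrable_haarState hDc) hint
    rw [integral_sub (integrable_const _) (integrable_haarState hwc)] at this
    simpa using this
  have hupp' : ∫ φ, G' φ ∂haarState n ≤
      (∫ φ, D φ ∂haarState n) + (1 - ∫ φ, w φ ∂haarState n) := hupp.trans hsplit.le
  rw [hGG', hDint] at hlow hupp'
  have hJ0 := symAverage_nonneg hQ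
  have hJ1 := symAverage_le_one hQ
  have hw1 : ∫ φ, w φ ∂haarState n ≤ 1 := by
    by_contra! hcon
    have : w ≤ fun _ => (1 : ℝ) := by
      intro φ
      have htot : ∑ y : Fin t → BitStr n, W y φ = 1 := by
        simp only [hW]
        rw [← Fintype.piFinset_univ, ← Finset.prod_univ_sum (fun _ => univ)
          fun _ z => ‖(φ : Qubits n).ofLp z‖ ^ 2]
        simp [sum_norm_sq_unit]
      rw [← htot]
      exact sum_le_univ_sum_of_nonneg fun y => prod_nonneg fun a _ => by positivity
    have := integral_mono (integrable_haarState hwc) (integrable_const (1 : ℝ)) this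
    simp at this
    linarith
  rw [abs_le]
  constructor <;> nlinarith

end TPRS

/-! ### Running circuits -/

namespace TPRS

open Finset

section run

variable {ι : Type} {a b : ℕ} {V W : Type} [DecidableEq V] [DecidableEq W]

theorem OracleGate.act_add (F : ι → BitStr a → BitStr b) (g : OracleGate ι a b W) (ψ φ : State W) :
    g.act F (ψ + φ) = g.act F ψ + g.act F φ := by
  ext z
  rcases g with (i | i | i | ⟨i, j⟩ | ⟨i, j, k⟩) | ⟨i, e⟩ <;>
    simp only [OracleGate.act, Gate.act, Pi.add_apply] <;> (try split_ifs) <;> ring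

theorem OracleGate.act_smul (F : ι → BitStr a → BitStr b) (g : OracleGate ι a b W) (c : ℂ)
    (ψ : State W) : g.act F (c • ψ) = c • g.act F ψ := by
  ext z
  rcases g with (i | i | i | ⟨i, j⟩ | ⟨i, j, k⟩) | ⟨i, e⟩ <;>
    simp only [OracleGate.act, Gate.act, Pi.smul_apply, smul_eq_mul] <;> (try split_ifs) <;> ring

/-- A circuit as a linear map. -/
noncomputable def runLin (F : ι → BitStr a → BitStr b) (C : List (OracleGate ι a b W)) :
    State W →ₗ[ℂ] State W where
  toFun := runOracleGates F C
  map_add' := by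
    induction C with
    | nil => intro ψ φ; rfl
    | cons g C ih =>
      intro ψ φ
      simp only [runOracleGates, List.foldl_cons, OracleGate.act_add] at ih ⊢
      exact ih _ _
  map_smul' := by
    induction C with
    | nil => intro c ψ; rfl
    | cons g C ih =>
      intro c ψ
      simp only [runOracleGates, List.foldl_cons, OracleGate.act_smul] at ih ⊢
      exact ih _ _

theorem runLin_apply (F : ι → BitStr a → BitStr b) (C : List (OracleGate ι a b W)) (ψ : State W) :
    runLin F C ψ = runOracleGates F C ψ := rfl

@[simp] theorem runLin_nil (F : ι → BitStr a → BitStr b) (ψ : State W) : runLin F [] ψ = ψ := rfl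

theorem runLin_cons (F : ι → BitStr a → BitStr b) (g : OracleGate ι a b W)
    (C : List (OracleGate ι a b W)) (ψ : State W) :
    runLin F (g :: C) ψ = runLin F C (g.act F ψ) := rfl

theorem runLin_append (F : ι → BitStr a → BitStr b) (C C' : List (OracleGate ι a b W))
    (ψ : State W) : runLin F (C ++ C') ψ = runLin F C' (runLin F C ψ) := by
  simp [runLin_apply, runOracleGates]

theorem runLin_elem (F : ι → BitStr a → BitStr b) (C : List (Gate W)) (ψ : State W) :
    runLin F (C.map OracleGate.elem) ψ = runGates C ψ := by
  simp only [runLin_apply, runOracleGates, runGates, List.foldl_map]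
  rfl

theorem ket_apply (z z' : W → Bool) : ket z z' = open Classical in if z' = z then 1 else 0 := rfl

theorem eq_sum_ket [Fintype W] (ψ : State W) : ψ = ∑ z, ψ z • ket z := by
  ext z'
  simp [ket_apply]

/-! ### Circuits on a subset of the wires -/

/-- The state `ψ` on the wires in the range of `e`, tensored with the basis state `z` on the
others. -/
noncomputable def embedState (e : V ↪ W) (z : W → Bool) (ψ : State V) : State W := fun w =>
  open Classical in if ∀ u, u ∉ Set.range e → w u = z u then ψ (w ∘ e) else 0

theorem update_agree (e : V ↪ W) (z w : W → Bool) (i : V) (x : Bool) :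
    (∀ u, u ∉ Set.range e → Function.update w (e i) x u = z u) ↔
      ∀ u, u ∉ Set.range e → w u = z u := by
  refine forall_congr' fun u => forall_congr' fun hu => ?_
  rw [Function.update_of_ne]
  rintro rfl
  exact hu ⟨i, rfl⟩

theorem update_comp_embedding (e : V ↪ W) (w : W → Bool) (i : V) (x : Bool) :
    Function.update w (e i) x ∘ e = Function.update (w ∘ e) i x :=
  Function.update_comp_eq_of_injective _ e.injective _ _

theorem embedState_update (e : V ↪ W) (z w : W → Bool) (ψ : State V) (i : V) (x : Bool) :
    embedState e z ψ (Function.update w (e i) x) =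
      embedState e z (fun v => ψ (Function.update v i x)) w := by
  simp only [embedState, update_comp_embedding]
  congr 1
  exact propext (update_agree e z w i x)

theorem embedState_flipBit (e : V ↪ W) (z w : W → Bool) (ψ : State V) (i : V) :
    embedState e z ψ (flipBit w (e i)) = embedState e z (fun v => ψ (flipBit v i)) w := by
  rw [flipBit, embedState_update]
  simp only [embedState, flipBit, Function.comp]

/-- The wires of a circuit with oracle queries, relabelled. -/
def OracleGate.map (e : V ↪ W) : OracleGate ι a b V → OracleGate ι a b W
  | .elem g => .elem (g.map e)
  | .query i e' => .query i (e'.trans e)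

theorem xorInto_embedding {G : BitStr a → BitStr b} (e' : Fin a ⊕ Fin b ↪ V) (e : V ↪ W)
    (w : W → Bool) : xorInto G (e'.trans e) w ∘ e = xorInto G e' (w ∘ e) := by
  ext v
  simp only [xorInto, Function.comp, Function.Embedding.trans_apply, e.injective.eq_iff]

theorem xorInto_agree {G : BitStr a → BitStr b} (e' : Fin a ⊕ Fin b ↪ V) (e : V ↪ W)
    (w : W → Bool) (u : W) (hu : u ∉ Set.range e) : xorInto G (e'.trans e) w u = w u := by
  rw [xorInto, if_neg]
  rintro ⟨j, hj, -⟩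
  exact hu ⟨_, hj⟩

theorem act_map_embedState (F : ι → BitStr a → BitStr b) (e : V ↪ W) (g : OracleGate ι a b V)
    (z : W → Bool) (ψ : State V) :
    (g.map e).act F (embedState e z ψ) = embedState e z (g.act F ψ) := by
  have hne : ∀ i j : V, e i ≠ e j ↔ i ≠ j := fun i j => e.injective.ne_iff
  ext w
  rcases g with (i | i | i | ⟨i, j⟩ | ⟨i, j, k⟩) | ⟨i, e'⟩
  · simp only [OracleGate.map, OracleGate.act, Gate.map, Gate.act, embedState_flipBit]
  · simp only [OracleGate.map, OracleGate.act, Gate.map, Gate.act, embedState_update]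
    simp only [embedState, Function.comp]
    split_ifs <;> simp
  · simp only [OracleGate.map, OracleGate.act, Gate.map, Gate.act, embedState, Function.comp]
    split_ifs <;> simp
  · simp only [OracleGate.map, OracleGate.act, Gate.map, Gate.act, embedState_flipBit, hne]
    simp only [embedState, Function.comp]
    split_ifs <;> rfl
  · simp only [OracleGate.map, OracleGate.act, Gate.map, Gate.act, embedState_flipBit, hne]
    simp only [embedState, Function.comp]
    split_ifs <;> rfl
  · simp only [OracleGate.map, OracleGate.act, embedState, xorInto_embedding]
    congr 1
    refine propext (forall_congr' fun u => forall_congr' fun hu => ?_)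
    rw [xorInto_agree e' e w u hu]

/-- A circuit acts only on its own wires. -/
theorem runLin_map_embedState (F : ι → BitStr a → BitStr b) (e : V ↪ W)
    (C : List (OracleGate ι a b V)) (z : W → Bool) (ψ : State V) :
    runLin F (C.map (OracleGate.map e)) (embedState e z ψ) = embedState e z (runLin F C ψ) := by
  induction C generalizing ψ with
  | nil => rfl
  | cons g C ih => rw [List.map_cons, runLin_cons, runLin_cons, act_map_embedState, ih]

theorem embedState_ket (e : V ↪ W) (z : W → Bool) (v : V → Bool) :
    embedState e z (ket v) = ket (Function.extend e v z) := by
  ext w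
  simp only [embedState, ket_apply]
  by_cases hw : w = Function.extend e v z
  · subst hw
    rw [if_pos fun u hu => Function.extend_apply' _ _ _ fun ⟨x, hx⟩ => hu ⟨x, hx⟩,
      if_pos (Function.extend_comp e.injective _ _), if_pos rfl]
  · rw [if_neg hw]
    split_ifs with h1 h2
    · refine absurd (funext fun u => ?_) hw
      by_cases hu : u ∈ Set.range e
      · obtain ⟨x, rfl⟩ := hu
        rw [e.injective.extend_apply, ← h2, Function.comp]
      · rw [h1 u hu, Function.extend_apply' _ _ _ fun ⟨x, hx⟩ => hu ⟨x, hx⟩]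
    · rfl
    · rfl

theorem extend_comp_self (e : V ↪ W) (z : W → Bool) : Function.extend e (z ∘ e) z = z := by
  ext u
  by_cases hu : ∃ x, e x = u
  · obtain ⟨x, rfl⟩ := hu
    rw [e.injective.extend_apply, Function.comp]
  · rw [Function.extend_apply' _ _ _ hu]

theorem ket_eq_embedState (e : V ↪ W) (z : W → Bool) : ket z = embedState e z (ket (z ∘ e)) := by
  rw [embedState_ket, extend_comp_self]

theorem runLin_map_ket (F : ι → BitStr a → BitStr b) (e : V ↪ W)
    (C : List (OracleGate ι a b V)) (z : W → Bool) :
    runLin F (C.map (OracleGate.map e)) (ket z) = embedState e z (runLin F C (ket (z ∘ e))) := by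
  rw [← runLin_map_embedState, ← ket_eq_embedState]

theorem embedState_extend (e : V ↪ W) (z : W → Bool) (ψ : State V) (v : V → Bool) :
    embedState e z ψ (Function.extend e v z) = ψ v := by
  rw [embedState, if_pos fun u hu => Function.extend_apply' _ _ _ fun ⟨x, hx⟩ => hu ⟨x, hx⟩,
    Function.extend_comp e.injective]

theorem extend_injective (e : V ↪ W) (z : W → Bool) :
    Function.Injective fun v : V → Bool => Function.extend e v z := fun v v' h => by
  have := congrArg (fun w : W → Bool => w ∘ e) h
  simpa only [Function.extend_comp e.injective] using this

theorem probOne_embedState [Fintype V] [Fintype W] (e : V ↪ W) (z : W → Bool) (ψ : State V)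
    (out : V) : probOne (e out) (embedState e z ψ) = probOne out ψ := by
  symm
  refine Fintype.sum_of_injective (fun v : V → Bool => Function.extend e v z)
    (extend_injective e z) _ _ ?_ ?_
  · intro w hw
    have h0 : embedState e z ψ w = 0 := by
      refine if_neg fun h => ?_
      refine hw ⟨w ∘ e, funext fun u => ?_⟩
      by_cases hu : ∃ x, e x = u
      · obtain ⟨x, rfl⟩ := hu
        simp [e.injective.extend_apply]
      · exact (Function.extend_apply' _ _ _ hu).trans (h u fun ⟨x, hx⟩ => hu ⟨x, hx⟩).symm
    simp [h0]
  · intro v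
    rw [embedState_extend, e.injective.extend_apply]

theorem embedState_add (e : V ↪ W) (z : W → Bool) (ψ φ : State V) :
    embedState e z (ψ + φ) = embedState e z ψ + embedState e z φ := by
  ext w
  simp only [embedState, Pi.add_apply]
  split_ifs <;> simp

theorem embedState_smul (e : V ↪ W) (z : W → Bool) (c : ℂ) (ψ : State V) :
    embedState e z (c • ψ) = c • embedState e z ψ := by
  ext w
  simp only [embedState, Pi.smul_apply]
  split_ifs <;> simp

theorem embedState_sum (e : V ↪ W) (z : W → Bool) {X : Type*} (s : Finset X) (ψ : X → State V) :
    embedState e z (∑ x ∈ s, ψ x) = ∑ x ∈ s, embedState e z (ψ x) := by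
  classical
  induction s using Finset.induction_on with
  | empty =>
    ext w
    simp [embedState]
  | insert x s hx ih => rw [sum_insert hx, sum_insert hx, embedState_add, ih]

/-- An oracle circuit may be given on an arbitrary finite set of wires, all of them initialized to
`|0⟩`. -/
theorem exists_oracleCircuit {n : ℕ} [Fintype V] (C : List (OracleGate ι n b V)) (out : V) :
    ∃ A : OracleCircuit ι n b, A.size = C.length ∧
      ∀ F, A.prob F = probOne out (runLin F C (ket fun _ => false)) := by
  let e : V ↪ Fin n ⊕ Fin (Fintype.card V) :=
    (Fintype.equivFin V).toEmbedding.trans Function.Embedding.inr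
  refine ⟨⟨Fintype.card V, C.map (OracleGate.map e), e out⟩, by simp [OracleCircuit.size],
    fun F => ?_⟩
  rw [OracleCircuit.prob, ← runLin_apply, runLin_map_ket, probOne_embedState]
  rfl

/-! ### Circuits that permute basis states -/

/-- The registers of a keyed circuit that hold the argument and the value. -/
def ioWires {l p q anc : ℕ} (e : Fin l ⊕ Fin p ⊕ Fin q ⊕ Fin anc ↪ W) : Fin p ⊕ Fin q ↪ W where
  toFun := Sum.elim (fun i => e (.inr (.inl i))) fun j => e (.inr (.inr (.inl j)))
  inj' := by
    rintro (i | i) (j | j) h <;> simpa using e.injective h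

@[simp] theorem ioWires_inl {l p q anc : ℕ} (e : Fin l ⊕ Fin p ⊕ Fin q ⊕ Fin anc ↪ W) (i : Fin p) :
    ioWires e (.inl i) = e (.inr (.inl i)) := rfl

@[simp] theorem ioWires_inr {l p q anc : ℕ} (e : Fin l ⊕ Fin p ⊕ Fin q ⊕ Fin anc ↪ W) (j : Fin q) :
    ioWires e (.inr j) = e (.inr (.inr (.inl j))) := rfl

/-- A keyed circuit, placed on some wires of a larger system. -/
def KeyedCircuit.place {l p q : ℕ} (C : KeyedCircuit l p q)
    (e : Fin l ⊕ Fin p ⊕ Fin q ⊕ Fin C.anc ↪ W) : List (OracleGate ι a b W) :=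
  C.gates.map fun g => .elem (g.map e)

theorem KeyedCircuit.runLin_place {l p q : ℕ} (C : KeyedCircuit l p q) {G : BitStr p → BitStr q}
    {k : BitStr l} (hC : ∀ x y, runGates C.gates (ket (assign k x y)) =
      ket (assign k x fun j => xor (y j) (G x j)))
    (e : Fin l ⊕ Fin p ⊕ Fin q ⊕ Fin C.anc ↪ W) (F : ι → BitStr a → BitStr b) (z : W → Bool)
    (hk : ∀ i, z (e (.inl i)) = k i) (hanc : ∀ i, z (e (.inr (.inr (.inr i)))) = false) :
    runLin F (C.place e) (ket z) = ket (xorInto G (ioWires e) z) := by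
  have h1 : (C.place e : List (OracleGate ι a b W)) =
      (C.gates.map OracleGate.elem).map (OracleGate.map e) := by
    simp [KeyedCircuit.place, OracleGate.map]
  have h2 : z ∘ e = assign k (fun i => z (e (.inr (.inl i))))
      fun j => z (e (.inr (.inr (.inl j)))) := by
    ext (i | i | i | i) <;> simp [assign, hk, hanc]
  rw [h1, runLin_map_ket, runLin_elem, h2, hC, embedState_ket]
  congr 1
  ext w
  by_cases hw : ∃ v, e v = w
  · obtain ⟨v, rfl⟩ := hw
    rw [e.injective.extend_apply]
    rcases v with i | i | j | i
    · simp [assign, xorInto, hk]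
    · simp [assign, xorInto]
    · by_cases hG : G (fun i => z (e (.inr (.inl i)))) j = true <;>
        simp [assign, xorInto, hG]
    · simp [assign, xorInto, hanc]
  · rw [Function.extend_apply' _ _ _ hw, xorInto, if_neg]
    rintro ⟨j, hj, -⟩
    exact hw ⟨_, hj⟩

theorem act_X_ket (z : W → Bool) (i : W) : (Gate.X i).act (ket z) = ket (flipBit z i) := by
  ext w
  simp only [Gate.act, ket_apply]
  congr 1
  refine propext ⟨fun h => ?_, fun h => ?_⟩
  · rw [← h]; simp [flipBit]
  · rw [h]; simp [flipBit]

theorem flipBit_flipBit (z : W → Bool) (i : W) : flipBit (flipBit z i) i = z := by simp [flipBit]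

theorem flipBit_of_ne (z : W → Bool) {i j : W} (h : j ≠ i) : flipBit z i j = z j := by
  simp [flipBit, h]

theorem flipBit_self (z : W → Bool) (i : W) : flipBit z i i = !z i := by simp [flipBit]

theorem ket_comp_involutive {f : (W → Bool) → W → Bool} (hf : Function.Involutive f)
    (z : W → Bool) : (fun w => ket z (f w)) = ket (f z) := by
  ext w
  simp only [ket_apply]
  congr 1
  exact propext ⟨fun h => by rw [← h, hf], fun h => by rw [h, hf]⟩

theorem condFlip_involutive (p : (W → Bool) → Bool) (k : W) (hp : ∀ z, p (flipBit z k) = p z) :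
    Function.Involutive fun z => if p z then flipBit z k else z := by
  intro z
  dsimp only
  by_cases h : p z
  · simp [h, hp, flipBit_flipBit]
  · simp [h]

theorem act_CX_ket (z : W → Bool) {i j : W} (h : i ≠ j) :
    (Gate.CX i j).act (ket z) = ket (if z i then flipBit z j else z) := by
  rw [← ket_comp_involutive (condFlip_involutive (fun z => z i) j fun z => flipBit_of_ne z h)]
  ext w
  simp only [Gate.act, ne_eq, h, not_false_eq_true, true_and]
  split_ifs <;> rfl

theorem act_CCX_ket (z : W → Bool) {i j k : W} (h : i ≠ k) (h' : j ≠ k) :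
    (Gate.CCX i j k).act (ket z) = ket (if z i && z j then flipBit z k else z) := by
  rw [← ket_comp_involutive (condFlip_involutive (fun z => z i && z j) k
    fun z => by simp [flipBit_of_ne, h, h'])]
  ext w
  simp only [Gate.act, ne_eq, h, h', not_false_eq_true, true_and, Bool.and_eq_true]
  split_ifs <;> rfl

theorem xorInto_involutive (G : BitStr a → BitStr b) (e : Fin a ⊕ Fin b ↪ W) :
    Function.Involutive (xorInto G e) := by
  intro z
  have h : (fun i => xorInto G e z (e (Sum.inl i))) = fun i => z (e (Sum.inl i)) := by
    ext i
    simp [xorInto]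
  ext w
  rw [xorInto, h]
  simp only [xorInto]
  split_ifs <;> simp

theorem act_query_ket (F : ι → BitStr a → BitStr b) (i : ι) (e : Fin a ⊕ Fin b ↪ W)
    (z : W → Bool) :
    (OracleGate.query i e).act F (ket z) = ket (xorInto (F i) e z) :=
  ket_comp_involutive (xorInto_involutive _ _) z

/-- A list of steps each of which adds to the wires in `Tg` a mask that depends only on the other
wires adds to them the sum of the masks. -/
theorem runLin_flatMap_xor {P : Type*} (F : ι → BitStr a → BitStr b)
    (S : P → List (OracleGate ι a b W)) (D : P → (W → Bool) → W → Bool)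
    (Good : (W → Bool) → Prop) (Tg : Set W)
    (hrun : ∀ p z, Good z → runLin F (S p) (ket z) = ket fun w => xor (z w) (D p z w))
    (hloc : ∀ p z z', (∀ w ∉ Tg, z w = z' w) → D p z = D p z')
    (hTg : ∀ p z, ∀ w ∉ Tg, D p z w = false)
    (hGood : ∀ z z', (∀ w ∉ Tg, z w = z' w) → Good z → Good z')
    (l : List P) (z : W → Bool) (hz : Good z) :
    runLin F (l.flatMap S) (ket z) =
      ket fun w => xor (z w) (decide (Odd (l.countP fun p => D p z w))) := by
  induction l generalizing z with
  | nil => simp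
  | cons p l ih =>
    have hz' : ∀ w ∉ Tg, z w = xor (z w) (D p z w) := fun w hw => by rw [hTg p z w hw]; simp
    rw [List.flatMap_cons, runLin_append, hrun p z hz, ih _ (hGood _ _ hz' hz)]
    congr 1
    ext w
    simp only [← hloc _ _ _ hz', List.countP_cons, Bool.xor_assoc]
    congr 1
    cases D p z w <;> simp [Nat.odd_add_one, ← Nat.not_even_iff_odd]

theorem countP_toList {P : Type*} [Fintype P] (f : P → Bool) :
    (univ : Finset P).toList.countP f = #{p | f p = true} := by
  classical
  rw [List.countP_eq_length_filter,
    ← List.toFinset_card_of_nodup ((Finset.nodup_toList _).filter f)]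
  congr 1
  ext
  simp

/-! ### Hadamard gates -/

theorem runLin_hadamards (F : ι → BitStr a → BitStr b) (ws : List W) (hws : ws.Nodup)
    (z : W → Bool) (hz : ∀ w ∈ ws, z w = false) :
    runLin F (ws.map fun w => .elem (.H w)) (ket z) = fun z' =>
      open Classical in if ∀ w, w ∉ ws → z' w = z w then (1 / (Real.sqrt 2 : ℂ)) ^ ws.length
        else 0 := by
  induction ws using List.reverseRecOn with
  | nil =>
    ext z'
    have : z' = z ↔ ∀ w, w ∉ ([] : List W) → z' w = z w := by simp [funext_iff]
    simp only [List.map_nil, runLin_nil, ket_apply, List.length_nil, pow_zero]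
    congr 1
    exact propext this
  | append_singleton ws i ih =>
    rw [List.nodup_append] at hws
    have hi : i ∉ ws := fun h => hws.2.2 i h i (by simp) rfl
    rw [List.map_append, runLin_append, ih hws.1 fun w hw => hz w (by simp [hw])]
    ext z'
    have h1 : ¬ ∀ w, w ∉ ws → Function.update z' i true w = z w := by
      intro h
      have := h i hi
      rw [hz i (by simp)] at this
      simp at this
    have h2 : (∀ w, w ∉ ws → Function.update z' i false w = z w) ↔
        ∀ w, w ∉ ws ++ [i] → z' w = z w := by
      constructor
      · intro h w hw
        simp only [List.mem_append, List.mem_singleton, not_or] at hw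
        have := h w hw.1
        rwa [Function.update_of_ne hw.2] at this
      · intro h w hw
        by_cases hwi : w = i
        · subst hwi
          simp [hz]
        · rw [Function.update_of_ne hwi]
          exact h w (by simp [hw, hwi])
    simp only [List.map_cons, List.map_nil, runLin_cons, runLin_nil, OracleGate.act, Gate.act,
      if_neg h1, mul_zero, add_zero, List.length_append, List.length_singleton]
    by_cases h : ∀ w, w ∉ ws ++ [i] → z' w = z w
    · rw [if_pos h, if_pos (h2.2 h), pow_succ]
      ring
    · rw [if_neg h, if_neg fun h' => h (h2.1 h'), zero_div]

/-- Hadamard gates on a register in state `|0⟩` give the uniform superposition. -/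
theorem runLin_hadamards_sum (F : ι → BitStr a → BitStr b) [Fintype V] (e : V ↪ W) (l : List V)
    (hl : l.Nodup) (hmem : ∀ v, v ∈ l) (z : W → Bool) (hz : ∀ v, z (e v) = false) :
    runLin F (l.map fun v => .elem (.H (e v))) (ket z) =
      ∑ x : V → Bool, (1 / (Real.sqrt 2 : ℂ)) ^ Fintype.card V • ket (Function.extend e x z) := by
  have h := runLin_hadamards F (l.map e) (hl.map e.injective) z (by simpa using fun v _ => hz v)
  rw [List.map_map] at h
  refine h.trans ?_
  have hlen : l.length = Fintype.card V := by
    rw [← List.toFinset_card_of_nodup hl, ← Finset.card_univ]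
    congr 1
    ext v
    simp [hmem]
  ext z'
  simp only [Finset.sum_apply, Pi.smul_apply, ket_apply, smul_eq_mul, mul_ite, mul_one, mul_zero,
    List.length_map, hlen]
  split_ifs with h1
  · rw [sum_eq_single (z' ∘ e), if_pos]
    · ext u
      by_cases hu : ∃ x, e x = u
      · obtain ⟨x, rfl⟩ := hu
        simp [e.injective.extend_apply]
      · rw [Function.extend_apply' _ _ _ hu]
        exact h1 u (by simpa [hmem] using hu)
    · intro x _ hx
      rw [if_neg]
      rintro rfl
      exact hx (Function.extend_comp e.injective _ _).symm
    · simp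
  · symm
    refine sum_eq_zero fun x _ => if_neg ?_
    rintro rfl
    refine h1 fun w hw => Function.extend_apply' _ _ _ ?_
    simpa [hmem] using hw

end run

end TPRS

/-! ### Acceptance probabilities as effects -/

namespace TPRS

open Finset

section norm

variable {V W : Type} [DecidableEq V] [DecidableEq W] [Fintype V] [Fintype W]

theorem sum_norm_comp_involutive {f : (W → Bool) → W → Bool} (hf : Function.Involutive f)
    (ψ : State W) : ∑ z, ‖ψ (f z)‖ ^ 2 = ∑ z, ‖ψ z‖ ^ 2 :=
  Fintype.sum_equiv hf.toPerm _ _ fun _ => rfl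

/-- Elementary gates preserve the norm. -/
theorem Gate.sum_norm_act (g : Gate W) (ψ : State W) :
    ∑ z, ‖g.act ψ z‖ ^ 2 = ∑ z, ‖ψ z‖ ^ 2 := by
  rcases g with i | i | i | ⟨i, j⟩ | ⟨i, j, k⟩
  · exact sum_norm_comp_involutive (fun z => flipBit_flipBit z i) ψ
  · have hflip : Function.Involutive fun z : W → Bool => flipBit z i :=
      fun z => flipBit_flipBit z i
    -- pair each basis state with the one in which the bit `i` is flipped
    have hpair : ∀ z, ‖(Gate.H i).act ψ z‖ ^ 2 + ‖(Gate.H i).act ψ (flipBit z i)‖ ^ 2 =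
        ‖ψ z‖ ^ 2 + ‖ψ (flipBit z i)‖ ^ 2 := by
      intro z
      have h2 : ∀ u v : ℂ, ‖(u + v) / (Real.sqrt 2 : ℂ)‖ ^ 2 + ‖(u - v) / (Real.sqrt 2 : ℂ)‖ ^ 2 =
          ‖u‖ ^ 2 + ‖v‖ ^ 2 := by
        intro u v
        rw [norm_div, norm_div, Complex.norm_real, Real.norm_of_nonneg (Real.sqrt_nonneg _),
          div_pow, div_pow, Real.sq_sqrt (by norm_num)]
        have := parallelogram_law_with_norm ℝ u v
        linarith
      have hu : ∀ x, Function.update (flipBit z i) i x = Function.update z i x := by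
        intro x
        simp [flipBit]
      simp only [Gate.act, hu, flipBit_self]
      have hself : Function.update z i (z i) = z := Function.update_eq_self i z
      cases h : z i
      · rw [h] at hself
        simp only [Bool.not_false, if_true, Bool.false_eq_true, if_false, one_mul, neg_mul,
          ← sub_eq_add_neg, flipBit, h, hself]
        exact h2 _ _
      · rw [h] at hself
        simp only [Bool.not_true, if_true, Bool.false_eq_true, if_false, one_mul, neg_mul,
          ← sub_eq_add_neg, flipBit, h, hself]
        rw [add_comm, h2, add_comm]
    have h1 := sum_norm_comp_involutive hflip ψ
    have h2 := sum_norm_comp_involutive hflip ((Gate.H i).act ψ)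
    have h3 := sum_congr (s₁ := univ) rfl fun z _ => hpair z
    rw [sum_add_distrib, sum_add_distrib, h1, h2] at h3
    linarith
  · refine sum_congr rfl fun z _ => ?_
    simp only [Gate.act]
    split_ifs
    · rw [norm_mul, show Complex.I * Real.pi / 4 = ((Real.pi / 4 : ℝ) : ℂ) * Complex.I by
        push_cast; ring, Complex.norm_exp_ofReal_mul_I, one_mul]
    · rw [one_mul]
  · by_cases hij : i = j
    · simp [Gate.act, hij]
    · rw [← sum_norm_comp_involutive
        (condFlip_involutive (fun z => z i) j fun z => flipBit_of_ne z hij) ψ]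
      refine sum_congr rfl fun z _ => ?_
      simp only [Gate.act, ne_eq, hij, not_false_eq_true, true_and]
      split_ifs <;> rfl
  · by_cases hik : i ≠ k ∧ j ≠ k
    · rw [← sum_norm_comp_involutive (condFlip_involutive (fun z => z i && z j) k
        fun z => by simp [flipBit_of_ne, hik.1, hik.2]) ψ]
      refine sum_congr rfl fun z _ => ?_
      simp only [Gate.act, ne_eq, hik.1, hik.2, not_false_eq_true, true_and, Bool.and_eq_true]
      split_ifs <;> rfl
    · refine sum_congr rfl fun z _ => ?_
      simp only [Gate.act]
      rw [if_neg fun h => hik ⟨h.1, h.2.1⟩]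

theorem sum_norm_runGates (C : List (Gate W)) (ψ : State W) :
    ∑ z, ‖runGates C ψ z‖ ^ 2 = ∑ z, ‖ψ z‖ ^ 2 := by
  induction C generalizing ψ with
  | nil => rfl
  | cons g C ih => exact (ih (g.act ψ)).trans (g.sum_norm_act ψ)

theorem sum_norm_embedState (e : V ↪ W) (z : W → Bool) (ψ : State V) :
    ∑ w, ‖embedState e z ψ w‖ ^ 2 = ∑ v, ‖ψ v‖ ^ 2 := by
  symm
  refine Fintype.sum_of_injective (fun v : V → Bool => Function.extend e v z)
    (extend_injective e z) _ _ ?_ fun v => by rw [embedState_extend]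
  intro w hw
  have h0 : embedState e z ψ w = 0 := by
    refine if_neg fun h => hw ⟨w ∘ e, funext fun u => ?_⟩
    by_cases hu : ∃ x, e x = u
    · obtain ⟨x, rfl⟩ := hu
      simp [e.injective.extend_apply]
    · exact (Function.extend_apply' _ _ _ hu).trans (h u fun ⟨x, hx⟩ => hu ⟨x, hx⟩).symm
  simp [h0]

end norm

/-- The amplitudes of a state of `t` registers of `n` qubits, as a state of `t * n` qubits. -/
def joinCopies {t n : ℕ} (Φ : (Fin t → BitStr n) → ℂ) : State (Fin (t * n)) :=
  fun z => Φ fun i j => z (finProdFinEquiv (i, j))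

/-- The acceptance probability of an observer of `t` registers of `n` qubits. -/
noncomputable def accept {t n : ℕ} (A : Distinguisher (t * n)) (Φ : (Fin t → BitStr n) → ℂ) : ℝ :=
  A.prob (joinCopies Φ)

theorem Distinguisher.prob_eq {N : ℕ} (A : Distinguisher N) (ψ : State (Fin N)) :
    A.prob ψ = probOne A.out
      (runGates A.gates (embedState Function.Embedding.inl (fun _ => false) ψ)) := by
  rw [Distinguisher.prob]
  congr 2
  ext z
  simp only [embedState]
  congr 1
  refine propext ⟨fun h u hu => ?_, fun h j => h _ (by simp)⟩
  rcases u with u | u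
  · exact absurd ⟨u, rfl⟩ hu
  · exact h u

theorem sum_norm_joinCopies {t n : ℕ} (Φ : (Fin t → BitStr n) → ℂ) :
    ∑ z, ‖joinCopies Φ z‖ ^ 2 = ∑ x, ‖Φ x‖ ^ 2 :=
  Fintype.sum_equiv ((Equiv.arrowCongr finProdFinEquiv.symm (Equiv.refl Bool)).trans
    (Equiv.curry _ _ _)) _ _ fun _ => rfl

theorem probOne_le {W : Type} [DecidableEq W] [Fintype W] (out : W) (ψ : State W) :
    probOne out ψ ≤ ∑ z, ‖ψ z‖ ^ 2 := by
  refine sum_le_sum fun z _ => ?_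
  split_ifs
  · exact le_rfl
  · positivity

theorem isEffect_accept {t n : ℕ} (A : Distinguisher (t * n)) : IsEffect (accept A) := by
  let R : ((Fin t → BitStr n) → ℂ) → State (Fin (t * n) ⊕ Fin A.anc) := fun Φ =>
    runLin (ι := Empty) (a := 0) (b := 0) (fun i => i.elim) (A.gates.map OracleGate.elem)
      (embedState Function.Embedding.inl (fun _ => false) (joinCopies Φ))
  have hR : ∀ Φ, accept A Φ = probOne A.out (R Φ) := fun Φ => by
    rw [accept, Distinguisher.prob_eq]
    simp only [R, runLin_elem]
  refine ⟨(Fin (t * n) ⊕ Fin A.anc) → Bool, inferInstance,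
    { toFun := fun Φ z => if z A.out then R Φ z else 0
      map_add' := fun Φ Φ' => ?_
      map_smul' := fun c Φ => ?_ }, fun Φ => ?_, fun Φ => ?_⟩
  · have : joinCopies (Φ + Φ') = joinCopies Φ + joinCopies Φ' := rfl
    ext z
    simp only [R, this, embedState_add, map_add, Pi.add_apply]
    split_ifs <;> simp
  · have : joinCopies (c • Φ) = c • joinCopies Φ := rfl
    ext z
    simp only [R, this, embedState_smul, map_smul, Pi.smul_apply, RingHom.id_apply]
    split_ifs <;> simp
  · rw [hR]
    refine sum_congr rfl fun z _ => ?_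
    simp only [LinearMap.coe_mk, AddHom.coe_mk]
    split_ifs <;> simp
  · rw [hR]
    refine (probOne_le _ _).trans (le_of_eq ?_)
    simp only [R, runLin_elem]
    rw [sum_norm_runGates, sum_norm_embedState, sum_norm_joinCopies]

/-! ### Multiply controlled NOT gates -/

section mcx

variable {W : Type} [DecidableEq W]

/-- The Toffoli gate with target `c'` controlled by the bit `c` and by the condition that wire `w`
holds the bit `b`. -/
def ctrlStep (w : W) (b : Bool) (c c' : W) : List (Gate W) :=
  if b then [.CCX w c c'] else [.X w, .CCX w c c', .X w]

/-- Starting from the flag `ch d`, compute into `ch (d + 1)`, `ch (d + 2)`, … whether longer and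
longer initial segments of the list of conditions hold, add the last flag to the target, and
uncompute the flags. -/
def ctrlChain (ch : ℕ → W) (tgt : W) : List (W × Bool) → ℕ → List (Gate W)
  | [], d => [.CX (ch d) tgt]
  | p :: L, d => ctrlStep p.1 p.2 (ch d) (ch (d + 1)) ++ ctrlChain ch tgt L (d + 1) ++
      ctrlStep p.1 p.2 (ch d) (ch (d + 1))

/-- A NOT gate on `tgt` controlled by a list of conditions on other wires, with ancillas `ch`. -/
def mcx (ch : ℕ → W) (tgt : W) (L : List (W × Bool)) : List (Gate W) :=
  .X (ch 0) :: (ctrlChain ch tgt L 0 ++ [.X (ch 0)])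

/-- Whether a list of conditions holds. -/
def conds (L : List (W × Bool)) (z : W → Bool) : Bool := L.all fun p => z p.1 == p.2

theorem conds_iff (L : List (W × Bool)) (z : W → Bool) :
    conds L z = true ↔ ∀ p ∈ L, z p.1 = p.2 := by
  simp [conds]

theorem conds_congr {L : List (W × Bool)} {z z' : W → Bool} (h : ∀ p ∈ L, z p.1 = z' p.1) :
    conds L z = conds L z' := by
  rw [Bool.eq_iff_iff, conds_iff, conds_iff]
  exact forall_congr' fun p => forall_congr' fun hp => by rw [h p hp]

theorem length_ctrlStep (w : W) (b : Bool) (c c' : W) : (ctrlStep w b c c').length ≤ 3 := by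
  cases b <;> simp [ctrlStep]

theorem length_ctrlChain (ch : ℕ → W) (tgt : W) (L : List (W × Bool)) (d : ℕ) :
    (ctrlChain ch tgt L d).length ≤ 6 * L.length + 1 := by
  induction L generalizing d with
  | nil => simp [ctrlChain]
  | cons p L ih =>
    have h1 := ih (d + 1)
    have h2 := length_ctrlStep p.1 p.2 (ch d) (ch (d + 1))
    simp only [ctrlChain, List.length_append, List.length_cons]
    omega

theorem length_mcx (ch : ℕ → W) (tgt : W) (L : List (W × Bool)) :
    (mcx ch tgt L).length ≤ 6 * L.length + 3 := by
  have := length_ctrlChain ch tgt L 0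
  simp only [mcx, List.length_cons, List.length_append, List.length_nil]
  omega

theorem runGates_append (C C' : List (Gate W)) (ψ : State W) :
    runGates (C ++ C') ψ = runGates C' (runGates C ψ) := by
  simp [runGates]

theorem runGates_cons (g : Gate W) (C : List (Gate W)) (ψ : State W) :
    runGates (g :: C) ψ = runGates C (g.act ψ) := rfl

theorem runGates_nil (ψ : State W) : runGates [] ψ = ψ := rfl

theorem flipBit_comm (z : W → Bool) {i j : W} (h : i ≠ j) :
    flipBit (flipBit z i) j = flipBit (flipBit z j) i := by
  rw [flipBit, flipBit_of_ne _ h.symm, flipBit, flipBit, flipBit_of_ne _ h, flipBit,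
    Function.update_comm h]

theorem runGates_ctrlStep (w : W) (b : Bool) {c c' : W} (h : w ≠ c') (h' : c ≠ c') (hw : w ≠ c)
    (z : W → Bool) :
    runGates (ctrlStep w b c c') (ket z) =
      ket (if (z w == b) && z c then flipBit z c' else z) := by
  cases b
  · simp only [ctrlStep, Bool.false_eq_true, if_false, runGates_cons, runGates_nil, act_X_ket,
      act_CCX_ket _ h h', flipBit_self, flipBit_of_ne _ hw.symm]
    cases hzw : z w <;> cases hzc : z c <;>
      simp [flipBit_flipBit, flipBit_comm z h]
  · simp only [ctrlStep, if_true, runGates_cons, runGates_nil, act_CCX_ket _ h h']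
    simp

theorem runGates_ctrlChain {ch : ℕ → W} {tgt : W} (L : List (W × Bool)) (d : ℕ)
    (hch : ∀ i j, i ≤ d + L.length → j ≤ d + L.length → ch i = ch j → i = j)
    (htgt : ∀ i ≤ d + L.length, ch i ≠ tgt) (hL : ∀ p ∈ L, p.1 ≠ tgt)
    (hLch : ∀ p ∈ L, ∀ i ≤ d + L.length, p.1 ≠ ch i) (z : W → Bool)
    (hz : ∀ i ≤ d + L.length, d < i → z (ch i) = false) :
    runGates (ctrlChain ch tgt L d) (ket z) =
      ket (if z (ch d) && conds L z then flipBit z tgt else z) := by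
  induction L generalizing d z with
  | nil =>
    simp only [ctrlChain, runGates_cons, runGates_nil, act_CX_ket z (htgt d (by simp))]
    simp [conds]
  | cons p L ih =>
    simp only [List.length_cons] at *
    have hne : ch d ≠ ch (d + 1) := fun h => by
      have := hch d (d + 1) (by omega) (by omega) h
      omega
    have hp1 : p.1 ≠ ch (d + 1) := hLch p (by simp) _ (by omega)
    have hp0 : p.1 ≠ ch d := hLch p (by simp) _ (by omega)
    have hpt : p.1 ≠ tgt := hL p (by simp)
    have hct : ch d ≠ tgt := htgt d (by omega)
    have hct' : ch (d + 1) ≠ tgt := htgt _ (by omega)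
    have hz1 : z (ch (d + 1)) = false := hz _ (by omega) (by omega)
    have ih' := fun z' hz' => ih (d + 1) (fun i j hi hj => hch i j (by omega) (by omega))
      (fun i hi => htgt i (by omega)) (fun q hq => hL q (by simp [hq]))
      (fun q hq i hi => hLch q (by simp [hq]) i (by omega)) z' hz'
    rw [ctrlChain, runGates_append, runGates_append, runGates_ctrlStep _ _ hp1 hne hp0]
    by_cases hc : ((z p.1 == p.2) && z (ch d)) = true
    · rw [if_pos hc, ih']
      · have hmem : conds L (flipBit z (ch (d + 1))) = conds L z :=
          conds_congr fun q hq => flipBit_of_ne _ (hLch q (by simp [hq]) _ (by omega))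
        rw [hmem, flipBit_self, hz1]
        simp only [Bool.and_eq_true, beq_iff_eq] at hc
        have hcons : conds (p :: L) z = conds L z := by simp [conds, hc.1]
        rw [hcons, hc.2]
        simp only [Bool.not_false, Bool.true_and]
        split_ifs with hall
        · rw [runGates_ctrlStep _ _ hp1 hne hp0, flipBit_of_ne _ hpt, flipBit_of_ne _ hp1,
            flipBit_of_ne _ hct, flipBit_of_ne _ hne, hc.1, hc.2]
          simp only [beq_self_eq_true, Bool.and_self, if_true]
          rw [flipBit_comm _ hct', flipBit_flipBit]
        · rw [runGates_ctrlStep _ _ hp1 hne hp0, flipBit_of_ne _ hp1,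
            flipBit_of_ne _ hne, hc.1, hc.2]
          simp [flipBit_flipBit]
      · intro i hi hdi
        rw [flipBit_of_ne]
        · exact hz i (by omega) (by omega)
        · intro h
          have := hch i (d + 1) (by omega) (by omega) h
          omega
    · rw [if_neg hc, ih']
      · have hfalse : ¬ (z (ch d) && conds (p :: L) z) = true := by
          rw [Bool.and_eq_true, conds_iff]
          rintro ⟨h1, h2⟩
          refine hc ?_
          simp [h1, h2 p (by simp)]
        rw [hz1, if_neg (by simp), if_neg hfalse, runGates_ctrlStep _ _ hp1 hne hp0, if_neg hc]
      · intro i hi hdi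
        exact hz i (by omega) (by omega)

theorem runGates_mcx {ch : ℕ → W} {tgt : W} (L : List (W × Bool))
    (hch : ∀ i j, i ≤ L.length → j ≤ L.length → ch i = ch j → i = j)
    (htgt : ∀ i ≤ L.length, ch i ≠ tgt) (hL : ∀ p ∈ L, p.1 ≠ tgt)
    (hLch : ∀ p ∈ L, ∀ i ≤ L.length, p.1 ≠ ch i) (z : W → Bool)
    (hz : ∀ i ≤ L.length, z (ch i) = false) :
    runGates (mcx ch tgt L) (ket z) =
      ket fun w => xor (z w) (decide (w = tgt) && conds L z) := by
  rw [mcx, runGates_cons, runGates_append, act_X_ket, runGates_ctrlChain L 0 (by simpa using hch)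
    (by simpa using htgt) hL (by simpa using hLch)]
  · have hmem : conds L (flipBit z (ch 0)) = conds L z :=
      conds_congr fun q hq => flipBit_of_ne _ (hLch q hq 0 (by simp))
    rw [hmem, flipBit_self, hz 0 (by simp)]
    simp only [Bool.not_false, Bool.true_and]
    split_ifs with hall
    · rw [runGates_cons, runGates_nil, act_X_ket, flipBit_comm _ (htgt 0 (by simp)),
        flipBit_flipBit]
      congr 1
      ext w
      by_cases hw : w = tgt
      · subst hw
        simp [flipBit_self, hall]
      · simp [flipBit_of_ne _ hw, hw]
    · rw [runGates_cons, runGates_nil, act_X_ket, flipBit_flipBit]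
      congr 1
      ext w
      simp [hall]
  · intro i hi h0
    rw [flipBit_of_ne]
    · exact hz i (by simpa using hi)
    · intro h
      have := hch i 0 (by simpa using hi) (by simp) h
      omega

end mcx

end TPRS

/-! ### Preparation of subset phase states -/

namespace TPRS

open Finset

section steps

variable {ι : Type} {a b : ℕ} {W : Type} [DecidableEq W]

/-- Steps that modify different components of a configuration act independently. -/
theorem runLin_flatMap_update {A M : Type*} [DecidableEq A] (F : ι → BitStr a → BitStr b)
    (S : A → List (OracleGate ι a b W)) (K : (A → M) → W → Bool) (g : A → M → M)
    (hS : ∀ i v, runLin F (S i) (ket (K v)) = ket (K (Function.update v i (g i (v i)))))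
    (l : List A) (hl : l.Nodup) (hmem : ∀ i, i ∈ l) (v : A → M) :
    runLin F (l.flatMap S) (ket (K v)) = ket (K fun i => g i (v i)) := by
  have key : ∀ l : List A, l.Nodup → ∀ v, runLin F (l.flatMap S) (ket (K v)) =
      ket (K fun i => if i ∈ l then g i (v i) else v i) := by
    intro l
    induction l with
    | nil => intro _ v; simp
    | cons i l ih =>
      intro hl v
      rw [List.nodup_cons] at hl
      rw [List.flatMap_cons, runLin_append, hS, ih hl.2]
      congr 2
      ext j
      by_cases hj : j = i
      · subst hj
        simp [hl.1]
      · simp [hj]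
  rw [key l hl]
  simp [hmem]

theorem runLin_flatMap_smul {A : Type*} (F : ι → BitStr a → BitStr b)
    (S : A → List (OracleGate ι a b W)) (c : A → ℂ) (ψ : State W)
    (hS : ∀ i, runLin F (S i) ψ = c i • ψ) (l : List A) :
    runLin F (l.flatMap S) ψ = (l.map c).prod • ψ := by
  induction l with
  | nil => simp
  | cons i l ih =>
    rw [List.flatMap_cons, runLin_append, hS, map_smul, ih, smul_smul, List.map_cons,
      List.prod_cons]

theorem runLin_X_list (F : ι → BitStr a → BitStr b) (ws : List W) (hws : ws.Nodup)
    (z : W → Bool) : runLin F (ws.map fun w => .elem (.X w)) (ket z) =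
      ket fun w => if w ∈ ws then !z w else z w := by
  induction ws generalizing z with
  | nil => simp
  | cons i ws ih =>
    rw [List.nodup_cons] at hws
    rw [List.map_cons, runLin_cons, OracleGate.act, act_X_ket, ih hws.2]
    congr 1
    ext w
    by_cases hw : w = i
    · subst hw
      simp [hws.1, flipBit_self]
    · simp [hw, flipBit_of_ne]

theorem act_H_ket (z : W → Bool) (i : W) : (Gate.H i).act (ket z) =
    (1 / (Real.sqrt 2 : ℂ)) • (ket (Function.update z i false) +
      (sgn (z i) : ℂ) • ket (Function.update z i true)) := by
  have hk : ∀ (w : W → Bool) (x : Bool), ket z (Function.update w i x) =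
      if z i = x then ket (Function.update z i (w i)) w else 0 := by
    intro w x
    simp only [ket_apply]
    by_cases h : Function.update w i x = z
    · have hzi : z i = x := by rw [← h]; simp
      rw [if_pos h, if_pos hzi, if_pos]
      rw [← h]; simp
    · rw [if_neg h]
      split_ifs with h1 h2
      · refine absurd ?_ h
        conv_lhs => rw [h2]
        rw [← h1]; simp
      · rfl
      · rfl
  have hk' : ∀ (w : W → Bool) (x : Bool), ket (Function.update z i x) w =
      if w i = x then ket (Function.update z i (w i)) w else 0 := by
    intro w x
    split_ifs with h
    · rw [h]
    · rw [ket_apply, if_neg]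
      rintro rfl
      simp at h
  ext w
  simp only [Gate.act, hk, Pi.smul_apply, Pi.add_apply, smul_eq_mul, hk' w false, hk' w true]
  cases z i <;> cases w i <;> simp [sgn, div_eq_inv_mul]

/-- Phase kickback: a NOT gate with a controlling condition, applied to a qubit in state
`(|0⟩ - |1⟩)/√2`, gives a sign. -/
theorem runLin_kickback (F : ι → BitStr a → BitStr b) (p : W) (C : List (OracleGate ι a b W))
    (z : W → Bool) (hz : z p = false) (c : Bool)
    (hC : ∀ x, runLin F C (ket (Function.update z p x)) = ket (Function.update z p (xor x c))) :
    runLin F ([.elem (.X p), .elem (.H p)] ++ C ++ [.elem (.H p), .elem (.X p)]) (ket z) =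
      (sgn c : ℂ) • ket z := by
  have hs : (1 / (Real.sqrt 2 : ℂ)) * (1 / (Real.sqrt 2 : ℂ)) = 1 / 2 := by
    rw [div_mul_div_comm, one_mul, ← Complex.ofReal_mul, Real.mul_self_sqrt (by norm_num)]
    norm_num
  have hX : (Gate.X p).act (ket z) = ket (Function.update z p true) := by
    rw [act_X_ket, flipBit, hz]; rfl
  have hX0 : (Gate.X p).act (ket (Function.update z p true)) = ket (Function.update z p false) := by
    rw [act_X_ket, flipBit]; simp
  have hz0 : Function.update z p false = z := by rw [← hz]; simp
  have hpre : runLin F [.elem (.X p), .elem (.H p)] (ket z) =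
      (1 / (Real.sqrt 2 : ℂ)) • (ket z + (-1 : ℂ) • ket (Function.update z p true)) := by
    simp only [runLin_cons, runLin_nil, OracleGate.act, hX]
    rw [act_H_ket]
    simp [sgn, hz0]
  have hmid : runLin F C ((1 / (Real.sqrt 2 : ℂ)) •
      (ket z + (-1 : ℂ) • ket (Function.update z p true))) =
      (sgn c : ℂ) • (1 / (Real.sqrt 2 : ℂ)) •
        (ket z + (-1 : ℂ) • ket (Function.update z p true)) := by
    have h0 := hC false
    have h1 := hC true
    rw [hz0] at h0
    rw [map_smul, map_add, map_smul, h0, h1]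
    cases c
    · simp [sgn, hz0]
    · ext w
      simp only [sgn, hz0, Bool.bne_true, Bool.not_true, Bool.not_false, if_true, Pi.smul_apply,
        Pi.add_apply, smul_eq_mul, Complex.ofReal_neg, Complex.ofReal_one]
      ring
  have hpost : runLin F [.elem (.H p), .elem (.X p)] ((1 / (Real.sqrt 2 : ℂ)) •
      (ket z + (-1 : ℂ) • ket (Function.update z p true))) = ket z := by
    have e1 : runLin F [.elem (.H p), .elem (.X p)] (ket z) =
        (1 / (Real.sqrt 2 : ℂ)) • (ket (Function.update z p true) + ket z) := by
      simp only [runLin_cons, runLin_nil, OracleGate.act, act_H_ket]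
      have := (OracleGate.act_smul F (.elem (.X p)) (1 / (Real.sqrt 2 : ℂ))
        (ket (Function.update z p false) +
          (sgn (z p) : ℂ) • ket (Function.update z p true))).trans (by
            rw [OracleGate.act_add, OracleGate.act_smul])
      refine this.trans ?_
      simp [OracleGate.act, hX0, hX, hz, sgn, hz0]
    have e2 : runLin F [.elem (.H p), .elem (.X p)] (ket (Function.update z p true)) =
        (1 / (Real.sqrt 2 : ℂ)) • (ket (Function.update z p true) + (-1 : ℂ) • ket z) := by
      simp only [runLin_cons, runLin_nil, OracleGate.act, act_H_ket]
      have := (OracleGate.act_smul F (.elem (.X p)) (1 / (Real.sqrt 2 : ℂ))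
        (ket (Function.update z p false) +
          (-1 : ℂ) • ket (Function.update z p true))).trans (by
            rw [OracleGate.act_add, OracleGate.act_smul])
      refine Eq.trans ?_ (this.trans ?_)
      · simp [OracleGate.act, sgn]
      · simp [OracleGate.act, hX0, hX, hz0]
    rw [map_smul, map_add, map_smul, e1, e2]
    ext w
    simp only [Pi.add_apply, Pi.smul_apply, smul_eq_mul]
    linear_combination (2 * ket z w) * hs
  rw [runLin_append, runLin_append, hpre, hmid, map_smul, hpost]

end steps

section prep

variable {ι : Type} {a b : ℕ} {W : Type} [DecidableEq W] {t n m : ℕ}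

/-- The configuration of a system with two groups of `t` registers of `n` wires each, which hold `u`
and `v`; the other wires hold the bits `z₀`. -/
noncomputable def regCfg (r : (Fin t × Fin n) ⊕ (Fin t × Fin n) ↪ W) (z₀ : W → Bool)
    (u v : Fin t → BitStr n) : W → Bool :=
  Function.extend r (Sum.elim (fun q => u q.1 q.2) fun q => v q.1 q.2) z₀

/-- Register `i` of the first group as argument, of the second as value. -/
def regFwd (r : (Fin t × Fin n) ⊕ (Fin t × Fin n) ↪ W) (i : Fin t) : Fin n ⊕ Fin n ↪ W where
  toFun := Sum.elim (fun j => r (.inl (i, j))) fun j => r (.inr (i, j))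
  inj' := by rintro (j | j) (j' | j') h <;> simpa using r.injective h

/-- Register `i` of the second group as argument, of the first as value. -/
def regBwd (r : (Fin t × Fin n) ⊕ (Fin t × Fin n) ↪ W) (i : Fin t) : Fin n ⊕ Fin n ↪ W where
  toFun := Sum.elim (fun j => r (.inr (i, j))) fun j => r (.inl (i, j))
  inj' := by rintro (j | j) (j' | j') h <;> simpa using r.injective h

/-- Register `i` of the second group as argument, the wire `p` as value. -/
def regPhase (r : (Fin t × Fin n) ⊕ (Fin t × Fin n) ↪ W) (p : W) (hp : p ∉ Set.range r)
    (i : Fin t) : Fin n ⊕ Fin 1 ↪ W where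
  toFun := Sum.elim (fun j => r (.inr (i, j))) fun _ => p
  inj' := by
    rintro (j | j) (j' | j') h
    · simpa using r.injective h
    · exact absurd ⟨_, h⟩ hp
    · exact absurd ⟨_, h.symm⟩ hp
    · simp [Subsingleton.elim j j']

variable (r : (Fin t × Fin n) ⊕ (Fin t × Fin n) ↪ W) (z₀ : W → Bool)

@[simp] theorem regCfg_inl (u v : Fin t → BitStr n) (q : Fin t × Fin n) :
    regCfg r z₀ u v (r (.inl q)) = u q.1 q.2 := by
  rw [regCfg, r.injective.extend_apply]; rfl

@[simp] theorem regCfg_inr (u v : Fin t → BitStr n) (q : Fin t × Fin n) :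
    regCfg r z₀ u v (r (.inr q)) = v q.1 q.2 := by
  rw [regCfg, r.injective.extend_apply]; rfl

theorem regCfg_of_notMem (u v : Fin t → BitStr n) {w : W} (hw : w ∉ Set.range r) :
    regCfg r z₀ u v w = z₀ w :=
  Function.extend_apply' _ _ _ fun ⟨x, hx⟩ => hw ⟨x, hx⟩

theorem xorInto_regFwd (G : BitStr n → BitStr n) (u v : Fin t → BitStr n) (i : Fin t) :
    xorInto G (regFwd r i) (regCfg r z₀ u v) =
      regCfg r z₀ u (Function.update v i fun j => xor (v i j) (G (u i) j)) := by
  have harg : (fun j => regCfg r z₀ u v (regFwd r i (.inl j))) = u i := by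
    ext j
    exact regCfg_inl r z₀ u v (i, j)
  have hout : ∀ j, regFwd r i (.inr j) = r (.inr (i, j)) := fun j => rfl
  ext w
  rw [xorInto, harg]
  simp only [hout]
  by_cases hw : w ∈ Set.range r
  · obtain ⟨⟨i', j'⟩ | ⟨i', j'⟩, rfl⟩ := hw
    · simp
    · simp only [regCfg_inr, r.injective.eq_iff, Sum.inr.injEq, Prod.mk.injEq]
      by_cases hi : i' = i
      · subst hi
        cases h : G (u i') j' <;> simp [h]
      · simp [Function.update_of_ne hi, Ne.symm hi]
  · rw [regCfg_of_notMem r z₀ _ _ hw, if_neg, regCfg_of_notMem r z₀ _ _ hw]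
    rintro ⟨j, hj, -⟩
    exact hw ⟨_, hj⟩

theorem xorInto_regBwd (G : BitStr n → BitStr n) (u v : Fin t → BitStr n) (i : Fin t) :
    xorInto G (regBwd r i) (regCfg r z₀ u v) =
      regCfg r z₀ (Function.update u i fun j => xor (u i j) (G (v i) j)) v := by
  have harg : (fun j => regCfg r z₀ u v (regBwd r i (.inl j))) = v i := by
    ext j
    exact regCfg_inr r z₀ u v (i, j)
  have hout : ∀ j, regBwd r i (.inr j) = r (.inl (i, j)) := fun j => rfl
  ext w
  rw [xorInto, harg]
  simp only [hout]
  by_cases hw : w ∈ Set.range r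
  · obtain ⟨⟨i', j'⟩ | ⟨i', j'⟩, rfl⟩ := hw
    · simp only [regCfg_inl, r.injective.eq_iff, Sum.inl.injEq, Prod.mk.injEq]
      by_cases hi : i' = i
      · subst hi
        cases h : G (v i') j' <;> simp [h]
      · simp [Function.update_of_ne hi, Ne.symm hi]
    · simp
  · rw [regCfg_of_notMem r z₀ _ _ hw, if_neg, regCfg_of_notMem r z₀ _ _ hw]
    rintro ⟨j, hj, -⟩
    exact hw ⟨_, hj⟩

theorem xorInto_regPhase (f : BitStr n → Bool) (u v : Fin t → BitStr n) {p : W}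
    (hp : p ∉ Set.range r) (i : Fin t) (x : Bool) :
    xorInto (fun y (_ : Fin 1) => f y) (regPhase r p hp i)
      (Function.update (regCfg r z₀ u v) p x) =
        Function.update (regCfg r z₀ u v) p (xor x (f (v i))) := by
  have hne : ∀ q, r q ≠ p := fun q h => hp ⟨q, h⟩
  have harg : (fun j => Function.update (regCfg r z₀ u v) p x (regPhase r p hp i (.inl j))) =
      v i := by
    ext j
    refine (Function.update_of_ne (hne _) _ _).trans ?_
    exact regCfg_inr r z₀ u v (i, j)
  have hout : ∀ j, regPhase r p hp i (.inr j) = p := fun j => rfl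
  ext w
  rw [xorInto, harg]
  simp only [hout]
  by_cases hw : w = p
  · subst hw
    cases h : f (v i) <;> simp
  · simp [Function.update_of_ne hw, Ne.symm hw]

/-- Preparation of `t` copies of a subset phase state: a superposition of all `x`, the evaluation of
the permutation, the erasure of `x` by the inverse permutation, and the phase. -/
def prepGates (l : List (Fin t × Fin m)) (hmn : m ≤ n) (p : W)
    (S S' Fp : Fin t → List (OracleGate ι a b W)) : List (OracleGate ι a b W) :=
  (l.map fun q => .elem (.H (r (.inl (q.1, Fin.castLE hmn q.2))))) ++
    (List.finRange t).flatMap S ++ (List.finRange t).flatMap S' ++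
    (List.finRange t).flatMap fun i =>
      [.elem (.X p), .elem (.H p)] ++ Fp i ++ [.elem (.H p), .elem (.X p)]

theorem subsetPhaseState_apply (f : BitStr n → Bool) (σ : Equiv.Perm (BitStr n)) (y : BitStr n) :
    subsetPhaseState m f σ y = ∑ x : BitStr m, (1 / (Real.sqrt 2 : ℂ)) ^ m *
      (sgn (f (σ (pad n x))) : ℂ) * (if y = σ (pad n x) then 1 else 0) := by
  rw [subsetPhaseState, Finset.sum_apply]
  refine sum_congr rfl fun x _ => ?_
  rw [Pi.smul_apply, ket_apply, smul_eq_mul]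
  have : (Real.sqrt (2 ^ m) : ℂ) = (Real.sqrt 2 : ℂ) ^ m := by
    rw [← Complex.ofReal_pow]
    congr 1
    rw [Real.sqrt_eq_iff_mul_self_eq (by positivity) (by positivity), ← mul_pow,
      Real.mul_self_sqrt (by norm_num)]
  rw [this]
  congr 1
  · cases f (σ (pad n x)) <;> simp [sgn, neg_div]
  · congr 1

/-- `prepGates` prepares the copies and resets the argument registers, provided that the circuits
`S`, `S'` and `Fp` compute the permutation, its inverse and the phase function. -/
theorem runLin_prepGates (F : ι → BitStr a → BitStr b) (l : List (Fin t × Fin m)) (hl : l.Nodup)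
    (hmem : ∀ q, q ∈ l) (hmn : m ≤ n) (p : W) (hp : p ∉ Set.range r)
    (S S' Fp : Fin t → List (OracleGate ι a b W)) (f : BitStr n → Bool) (σ : Equiv.Perm (BitStr n))
    (hz₀ : ∀ q, z₀ (r q) = false) (hz₀p : z₀ p = false)
    (hS : ∀ i z, (∀ w, w ∉ Set.range r → z w = z₀ w) →
      runLin F (S i) (ket z) = ket (xorInto σ (regFwd r i) z))
    (hS' : ∀ i z, (∀ w, w ∉ Set.range r → z w = z₀ w) →
      runLin F (S' i) (ket z) = ket (xorInto σ.symm (regBwd r i) z))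
    (hF : ∀ i z, (∀ w, w ∉ Set.range r → w ≠ p → z w = z₀ w) →
      runLin F (Fp i) (ket z) = ket (xorInto (fun y _ => f y) (regPhase r p hp i) z)) :
    runLin F (prepGates r l hmn p S S' Fp) (ket z₀) =
      ∑ v : Fin t → BitStr n, (∏ i, subsetPhaseState m f σ (v i)) •
        ket (regCfg r z₀ (fun _ _ => false) v) := by
  let e : Fin t × Fin m ↪ W :=
    ⟨fun q => r (.inl (q.1, Fin.castLE hmn q.2)), fun q q' h => by
      have := r.injective h
      simp only [Sum.inl.injEq, Prod.mk.injEq, Fin.castLE_inj] at this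
      exact Prod.ext this.1 this.2⟩
  have hpad : ∀ y : Fin t × Fin m → Bool, Function.extend e y z₀ =
      regCfg r z₀ (fun i => pad n fun j => y (i, j)) fun _ _ => false := by
    intro y
    ext w
    by_cases hw : w ∈ Set.range r
    · obtain ⟨⟨i, j⟩ | ⟨i, j⟩, rfl⟩ := hw
      · rw [regCfg_inl]
        by_cases hj : (j : ℕ) < m
        · have : r (.inl (i, j)) = e (i, ⟨j, hj⟩) := rfl
          rw [this, e.injective.extend_apply]
          simp [pad, hj]
        · rw [Function.extend_apply', hz₀]
          · simp [pad, hj]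
          · rintro ⟨q, hq⟩
            have := r.injective hq
            simp only [Sum.inl.injEq, Prod.mk.injEq] at this
            exact hj (by rw [← this.2]; exact q.2.2)
      · rw [regCfg_inr, Function.extend_apply', hz₀]
        rintro ⟨q, hq⟩
        simpa using r.injective hq
    · rw [regCfg_of_notMem _ _ _ _ hw, Function.extend_apply']
      rintro ⟨q, hq⟩
      exact hw ⟨_, hq⟩
  -- the Hadamard gates act on the first `m` wires only, so the superposition is over padded strings
  have h1 := runLin_hadamards_sum F e l hl hmem z₀ fun q => hz₀ _
  have h2 : ∀ u v, runLin F ((List.finRange t).flatMap S) (ket (regCfg r z₀ u v)) =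
      ket (regCfg r z₀ u fun i j => xor (v i j) (σ (u i) j)) := fun u v =>
    runLin_flatMap_update F S (fun v => regCfg r z₀ u v) (fun i x j => xor (x j) (σ (u i) j))
      (fun i v => by rw [hS i _ fun w hw => regCfg_of_notMem r z₀ _ _ hw, xorInto_regFwd])
      _ (List.nodup_finRange t) (List.mem_finRange) v
  have h3 : ∀ u v, runLin F ((List.finRange t).flatMap S') (ket (regCfg r z₀ u v)) =
      ket (regCfg r z₀ (fun i j => xor (u i j) (σ.symm (v i) j)) v) := fun u v =>
    runLin_flatMap_update F S' (fun u => regCfg r z₀ u v)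
      (fun i x j => xor (x j) (σ.symm (v i) j))
      (fun i u => by rw [hS' i _ fun w hw => regCfg_of_notMem r z₀ _ _ hw, xorInto_regBwd])
      _ (List.nodup_finRange t) (List.mem_finRange) u
  have h4 : ∀ u v, runLin F ((List.finRange t).flatMap fun i =>
      [.elem (.X p), .elem (.H p)] ++ Fp i ++ [.elem (.H p), .elem (.X p)])
        (ket (regCfg r z₀ u v)) = (∏ i, (sgn (f (v i)) : ℂ)) • ket (regCfg r z₀ u v) := by
    intro u v
    rw [runLin_flatMap_smul F _ (fun i => (sgn (f (v i)) : ℂ)), ← List.ofFn_eq_map, List.prod_ofFn]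
    intro i
    refine runLin_kickback F p (Fp i) _ ?_ _ fun x => ?_
    · rw [regCfg_of_notMem r z₀ _ _ hp, hz₀p]
    · rw [hF, xorInto_regPhase]
      intro w hw hwp
      rw [Function.update_of_ne hwp, regCfg_of_notMem r z₀ _ _ hw]
  have h1' : runLin F (l.map fun q => .elem (.H (r (.inl (q.1, Fin.castLE hmn q.2))))) (ket z₀) =
      _ := h1
  rw [prepGates, runLin_append, runLin_append, runLin_append, h1']
  simp only [map_sum, map_smul, hpad, h2, h3, h4, Bool.false_bne,
    Equiv.symm_apply_apply, Bool.xor_self]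
  have hprod : ∀ v : Fin t → BitStr n, ∏ i, subsetPhaseState m f σ (v i) =
      ∑ y : Fin t → BitStr m, (1 / (Real.sqrt 2 : ℂ)) ^ (t * m) *
        (∏ i, (sgn (f (σ (pad n (y i)))) : ℂ)) *
          if v = (fun i => σ (pad n (y i))) then 1 else 0 := by
    intro v
    simp only [subsetPhaseState_apply]
    rw [Finset.prod_univ_sum, Fintype.piFinset_univ]
    refine sum_congr rfl fun y _ => ?_
    rw [prod_mul_distrib, prod_mul_distrib, prod_const, card_univ, Fintype.card_fin, ← pow_mul,
      mul_comm m t]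
    congr 1
    by_cases hv : v = fun i => σ (pad n (y i))
    · subst hv
      simp
    · rw [if_neg hv]
      obtain ⟨i, hi⟩ := Function.ne_iff.1 hv
      exact prod_eq_zero (mem_univ i) (if_neg hi)
  simp only [hprod, sum_smul]
  rw [sum_comm]
  refine Fintype.sum_equiv (Equiv.curry (Fin t) (Fin m) Bool) _ _ fun y => ?_
  simp only [mul_ite, mul_one, mul_zero, ite_smul, zero_smul, sum_ite_eq', mem_univ,
    if_true, Fintype.card_prod, Fintype.card_fin, smul_smul, Equiv.curry_apply]
  rfl

end prep

end TPRS

/-! ### The adversary against the phase function -/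

namespace TPRS

open Finset

section observer

variable {ι : Type} {a b : ℕ} {W : Type} [DecidableEq W] {t n : ℕ}

/-- The basis state of `t * n` qubits given by `t` registers of `n` bits. -/
def joinBits (v : Fin t → BitStr n) : BitStr (t * n) := fun q =>
  v (finProdFinEquiv.symm q).1 (finProdFinEquiv.symm q).2

@[simp] theorem joinBits_apply (v : Fin t → BitStr n) (i : Fin t) (j : Fin n) :
    joinBits v (finProdFinEquiv (i, j)) = v i j := by
  rw [joinBits, Equiv.symm_apply_apply]

theorem joinCopies_eq_sum (Φ : (Fin t → BitStr n) → ℂ) :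
    joinCopies Φ = ∑ v, Φ v • ket (joinBits v) := by
  have h : ∀ (z : BitStr (t * n)) (v : Fin t → BitStr n),
      z = joinBits v ↔ v = fun i j => z (finProdFinEquiv (i, j)) := by
    intro z v
    constructor
    · rintro rfl
      ext i j
      rw [joinBits_apply]
    · rintro rfl
      ext q
      obtain ⟨⟨i, j⟩, rfl⟩ := finProdFinEquiv.surjective q
      rw [joinBits_apply]
  ext z
  simp [joinCopies, Finset.sum_apply, ket_apply, h]

/-- The registers `r ∘ inr` as input register of an observer on the wires `e`. -/
theorem extend_joinBits {anc : ℕ} (r : (Fin t × Fin n) ⊕ (Fin t × Fin n) ↪ W)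
    (e : Fin (t * n) ⊕ Fin anc ↪ W)
    (he : ∀ i j, e (.inl (finProdFinEquiv (i, j))) = r (.inr (i, j))) (z : W → Bool)
    (hz : ∀ q, z (r (.inl q)) = false) (hanc : ∀ q, z (e (.inr q)) = false)
    (v : Fin t → BitStr n) :
    Function.extend e (Function.extend Function.Embedding.inl (joinBits v) fun _ => false) z =
      regCfg r z (fun _ _ => false) v := by
  have he' : ∀ q, e (.inl q) = r (.inr (finProdFinEquiv.symm q)) := fun q => by
    obtain ⟨⟨i, j⟩, rfl⟩ := finProdFinEquiv.surjective q
    rw [he, Equiv.symm_apply_apply]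
  ext w
  by_cases hwe : ∃ q, e q = w
  · obtain ⟨q | q, rfl⟩ := hwe
    · have hinl : Function.extend (Function.Embedding.inl : Fin (t * n) ↪ Fin (t * n) ⊕ Fin anc)
          (joinBits v) (fun _ => false) (.inl q) = joinBits v q :=
        Function.Embedding.inl.injective.extend_apply _ _ q
      rw [e.injective.extend_apply, hinl, he', regCfg_inr]
      rfl
    · have hinr : Function.extend (Function.Embedding.inl : Fin (t * n) ↪ Fin (t * n) ⊕ Fin anc)
          (joinBits v) (fun _ => false) (.inr q) = false :=
        Function.extend_apply' _ _ _ fun ⟨x, hx⟩ => by simp at hx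
      rw [e.injective.extend_apply, hinr]
      by_cases hw : e (.inr q) ∈ Set.range r
      · obtain ⟨x | ⟨i, j⟩, hx⟩ := hw
        · rw [← hx, regCfg_inl]
        · rw [← he] at hx
          simpa using e.injective hx
      · rw [regCfg_of_notMem _ _ _ _ hw, hanc]
  · rw [Function.extend_apply' _ _ _ hwe]
    by_cases hw : w ∈ Set.range r
    · obtain ⟨x | ⟨i, j⟩, rfl⟩ := hw
      · rw [regCfg_inl, hz]
      · exact absurd ⟨_, he i j⟩ hwe
    · rw [regCfg_of_notMem _ _ _ _ hw]

end observer

/-- The wires of the adversary against the phase function. -/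
inductive PhaseWire (t n ancA l anc anc' : ℕ) : Type
  | sys (w : Fin (t * n) ⊕ Fin ancA)
  | arg (i : Fin t) (j : Fin n)
  | phase
  | key (i : Fin l)
  | anc (i : Fin anc)
  | anc' (i : Fin anc')
deriving DecidableEq, Fintype

namespace PhaseWire

variable {t n ancA l a a' : ℕ}

/-- The two groups of registers: the arguments of the permutation and the input of the observer. -/
def regs : (Fin t × Fin n) ⊕ (Fin t × Fin n) ↪ PhaseWire t n ancA l a a' where
  toFun := Sum.elim (fun q => .arg q.1 q.2) fun q => .sys (.inl (finProdFinEquiv q))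
  inj' := by
    rintro (⟨i, j⟩ | ⟨i, j⟩) (⟨i', j'⟩ | ⟨i', j'⟩) h
    · simp only [Sum.elim_inl, arg.injEq] at h
      rw [h.1, h.2]
    · simp at h
    · simp at h
    · simpa using h

/-- The wires of the circuit for the permutation. -/
def fwd (i : Fin t) : Fin l ⊕ Fin n ⊕ Fin n ⊕ Fin a ↪ PhaseWire t n ancA l a a' where
  toFun := Sum.elim .key (Sum.elim (fun j => .arg i j)
    (Sum.elim (fun j => .sys (.inl (finProdFinEquiv (i, j)))) .anc))
  inj' := by rintro (j | j | j | j) (j' | j' | j' | j') h <;> simp_all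

/-- The wires of the circuit for the inverse permutation. -/
def bwd (i : Fin t) : Fin l ⊕ Fin n ⊕ Fin n ⊕ Fin a' ↪ PhaseWire t n ancA l a a' where
  toFun := Sum.elim .key (Sum.elim (fun j => .sys (.inl (finProdFinEquiv (i, j))))
    (Sum.elim (fun j => .arg i j) .anc'))
  inj' := by rintro (j | j | j | j) (j' | j' | j' | j') h <;> simp_all

/-- The wires of the observer. -/
def obs : Fin (t * n) ⊕ Fin ancA ↪ PhaseWire t n ancA l a a' where
  toFun := .sys
  inj' _ _ h := by simpa using h

@[simp] theorem regs_inl (q : Fin t × Fin n) :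
    regs (ancA := ancA) (l := l) (a := a) (a' := a') (.inl q) = .arg q.1 q.2 := rfl

@[simp] theorem regs_inr (q : Fin t × Fin n) :
    regs (ancA := ancA) (l := l) (a := a) (a' := a') (.inr q) =
      .sys (.inl (finProdFinEquiv q)) := rfl

@[simp] theorem obs_apply (q : Fin (t * n) ⊕ Fin ancA) :
    obs (l := l) (a := a) (a' := a') q = .sys q := rfl

@[simp] theorem fwd_apply (i : Fin t) (q : Fin l ⊕ Fin n ⊕ Fin n ⊕ Fin a) :
    fwd (ancA := ancA) (a' := a') i q = Sum.elim .key (Sum.elim (fun j => .arg i j)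
    (Sum.elim (fun j => .sys (.inl (finProdFinEquiv (i, j)))) .anc)) q := rfl

@[simp] theorem bwd_apply (i : Fin t) (q : Fin l ⊕ Fin n ⊕ Fin n ⊕ Fin a') :
    bwd (ancA := ancA) (a := a) i q = Sum.elim .key (Sum.elim
    (fun j => .sys (.inl (finProdFinEquiv (i, j)))) (Sum.elim (fun j => .arg i j) .anc')) q := rfl

theorem mem_range_regs (w : PhaseWire t n ancA l a a') :
    w ∈ Set.range regs ↔ (∃ i j, w = .arg i j) ∨ ∃ q, w = .sys (.inl q) := by
  constructor
  · rintro ⟨⟨i, j⟩ | ⟨i, j⟩, rfl⟩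
    · exact .inl ⟨i, j, rfl⟩
    · exact .inr ⟨_, rfl⟩
  · rintro (⟨i, j, rfl⟩ | ⟨q, rfl⟩)
    · exact ⟨.inl (i, j), rfl⟩
    · exact ⟨.inr (finProdFinEquiv.symm q), by
        change sys (Sum.inl (finProdFinEquiv (finProdFinEquiv.symm q))) = _
        rw [Equiv.apply_symm_apply]⟩

end PhaseWire

/-- With the key of the permutation fixed, an observer of `t` copies of subset phase states is an
adversary against the phase function. -/
theorem exists_phaseAdversary {t n m l : ℕ} (hmn : m ≤ n) (C C' : KeyedCircuit l n n)
    (σ : Equiv.Perm (BitStr n)) (k : BitStr l)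
    (hC : ∀ x y, runGates C.gates (ket (assign k x y)) =
      ket (assign k x fun j => xor (y j) (σ x j)))
    (hC' : ∀ x y, runGates C'.gates (ket (assign k x y)) =
      ket (assign k x fun j => xor (y j) (σ.symm x j)))
    (A : Distinguisher (t * n)) :
    ∃ B : OracleCircuit Unit n 1, B.size ≤ l + t * (m + C.size + C'.size + 5) + A.size ∧
      ∀ f, B.prob (phaseOracle f) = A.prob (copies t (subsetPhaseState m f σ)) := by
  -- NOT gates on the wires `ks` write the key
  obtain ⟨ks, hks⟩ : ∃ ks : List (PhaseWire t n A.anc l C.anc C'.anc),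
      ks = ((List.finRange l).filter k).map .key := ⟨_, rfl⟩
  have hp : PhaseWire.phase ∉ Set.range (PhaseWire.regs (t := t) (n := n) (ancA := A.anc) (l := l)
      (a := C.anc) (a' := C'.anc)) := by rw [PhaseWire.mem_range_regs]; simp
  obtain ⟨B, hBsize, hB⟩ := exists_oracleCircuit (ι := Unit) (n := n) (b := 1)
    ((ks.map fun w => .elem (.X w)) ++
      prepGates PhaseWire.regs (univ : Finset (Fin t × Fin m)).toList hmn PhaseWire.phase
        (fun i => C.place (PhaseWire.fwd i)) (fun i => C'.place (PhaseWire.bwd i))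
        (fun i => [.query () (regPhase PhaseWire.regs .phase hp i)]) ++
      (A.gates.map OracleGate.elem).map (OracleGate.map PhaseWire.obs)) (PhaseWire.obs A.out)
  refine ⟨B, ?_, fun f => ?_⟩
  · have h1 : ks.length ≤ l := by
      rw [hks, List.length_map]
      exact (List.length_filter_le _ _).trans (by simp)
    rw [hBsize]
    simp only [prepGates, List.length_append, List.length_map, List.length_flatMap,
      List.length_cons, List.length_nil, KeyedCircuit.place, List.map_const', List.sum_replicate,
      List.length_finRange, length_toList, card_univ, Fintype.card_prod, Fintype.card_fin,
      smul_eq_mul, Distinguisher.size, KeyedCircuit.size]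
    nlinarith
  · obtain ⟨z₀, hz₀⟩ : ∃ z₀ : PhaseWire t n A.anc l C.anc C'.anc → Bool,
        z₀ = fun w => decide (w ∈ ks) := ⟨_, rfl⟩
    have hkey : ∀ i, z₀ (.key i) = k i := by
      intro i
      by_cases h : k i = true <;> simp [hz₀, hks, h]
    have hother : ∀ w, (∀ i, w ≠ .key i) → z₀ w = false := by
      intro w hw
      simp only [hz₀, hks, List.mem_map, decide_eq_false_iff_not]
      rintro ⟨i, -, rfl⟩
      exact hw i rfl
    have hnd : ks.Nodup := by
      rw [hks]
      exact ((List.nodup_finRange l).filter _).map fun _ _ h => by simpa using h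
    have hz : (fun w => if w ∈ ks then !(fun _ => false) w else (fun _ => false) w) = z₀ := by
      ext w
      simp [hz₀]
    have hsum : ∑ v : Fin t → BitStr n, (∏ i, subsetPhaseState m f σ (v i)) •
        ket (regCfg PhaseWire.regs z₀ (fun _ _ => false) v) =
          embedState PhaseWire.obs z₀ (embedState Function.Embedding.inl (fun _ => false)
            (copies t (subsetPhaseState m f σ))) := by
      have hc : copies t (subsetPhaseState m f σ) =
        joinCopies fun v => ∏ i, subsetPhaseState m f σ (v i) := rfl
      rw [hc, joinCopies_eq_sum]
      simp only [embedState_sum, embedState_smul, embedState_ket]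
      refine sum_congr rfl fun v _ => ?_
      rw [extend_joinBits PhaseWire.regs PhaseWire.obs (fun i j => rfl) z₀
        (fun q => hother _ (by simp))
        fun q => hother _ (by simp)]
    rw [hB, runLin_append, runLin_append, runLin_X_list _ _ hnd, hz,
      runLin_prepGates PhaseWire.regs z₀ (phaseOracle f) _ (nodup_toList _) (by simp) hmn _ hp
        _ _ _ f σ]
    · rw [hsum, runLin_map_embedState, probOne_embedState, runLin_elem, Distinguisher.prob_eq]
    · rintro (⟨i, j⟩ | ⟨i, j⟩) <;> exact hother _ (by simp)
    · exact hother _ (by simp)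
    · intro i z hz
      refine (C.runLin_place (G := fun x => σ x) hC (PhaseWire.fwd i) _ z (fun j => ?_)
        fun j => ?_).trans ?_
      · rw [hz _ (by rw [PhaseWire.mem_range_regs]; simp)]
        exact hkey j
      · rw [hz _ (by rw [PhaseWire.mem_range_regs]; simp)]
        exact hother _ (by simp)
      · congr 2
    · intro i z hz
      refine (C'.runLin_place (G := fun x => σ.symm x) hC' (PhaseWire.bwd i) _ z (fun j => ?_)
        fun j => ?_).trans ?_
      · rw [hz _ (by rw [PhaseWire.mem_range_regs]; simp)]
        exact hkey j
      · rw [hz _ (by rw [PhaseWire.mem_range_regs]; simp)]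
        exact hother _ (by simp)
      · congr 2
    · intro i z _
      rw [runLin_cons, runLin_nil, act_query_ket]
      rfl

end TPRS

/-! ### The adversary against the permutation -/

namespace TPRS

open Finset

section mcxList

variable {ι : Type} {a b : ℕ} {W P : Type} [DecidableEq W] [Fintype P]

/-- The multiply controlled NOT gates with targets `tgt p` and conditions `L p`, for all `p` with
`en p`. -/
noncomputable def mcxAll (ι : Type) (a b : ℕ) (ch : ℕ → W) (en : P → Bool) (tgt : P → W)
    (L : P → List (W × Bool)) : List (OracleGate ι a b W) :=
  (univ : Finset P).toList.flatMap fun p =>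
    (if en p then mcx ch (tgt p) (L p) else []).map OracleGate.elem

theorem length_mcxAll (ch : ℕ → W) (en : P → Bool) (tgt : P → W) (L : P → List (W × Bool)) {N : ℕ}
    (hN : ∀ p, (L p).length ≤ N) :
    (mcxAll ι a b ch en tgt L).length ≤ Fintype.card P * (6 * N + 3) := by
  rw [mcxAll, List.length_flatMap]
  refine (List.sum_le_card_nsmul _ (6 * N + 3) ?_).trans (by simp)
  intro x hx
  obtain ⟨p, -, rfl⟩ := List.mem_map.1 hx
  rw [List.length_map]
  split_ifs
  · exact (length_mcx _ _ _).trans (by have := hN p; omega)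
  · simp

theorem runLin_mcxAll (F : ι → BitStr a → BitStr b) {ch : ℕ → W} {en : P → Bool} {tgt : P → W}
    {L : P → List (W × Bool)} (Tg : Set W) (N : ℕ)
    (hch : ∀ i j, i ≤ N → j ≤ N → ch i = ch j → i = j) (hchT : ∀ i, ch i ∉ Tg)
    (htgt : ∀ p, tgt p ∈ Tg) (hN : ∀ p, (L p).length ≤ N) (hL : ∀ p, ∀ q ∈ L p, q.1 ∉ Tg)
    (hLch : ∀ p, ∀ q ∈ L p, ∀ i, q.1 ≠ ch i) (z : W → Bool) (hz : ∀ i, z (ch i) = false) :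
    runLin F (mcxAll ι a b ch en tgt L) (ket z) = ket fun w =>
      xor (z w) (decide (Odd #{p | (en p && (decide (w = tgt p) && conds (L p) z)) = true})) := by
  rw [mcxAll, runLin_flatMap_xor F _
    (fun p z w => en p && (decide (w = tgt p) && conds (L p) z)) (fun z => ∀ i, z (ch i) = false)
    Tg ?_ ?_ ?_ ?_ _ z hz]
  · simp only [countP_toList]
  · intro p z hz
    rw [runLin_elem]
    split_ifs with h
    · rw [runGates_mcx _ (fun i j hi hj => hch i j (hi.trans (hN p)) (hj.trans (hN p)))
        (fun i _ h => hchT i (h ▸ htgt p)) (fun q hq h => hL p q hq (h ▸ htgt p))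
        (fun q hq i _ => hLch p q hq i) z fun i _ => hz i, h]
      simp
    · simp [runGates_nil, h]
  · intro p z z' h
    rw [conds_congr fun q hq => h _ (hL p q hq)]
  · intro p z w hw
    have : w ≠ tgt p := fun h => hw (h ▸ htgt p)
    simp [this]
  · intro z z' h hz i
    rw [← h _ (hchT i)]
    exact hz i

theorem decide_odd_card_eq {f : P → Bool} {p : P} (h : ∀ q, f q = true → q = p) :
    decide (Odd #{q | f q = true}) = f p := by
  classical
  cases hp : f p
  · rw [filter_eq_empty_iff.2]
    · simp
    · intro q _ hq
      rw [h q hq, hp] at hq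
      simp at hq
  · have : ({q | f q = true} : Finset P) = {p} := by
      ext q
      simp only [mem_filter, mem_univ, true_and, mem_singleton]
      exact ⟨h q, fun h => h ▸ hp⟩
    rw [this]
    simp

theorem decide_odd_card_false {f : P → Bool} (h : ∀ q, f q = false) :
    decide (Odd #{q | f q = true}) = false := by
  simp [h]

end mcxList

/-- The wires of the adversary against the permutation. -/
inductive PermWire (t n ancA κ d : ℕ) : Type
  | sys (w : Fin (t * n) ⊕ Fin ancA)
  | arg (i : Fin t) (j : Fin n)
  | idx (i : Fin t) (l : Fin κ)
  | par (v : BitStr κ)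
  | col (i i' : Fin t)
  | chain (i : Fin (d + 1))
  | out
deriving DecidableEq, Fintype

namespace PermWire

variable {t n ancA κ d : ℕ}

/-- The two groups of registers: the arguments of the permutation and the input of the observer. -/
def regs : (Fin t × Fin n) ⊕ (Fin t × Fin n) ↪ PermWire t n ancA κ d where
  toFun := Sum.elim (fun q => .arg q.1 q.2) fun q => .sys (.inl (finProdFinEquiv q))
  inj' := by
    rintro (⟨i, j⟩ | ⟨i, j⟩) (⟨i', j'⟩ | ⟨i', j'⟩) h
    · simp only [Sum.elim_inl, arg.injEq] at h
      rw [h.1, h.2]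
    · simp at h
    · simp at h
    · simpa using h

/-- The wires of the observer. -/
def obs : Fin (t * n) ⊕ Fin ancA ↪ PermWire t n ancA κ d where
  toFun := .sys
  inj' _ _ h := by simpa using h

/-- The wires that hold the indices. -/
def idxs : Fin t × Fin κ ↪ PermWire t n ancA κ d where
  toFun q := .idx q.1 q.2
  inj' := by
    rintro ⟨i, j⟩ ⟨i', j'⟩ h
    simp only [idx.injEq] at h
    rw [h.1, h.2]

/-- Ancillas of the multiply controlled NOT gates. -/
def chains (i : ℕ) : PermWire t n ancA κ d := .chain (Fin.ofNat (d + 1) i)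

theorem chains_injOn (i j : ℕ) (hi : i ≤ d) (hj : j ≤ d)
    (h : (chains i : PermWire t n ancA κ d) = chains j) : i = j := by
  simp only [chains, chain.injEq, Fin.ext_iff, Fin.val_ofNat] at h
  rwa [Nat.mod_eq_of_lt (by omega), Nat.mod_eq_of_lt (by omega)] at h

@[simp] theorem regs_inl (q : Fin t × Fin n) :
    regs (ancA := ancA) (κ := κ) (d := d) (.inl q) = .arg q.1 q.2 := rfl

@[simp] theorem regs_inr (q : Fin t × Fin n) :
    regs (ancA := ancA) (κ := κ) (d := d) (.inr q) = .sys (.inl (finProdFinEquiv q)) := rfl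

@[simp] theorem obs_apply (q : Fin (t * n) ⊕ Fin ancA) :
    obs (κ := κ) (d := d) q = .sys q := rfl

@[simp] theorem idxs_apply (q : Fin t × Fin κ) :
    idxs (n := n) (ancA := ancA) (d := d) q = .idx q.1 q.2 := rfl

/-- The configuration with indices `i`, arguments `x`, input `y` of the observer, parities `c` and
collision flags `e`. -/
def cfg (i : Fin t → BitStr κ) (x y : Fin t → BitStr n) (c : BitStr κ → Bool)
    (e : Fin t → Fin t → Bool) : PermWire t n ancA κ d → Bool
  | sys (.inl q) => joinBits y q
  | sys (.inr _) => false
  | arg a j => x a j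
  | idx a l => i a l
  | par v => c v
  | col a b => e a b
  | chain _ => false
  | out => false

theorem cfg_eq_regCfg (i : Fin t → BitStr κ) (x y x' y' : Fin t → BitStr n) (c : BitStr κ → Bool)
    (e : Fin t → Fin t → Bool) :
    (cfg i x y c e : PermWire t n ancA κ d → Bool) = regCfg regs (cfg i x' y' c e) x y := by
  have hn : ∀ w : PermWire t n ancA κ d, (∀ a j, w ≠ arg a j) → (∀ q, w ≠ sys (.inl q)) →
      w ∉ Set.range regs := by
    rintro w h h' ⟨q | q, rfl⟩
    · exact h _ _ (regs_inl q)
    · exact h' _ (regs_inr q)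
  ext w
  rcases w with (q | q) | ⟨a, j⟩ | _ | _ | _ | _ | _
  · obtain ⟨⟨a, j⟩, rfl⟩ := finProdFinEquiv.surjective q
    exact (joinBits_apply y a j).trans (regCfg_inr regs _ x y (a, j)).symm
  · rw [regCfg_of_notMem _ _ _ _ (hn _ (by simp) (by simp))]; rfl
  · exact (regCfg_inl regs _ x y (a, j)).symm
  all_goals rw [regCfg_of_notMem _ _ _ _ (hn _ (by simp) (by simp))]; rfl

/-- The condition that index `a` is `v`. -/
def idxIs (a : Fin t) (v : BitStr κ) : List (PermWire t n ancA κ d × Bool) :=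
  (List.finRange κ).map fun l => (idx a l, v l)

/-- The condition that argument `a` is `x`. -/
def argIs (a : Fin t) (x : BitStr n) : List (PermWire t n ancA κ d × Bool) :=
  (List.finRange n).map fun j => (arg a j, x j)

theorem conds_append {W : Type} (L L' : List (W × Bool)) (z : W → Bool) :
    conds (L ++ L') z = (conds L z && conds L' z) := by
  simp [conds]

theorem conds_idxIs (a : Fin t) (v : BitStr κ) (z : PermWire t n ancA κ d → Bool) :
    conds (idxIs a v) z = decide ((fun l => z (idx a l)) = v) := by
  rw [Bool.eq_iff_iff, conds_iff]
  simp [idxIs, funext_iff]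

theorem conds_argIs (a : Fin t) (x : BitStr n) (z : PermWire t n ancA κ d → Bool) :
    conds (argIs a x) z = decide ((fun j => z (arg a j)) = x) := by
  rw [Bool.eq_iff_iff, conds_iff]
  simp [argIs, funext_iff]

/-- The collision flags of a tuple. -/
def collisions (i : Fin t → BitStr κ) (a b : Fin t) : Bool := decide (a ≠ b ∧ i a = i b)

variable {ι : Type} {p q : ℕ} (F : ι → BitStr p → BitStr q)

/-- The parities of the index tuple are recorded; the indices of a tuple without repetitions are
thereby determined up to their order. -/
theorem run_parity (hd : κ ≤ d) (i : Fin t → BitStr κ) (x y : Fin t → BitStr n)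
    (e : Fin t → Fin t → Bool) :
    runLin F (mcxAll ι p q chains (fun _ => true) (fun s : Fin t × BitStr κ => par s.2)
      fun s => idxIs s.1 s.2) (ket (cfg i x y (fun _ => false) e : PermWire t n ancA κ d → Bool)) =
        ket (cfg i x y (parity i) e) := by
  rw [runLin_mcxAll F {w | ∃ v, w = par v} d chains_injOn (by simp [chains]) (by simp)
    (fun s => by simpa [idxIs] using hd) (by simp [idxIs]) (by simp [idxIs, chains]) _
    fun i => rfl]
  congr 1
  ext w
  simp only [conds_idxIs]
  rcases w with (_ | _) | _ | _ | v | _ | _ | _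
  case par =>
    simp only [cfg, Bool.true_and, Bool.false_bne, parity, Bool.and_eq_true, decide_eq_true_eq]
    congr 2
    refine card_nbij' (fun s => s.1) (fun a => (a, v)) ?_ ?_ ?_ ?_
    · rintro ⟨a, v'⟩ h
      simp only [par.injEq, coe_filter, mem_univ, true_and, Set.mem_ofPred_eq] at h ⊢
      rw [h.1]; exact of_decide_eq_true h.2
    · intro a h
      simp only [coe_filter, mem_univ, true_and, Set.mem_ofPred_eq] at h ⊢
      exact decide_eq_true h
    · rintro ⟨a, v'⟩ h
      simp only [par.injEq, coe_filter, mem_univ, true_and, Set.mem_ofPred_eq] at h ⊢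
      rw [h.1]
    · intro a _
      rfl
  all_goals
    rw [decide_odd_card_false (by simp)]
    simp [cfg]

theorem run_collisions (hd : 2 * κ ≤ d) (i : Fin t → BitStr κ) (x y : Fin t → BitStr n)
    (c : BitStr κ → Bool) :
    runLin F (mcxAll ι p q chains (fun s : (Fin t × Fin t) × BitStr κ => decide (s.1.1 ≠ s.1.2))
      (fun s => col s.1.1 s.1.2) fun s => idxIs s.1.1 s.2 ++ idxIs s.1.2 s.2)
        (ket (cfg i x y c (fun _ _ => false) : PermWire t n ancA κ d → Bool)) =
          ket (cfg i x y c (collisions i)) := by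
  rw [runLin_mcxAll F {w | ∃ a b, w = col a b} d chains_injOn (by simp [chains]) (by simp)
    (by
      intro s
      simp only [idxIs, List.length_append, List.length_map, List.length_finRange]
      omega)
    (by
      intro s w hw
      simp only [idxIs, List.mem_append, List.mem_map] at hw
      obtain ⟨l, -, rfl⟩ | ⟨l, -, rfl⟩ := hw <;> simp)
    (by
      intro s w hw
      simp only [idxIs, List.mem_append, List.mem_map] at hw
      obtain ⟨l, -, rfl⟩ | ⟨l, -, rfl⟩ := hw <;> simp [chains]) _ fun i => rfl]
  congr 1
  ext w
  simp only [conds_append, conds_idxIs]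
  rcases w with (_ | _) | _ | _ | _ | ⟨a, b⟩ | _ | _
  case col =>
    rw [decide_odd_card_eq (p := ((a, b), i a))]
    · simp [cfg, collisions, eq_comm]
    · rintro ⟨⟨a', b'⟩, v⟩ h
      simp only [cfg, col.injEq, Bool.and_eq_true, decide_eq_true_eq] at h
      obtain ⟨-, ⟨rfl, rfl⟩, h, -⟩ := h
      rw [← of_decide_eq_true h]
  all_goals
    rw [decide_odd_card_false (by simp)]
    simp [cfg]

/-- Table lookup: the gate for the index value `v` acts on the register of copy `a` only if index
`a` is `v`. -/
theorem run_lookup (hd : κ ≤ d) (X : BitStr κ → BitStr n) (i : Fin t → BitStr κ)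
    (y : Fin t → BitStr n) (c : BitStr κ → Bool) (e : Fin t → Fin t → Bool) :
    runLin F (mcxAll ι p q chains (fun s : (Fin t × Fin n) × BitStr κ => X s.2 s.1.2)
      (fun s => arg s.1.1 s.1.2) fun s => idxIs s.1.1 s.2)
        (ket (cfg i (fun _ _ => false) y c e : PermWire t n ancA κ d → Bool)) =
          ket (cfg i (fun a => X (i a)) y c e) := by
  rw [runLin_mcxAll F {w | ∃ a j, w = arg a j} d chains_injOn (by simp [chains]) (by simp)
    (fun s => by simpa [idxIs] using hd) (by simp [idxIs]) (by simp [idxIs, chains]) _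
    fun i => rfl]
  congr 1
  ext w
  simp only [conds_idxIs]
  rcases w with (_ | _) | ⟨a, j⟩ | _ | _ | _ | _ | _
  case arg =>
    rw [decide_odd_card_eq (p := ((a, j), i a))]
    · simp [cfg]
    · rintro ⟨⟨a', j'⟩, v⟩ h
      simp only [cfg, arg.injEq, Bool.and_eq_true, decide_eq_true_eq] at h
      obtain ⟨-, ⟨rfl, rfl⟩, h⟩ := h
      rw [← of_decide_eq_true h]
  all_goals
    rw [decide_odd_card_false (by simp)]
    simp [cfg]

/-- Since `X` is injective, the indices can be erased by a lookup in the inverse table. -/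
theorem run_erase (hd : n ≤ d) {X : BitStr κ → BitStr n} (hX : Function.Injective X)
    (i : Fin t → BitStr κ) (y : Fin t → BitStr n) (c : BitStr κ → Bool)
    (e : Fin t → Fin t → Bool) :
    runLin F (mcxAll ι p q chains (fun s : (Fin t × Fin κ) × BitStr κ => s.2 s.1.2)
      (fun s => idx s.1.1 s.1.2) fun s => argIs s.1.1 (X s.2))
        (ket (cfg i (fun a => X (i a)) y c e : PermWire t n ancA κ d → Bool)) =
          ket (cfg (fun _ _ => false) (fun a => X (i a)) y c e) := by
  rw [runLin_mcxAll F {w | ∃ a j, w = idx a j} d chains_injOn (by simp [chains]) (by simp)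
    (fun s => by simpa [argIs] using hd) (by simp [argIs]) (by simp [argIs, chains]) _
    fun i => rfl]
  congr 1
  ext w
  simp only [conds_argIs]
  rcases w with (_ | _) | _ | ⟨a, l⟩ | _ | _ | _ | _
  case idx =>
    rw [decide_odd_card_eq (p := ((a, l), i a))]
    · simp [cfg]
    · rintro ⟨⟨a', j'⟩, v⟩ h
      simp only [cfg, idx.injEq, Bool.and_eq_true, decide_eq_true_eq] at h
      obtain ⟨-, ⟨rfl, rfl⟩, h⟩ := h
      rw [← hX (of_decide_eq_true h)]
  all_goals
    rw [decide_odd_card_false (by simp)]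
    simp [cfg]

end PermWire

end TPRS

/-! ### The success probability of the adversary against the permutation -/

namespace TPRS

open Finset

theorem probOne_sum_ket {S W : Type} [Fintype S] [Fintype W] [DecidableEq W] {g : S → W → Bool}
    (hg : Function.Injective g) (β : S → ℂ) (out : W) :
    probOne out (∑ s, β s • ket (g s)) = ∑ s, if g s out = true then ‖β s‖ ^ 2 else 0 := by
  have happ : ∀ z, (∑ s, β s • ket (g s)) z = ∑ s, if z = g s then β s else 0 := by
    intro z
    simp only [Finset.sum_apply, Pi.smul_apply, ket_apply, smul_eq_mul, mul_ite, mul_one, mul_zero]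
  symm
  refine Fintype.sum_of_injective g hg _ _ ?_ fun s => ?_
  · intro z hz
    rw [happ, sum_eq_zero fun s _ => if_neg fun h => hz ⟨s, h.symm⟩]
    simp
  · rw [happ, sum_eq_single s]
    · rw [if_pos rfl]
    · intro s' _ hs
      exact if_neg fun h => hs (hg h.symm)
    · simp

/-- The final state of an observer run on a basis state. -/
noncomputable def basisRun {t n : ℕ} (A : Distinguisher (t * n)) (y : Fin t → BitStr n) :
    State (Fin (t * n) ⊕ Fin A.anc) :=
  runGates A.gates (embedState Function.Embedding.inl (fun _ => false) (ket (joinBits y)))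

theorem accept_eq_basisRun {t n : ℕ} (A : Distinguisher (t * n)) (Φ : (Fin t → BitStr n) → ℂ) :
    accept A Φ = probOne A.out (∑ y, Φ y • basisRun A y) := by
  rw [accept, Distinguisher.prob_eq]
  congr 1
  simp only [basisRun, ← runLin_elem (ι := Empty) (a := 0) (b := 0) (fun i => i.elim)]
  rw [joinCopies_eq_sum, embedState_sum, map_sum]
  exact sum_congr rfl fun y _ => by rw [embedState_smul, map_smul]

theorem collisions_eq_false_iff {t κ : ℕ} (i : Fin t → BitStr κ) :
    PermWire.collisions i = (fun _ _ => false) ↔ Function.Injective i := by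
  rw [funext_iff]
  simp only [funext_iff (f := PermWire.collisions i _), PermWire.collisions,
    decide_eq_false_iff_not, not_and]
  exact ⟨fun h a b hab => by_contra fun hne => h a b hne hab, fun h a b hne hab => hne (h hab)⟩

/-- A parity class of index tuples without collisions consists of the reorderings of one tuple, so
that recording the parities leaves a mixture of symmetric vectors. -/
theorem sum_parity_class {t n κ : ℕ} {Q : ((Fin t → BitStr n) → ℂ) → ℝ} (hQ : IsEffect Q)
    (Y : BitStr κ → BitStr n) (α : ℂ) :
    ∑ c : BitStr κ → Bool, Q (fun x => ∑ i : Fin t → BitStr κ,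
      if parity i = c ∧ PermWire.collisions i = (fun _ _ => false) then
        (if x = Y ∘ i then α else 0) else 0) =
      ‖α‖ ^ 2 * ∑ i ∈ injTuples t (BitStr κ), symWeight Q (Y ∘ i) := by
  classical
  have hclass : ∀ i₀ : Fin t → BitStr κ, Function.Injective i₀ →
      (fun x => ∑ i : Fin t → BitStr κ,
        if parity i = parity i₀ ∧ PermWire.collisions i = (fun _ _ => false) then
          (if x = Y ∘ i then α else 0) else 0) = α • symVec (Y ∘ i₀) := by
    intro i₀ hi₀
    ext x
    have h1 : ∀ i : Fin t → BitStr κ,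
        (if parity i = parity i₀ ∧ PermWire.collisions i = (fun _ _ => false) then
          (if x = Y ∘ i then α else 0) else 0) =
        if parity i = parity i₀ then (if x = Y ∘ i then α else 0) else 0 := by
      intro i
      by_cases h : parity i = parity i₀
      · obtain ⟨π, rfl⟩ := (parity_eq_iff hi₀ i).1 h
        rw [if_pos ⟨h, (collisions_eq_false_iff _).2 (hi₀.comp π.injective)⟩, if_pos h]
      · rw [if_neg fun h' => h h'.1, if_neg h]
    simp only [h1]
    rw [sum_perm_ne_zero hi₀ fun i => if x = Y ∘ i then α else 0]
    simp only [symVec, Pi.smul_apply, smul_eq_mul, mul_sum, mul_ite, mul_one, mul_zero]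
    rfl
  rw [← sum_subset (subset_univ ((injTuples t (BitStr κ)).image parity))]
  · have h2 : ∀ c ∈ (injTuples t (BitStr κ)).image parity, ∀ i₀, Function.Injective i₀ →
        parity i₀ = c → Q (fun x => ∑ i : Fin t → BitStr κ,
          if parity i = c ∧ PermWire.collisions i = (fun _ _ => false) then
            (if x = Y ∘ i then α else 0) else 0) = ‖α‖ ^ 2 * Q (symVec (Y ∘ i₀)) := by
      rintro c - i₀ hi₀ rfl
      rw [hclass i₀ hi₀, hQ.smul]
    rw [sum_image_parity, mul_sum]
    refine sum_congr rfl fun i hi => ?_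
    rw [h2 _ (mem_image_of_mem _ hi) i (mem_injTuples.1 hi) rfl, symWeight, mul_div_assoc]
  · intro c _ hc
    have h0 : (fun x => ∑ i : Fin t → BitStr κ,
        if parity i = c ∧ PermWire.collisions i = (fun _ _ => false) then
          (if x = Y ∘ i then α else 0) else 0) = (0 : ℂ) • (0 : (Fin t → BitStr n) → ℂ) := by
      ext x
      rw [sum_eq_zero]
      · simp
      · intro i _
        rw [if_neg]
        rintro ⟨rfl, h⟩
        exact hc (mem_image_of_mem _ (mem_injTuples.2 ((collisions_eq_false_iff _).1 h)))
    rw [h0, hQ.smul]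
    simp

namespace PermWire

variable {t n ancA κ d : ℕ}

/-- The conditions that the observer accepts and that no two indices collide. -/
noncomputable def acceptList (o : Fin (t * n) ⊕ Fin ancA) : List (PermWire t n ancA κ d × Bool) :=
  (sys o, true) :: (univ : Finset (Fin t × Fin t)).toList.map fun q => (col q.1 q.2, false)

theorem conds_acceptList (o : Fin (t * n) ⊕ Fin ancA) (z : PermWire t n ancA κ d → Bool) :
    conds (acceptList o) z =
      (z (sys o) && decide ((fun a b => z (col a b)) = fun _ _ => false)) := by
  rw [Bool.eq_iff_iff, conds_iff]
  simp only [acceptList, List.forall_mem_cons, List.forall_mem_map, mem_toList, mem_univ,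
    forall_const, Prod.forall, Bool.and_eq_true, decide_eq_true_eq, funext_iff]

theorem length_acceptList (o : Fin (t * n) ⊕ Fin ancA) :
    (acceptList o : List (PermWire t n ancA κ d × Bool)).length = t * t + 1 := by
  simp [acceptList]

/-- The final configuration: parities, collision flags, the bits of the observer, and the answer. -/
def final (o : Fin (t * n) ⊕ Fin ancA)
    (s : (BitStr κ → Bool) × (Fin t → Fin t → Bool) × (Fin (t * n) ⊕ Fin ancA → Bool)) :
    PermWire t n ancA κ d → Bool
  | sys q => s.2.2 q
  | arg _ _ => false
  | idx _ _ => false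
  | par v => s.1 v
  | col a b => s.2.1 a b
  | chain _ => false
  | out => s.2.2 o && decide (s.2.1 = fun _ _ => false)

theorem final_injective (o : Fin (t * n) ⊕ Fin ancA) :
    Function.Injective (final (κ := κ) (d := d) o) := by
  rintro ⟨c, e, v⟩ ⟨c', e', v'⟩ h
  have h1 : c = c' := funext fun x => congrFun h (par x)
  have h2 : e = e' := funext fun a => funext fun b => congrFun h (col a b)
  have h3 : v = v' := funext fun q => congrFun h (sys q)
  rw [h1, h2, h3]

variable {ι : Type} {p q : ℕ} (F : ι → BitStr p → BitStr q)

theorem run_answer (hd : t * t + 1 ≤ d) (o : Fin (t * n) ⊕ Fin ancA) (c : BitStr κ → Bool)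
    (e : Fin t → Fin t → Bool) (v : Fin (t * n) ⊕ Fin ancA → Bool) :
    runLin F ((mcx chains out (acceptList o)).map .elem) (ket (Function.extend obs v
      (cfg (fun _ _ => false) (fun _ _ => false) (fun _ _ => false) c e :
        PermWire t n ancA κ d → Bool))) = ket (final o (c, e, v)) := by
  have hsys : ∀ z : PermWire t n ancA κ d → Bool, ∀ q, Function.extend obs v z (sys q) = v q :=
    fun z q => obs.injective.extend_apply v z q
  have hne : ∀ z : PermWire t n ancA κ d → Bool, ∀ w, (∀ q, w ≠ sys q) →
      Function.extend obs v z w = z w := fun z w hw =>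
    Function.extend_apply' _ _ _ fun ⟨q, hq⟩ => hw q hq.symm
  rw [runLin_elem, runGates_mcx]
  · congr 1
    ext w
    rw [conds_acceptList, hsys]
    have hcol : (fun a b => Function.extend obs v (cfg (fun _ _ => false) (fun _ _ => false)
        (fun _ _ => false) c e : PermWire t n ancA κ d → Bool) (col a b)) = e := by
      ext a b
      rw [hne _ _ (by simp)]
      rfl
    rw [hcol]
    rcases w with w | _ | _ | _ | _ | _ | _
    · rw [hsys]; simp [final]
    all_goals
      rw [hne _ _ (by simp)]
      simp [cfg, final]
  · intro i j hi hj
    rw [length_acceptList] at hi hj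
    exact chains_injOn i j (hi.trans hd) (hj.trans hd)
  · simp [chains]
  · simp only [acceptList, List.forall_mem_cons, List.forall_mem_map]
    simp
  · simp only [acceptList, List.forall_mem_cons, List.forall_mem_map]
    simp [chains]
  · intro i _
    rw [hne _ _ (by simp [chains])]
    rfl

theorem cfg_eq_extend (A : Distinguisher (t * n)) (y : Fin t → BitStr n) (c : BitStr κ → Bool)
    (e : Fin t → Fin t → Bool) :
    (cfg (fun _ _ => false) (fun _ _ => false) y c e : PermWire t n A.anc κ d → Bool) =
      Function.extend obs (Function.extend Function.Embedding.inl (joinBits y) fun _ => false)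
        (cfg (fun _ _ => false) (fun _ _ => false) (fun _ _ => false) c e) := by
  rw [extend_joinBits regs obs (fun _ _ => rfl) _ (fun _ => rfl) (fun _ => rfl)]
  exact cfg_eq_regCfg _ _ _ _ _ _ _

theorem run_observer (A : Distinguisher (t * n)) (y : Fin t → BitStr n) (c : BitStr κ → Bool)
    (e : Fin t → Fin t → Bool) :
    runLin F ((A.gates.map OracleGate.elem).map (OracleGate.map obs))
      (ket (cfg (fun _ _ => false) (fun _ _ => false) y c e : PermWire t n A.anc κ d → Bool)) =
      ∑ v, basisRun A y v • ket (Function.extend obs v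
        (cfg (fun _ _ => false) (fun _ _ => false) (fun _ _ => false) c e)) := by
  rw [cfg_eq_extend, ← embedState_ket, runLin_map_embedState, ← embedState_ket, runLin_elem]
  change embedState obs _ (basisRun A y) = _
  conv_lhs => rw [eq_sum_ket (basisRun A y)]
  rw [embedState_sum]
  exact sum_congr rfl fun v _ => by rw [embedState_smul, embedState_ket]

theorem run_hadamards :
    runLin F ((univ : Finset (Fin t × Fin κ)).toList.map fun s => .elem (.H (idxs s)))
      (ket fun _ : PermWire t n ancA κ d => false) =
      ∑ i : Fin t → BitStr κ, (1 / (Real.sqrt 2 : ℂ)) ^ (t * κ) • ket (cfg i (fun _ _ => false)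
        (fun _ _ => false) (fun _ => false) fun _ _ => false) := by
  rw [runLin_hadamards_sum F idxs _ (nodup_toList _) (by simp) _ fun _ => rfl]
  refine Fintype.sum_equiv (Equiv.curry (Fin t) (Fin κ) Bool) _ _ fun i => ?_
  rw [Fintype.card_prod, Fintype.card_fin, Fintype.card_fin]
  congr 2
  ext w
  by_cases hw : ∃ s, idxs s = w
  · obtain ⟨s, rfl⟩ := hw
    rw [idxs.injective.extend_apply]
    rfl
  · rw [Function.extend_apply' _ _ _ hw]
    rcases w with (q | q) | _ | ⟨a, l⟩ | _ | _ | _ | _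
    case idx => exact absurd ⟨(a, l), rfl⟩ hw
    all_goals rfl

end PermWire

open PermWire in
/-- An observer of `t` copies gives an adversary against the permutation, which accepts with the
probability with which the observer accepts a superposition of `t` distinct points of the image of
`σ ∘ X`, up to the factor due to the postselection of distinct indices. -/
theorem exists_permAdversary {t n κ : ℕ} {X : BitStr κ → BitStr n} (hX : Function.Injective X)
    (A : Distinguisher (t * n)) :
    ∃ B : OracleCircuit Bool n n,
      B.size ≤ 50 * ((t + 1) * (t + 1) * (κ + 1) * 2 ^ κ * (n + 1)) + A.size ∧
      ∀ π : Equiv.Perm (BitStr n), B.prob (permOracle π) =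
        (1 / (2 : ℝ) ^ (t * κ)) * ∑ i ∈ injTuples t (BitStr κ),
          symWeight (accept A) fun a => π (X (i a)) := by
  obtain ⟨d, hd⟩ : ∃ d, d = 2 * κ + n + t * t + 1 := ⟨_, rfl⟩
  have hκ : κ ≤ d := by omega
  have hlen : ∀ s : Fin t × BitStr κ, (idxIs s.1 s.2 :
      List (PermWire t n A.anc κ d × Bool)).length ≤ κ := fun s => by simp [idxIs]
  obtain ⟨B, hBsize, hB⟩ := exists_oracleCircuit (ι := Bool) (n := n) (b := n)
    ((((univ : Finset (Fin t × Fin κ)).toList.map fun s => .elem (.H (idxs s))) ++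
      mcxAll Bool n n chains (fun _ => true) (fun s : Fin t × BitStr κ => par s.2)
        (fun s => idxIs s.1 s.2) ++
      mcxAll Bool n n chains (fun s : (Fin t × Fin t) × BitStr κ => decide (s.1.1 ≠ s.1.2))
        (fun s => col s.1.1 s.1.2) (fun s => idxIs s.1.1 s.2 ++ idxIs s.1.2 s.2) ++
      mcxAll Bool n n chains (fun s : (Fin t × Fin n) × BitStr κ => X s.2 s.1.2)
        (fun s => arg s.1.1 s.1.2) (fun s => idxIs s.1.1 s.2) ++
      ((List.finRange t).flatMap fun a => [.query true (regFwd regs a)]) ++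
      mcxAll Bool n n chains (fun s : (Fin t × Fin κ) × BitStr κ => s.2 s.1.2)
        (fun s => idx s.1.1 s.1.2) (fun s => argIs s.1.1 (X s.2)) ++
      ((List.finRange t).flatMap fun a => [.query false (regBwd regs a)]) ++
      (A.gates.map OracleGate.elem).map (OracleGate.map obs) ++
      (mcx chains out (acceptList A.out)).map .elem :
        List (OracleGate Bool n n (PermWire t n A.anc κ d)))) out
  refine ⟨B, ?_, fun π => ?_⟩
  · rw [hBsize]
    have h1 := length_mcxAll (ι := Bool) (a := n) (b := n) (W := PermWire t n A.anc κ d) chains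
      (fun _ => true) (fun s : Fin t × BitStr κ => par s.2) (fun s => idxIs s.1 s.2) hlen
    have h2 := length_mcxAll (ι := Bool) (a := n) (b := n) (W := PermWire t n A.anc κ d) chains
      (fun s : (Fin t × Fin t) × BitStr κ => decide (s.1.1 ≠ s.1.2))
        (fun s => col s.1.1 s.1.2) (fun s => idxIs s.1.1 s.2 ++ idxIs s.1.2 s.2) (N := 2 * κ) (by
          intro s
          simp only [idxIs, List.length_append, List.length_map, List.length_finRange]
          omega)
    have h3 := length_mcxAll (ι := Bool) (a := n) (b := n) (W := PermWire t n A.anc κ d) chains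
      (fun s : (Fin t × Fin n) × BitStr κ => X s.2 s.1.2)
        (fun s => arg s.1.1 s.1.2) (fun s => idxIs s.1.1 s.2) fun s => hlen (s.1.1, s.2)
    have h4 := length_mcxAll (ι := Bool) (a := n) (b := n) (W := PermWire t n A.anc κ d) chains
      (fun s : (Fin t × Fin κ) × BitStr κ => s.2 s.1.2)
        (fun s => idx s.1.1 s.1.2) (fun s => argIs s.1.1 (X s.2)) (N := n) fun s => by simp [argIs]
    have h5 := length_mcx (chains (t := t) (n := n) (ancA := A.anc) (κ := κ) (d := d)) out
      (acceptList A.out)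
    rw [length_acceptList] at h5
    simp only [Fintype.card_prod, Fintype.card_fin, Fintype.card_pi, Fintype.card_bool,
      prod_const, card_univ] at h1 h2 h3 h4
    simp only [List.length_append, List.length_map, List.length_flatMap,
      List.length_cons, List.length_nil, List.map_const', List.sum_replicate,
      List.length_finRange, length_toList, card_univ, Fintype.card_prod, Fintype.card_fin,
      smul_eq_mul, Distinguisher.size]
    have hK : 1 ≤ 2 ^ κ := Nat.one_le_two_pow
    generalize 2 ^ κ = K at *
    -- each summand is a part of the product with all factors multiplied out
    have e1 : t * K * (6 * κ + 3) + t * t * K * (6 * (2 * κ) + 3) + t * n * K * (6 * κ + 3) +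
        t * κ * K * (6 * n + 3) ≤ 30 * ((t + 1) * (t + 1) * (κ + 1) * K * (n + 1)) := by
      have h : (t * (6 * κ + 3) + t * t * (6 * (2 * κ) + 3) + t * n * (6 * κ + 3) +
          t * κ * (6 * n + 3)) * K ≤ (30 * ((t + 1) * (t + 1) * (κ + 1) * (n + 1))) * K := by
        refine Nat.mul_le_mul_right _ ?_
        ring_nf
        nlinarith [Nat.zero_le (t * κ), Nat.zero_le (t * n), Nat.zero_le (t * t),
          Nat.zero_le (t * κ * n), Nat.zero_le (t * t * κ), Nat.zero_le (t * t * n),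
          Nat.zero_le (t * t * κ * n), Nat.zero_le (κ * n)]
      calc _ = _ := by ring
        _ ≤ _ := h
        _ = _ := by ring
    have e2 : t * κ + 2 * t + (6 * (t * t + 1) + 3) ≤
        20 * ((t + 1) * (t + 1) * (κ + 1) * K * (n + 1)) := by
      have h : t * κ + 2 * t + (6 * (t * t + 1) + 3) ≤ 20 * ((t + 1) * (t + 1) * (κ + 1)) := by
        ring_nf
        nlinarith [Nat.zero_le (t * κ), Nat.zero_le (t * t), Nat.zero_le (t * t * κ)]
      refine h.trans (Nat.mul_le_mul_left _ ?_)
      rw [mul_assoc _ K]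
      exact Nat.le_mul_of_pos_right _ (Nat.mul_pos hK (by omega))
    omega
  · have hq1 : ∀ (x y : Fin t → BitStr n) (c : BitStr κ → Bool) (e : Fin t → Fin t → Bool)
        (i : Fin t → BitStr κ),
        runLin (permOracle π) ((List.finRange t).flatMap fun a => [.query true (regFwd regs a)])
          (ket (cfg i x y c e : PermWire t n A.anc κ d → Bool)) =
          ket (cfg i x (fun a j => xor (y a j) (π (x a) j)) c e) := fun x y c e i =>
      runLin_flatMap_update _ _ (fun y => (cfg i x y c e : PermWire t n A.anc κ d → Bool))
        (fun a y j => xor (y j) (π (x a) j)) (fun a v => by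
          rw [runLin_cons, runLin_nil, act_query_ket, cfg_eq_regCfg i x v x v,
            xorInto_regFwd, ← cfg_eq_regCfg]
          rfl) _ (List.nodup_finRange t) List.mem_finRange y
    have hq2 : ∀ (x y : Fin t → BitStr n) (c : BitStr κ → Bool) (e : Fin t → Fin t → Bool)
        (i : Fin t → BitStr κ),
        runLin (permOracle π) ((List.finRange t).flatMap fun a => [.query false (regBwd regs a)])
          (ket (cfg i x y c e : PermWire t n A.anc κ d → Bool)) =
          ket (cfg i (fun a j => xor (x a j) (π.symm (y a) j)) y c e) := fun x y c e i =>
      runLin_flatMap_update _ _ (fun x => (cfg i x y c e : PermWire t n A.anc κ d → Bool))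
        (fun a x j => xor (x j) (π.symm (y a) j)) (fun a v => by
          rw [runLin_cons, runLin_nil, act_query_ket, cfg_eq_regCfg i v y v y,
            xorInto_regBwd, ← cfg_eq_regCfg]
          rfl) _ (List.nodup_finRange t) List.mem_finRange x
    have hn : n ≤ d := by omega
    have h2κ : 2 * κ ≤ d := by omega
    have htt : t * t + 1 ≤ d := by omega
    rw [hB]
    simp only [runLin_append, run_hadamards, map_sum, map_smul, run_parity _ hκ,
      run_collisions _ h2κ, run_lookup _ hκ, hq1, run_erase _ hn hX, hq2, Bool.false_bne,
      Equiv.symm_apply_apply, Bool.xor_self, run_observer, run_answer _ htt]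
    obtain ⟨α, hα⟩ : ∃ α : ℂ, α = (1 / (Real.sqrt 2 : ℂ)) ^ (t * κ) := ⟨_, rfl⟩
    have hα2 : ‖α‖ ^ 2 = 1 / (2 : ℝ) ^ (t * κ) := by
      rw [hα, norm_pow, ← pow_mul, mul_comm (t * κ), pow_mul, norm_div, norm_one,
        Complex.norm_real, Real.norm_of_nonneg (Real.sqrt_nonneg _), div_pow,
        Real.sq_sqrt (by norm_num), one_pow, div_pow, one_pow]
    obtain ⟨Y, hY⟩ : ∃ Y : BitStr κ → BitStr n, Y = fun v => π (X v) := ⟨_, rfl⟩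
    change probOne out (∑ i : Fin t → BitStr κ, _ • ∑ v, basisRun A ((fun v => π (X v)) ∘ i) v •
      ket (final A.out (parity i, collisions i, v))) = _ * ∑ i ∈ injTuples t (BitStr κ),
        symWeight (accept A) ((fun v => π (X v)) ∘ i)
    rw [← hα, ← hα2, ← hY, ← sum_parity_class (isEffect_accept A) Y α]
    -- group the index tuples by what the final configuration records of them
    have hsum : ∑ i : Fin t → BitStr κ, α • ∑ v, basisRun A (Y ∘ i) v •
        ket (final (d := d) A.out (parity i, collisions i, v)) =
        ∑ s, (∑ i : Fin t → BitStr κ, if parity i = s.1 ∧ collisions i = s.2.1 then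
          α * basisRun A (Y ∘ i) s.2.2 else 0) • ket (final A.out s) := by
      simp only [sum_smul, smul_sum, smul_smul]
      symm
      rw [sum_comm]
      refine sum_congr rfl fun i _ => ?_
      rw [Fintype.sum_prod_type, sum_eq_single (parity i), Fintype.sum_prod_type,
        sum_eq_single (collisions i)]
      · simp
      · intro e _ he
        refine sum_eq_zero fun v _ => ?_
        simp [he.symm]
      · simp
      · intro c _ hc
        refine sum_eq_zero fun v _ => ?_
        simp [hc.symm]
      · simp
    -- the answer is `1` only if no collision is flagged
    rw [hsum, probOne_sum_ket (final_injective A.out)]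
    simp only [Fintype.sum_prod_type]
    refine sum_congr rfl fun c _ => ?_
    rw [accept_eq_basisRun, probOne, sum_eq_single (fun _ _ => false)]
    · refine sum_congr rfl fun v _ => ?_
      simp only [final, decide_true, Bool.and_true, Finset.sum_apply, Pi.smul_apply, smul_eq_mul]
      congr 3
      simp only [sum_mul]
      rw [sum_comm]
      refine sum_congr rfl fun i _ => ?_
      split_ifs
      · simp
      · simp
    · intro e _ he
      simp [final, he]
    · simp

end TPRS

/-! ### Subset phase states with ideal phases or an ideal permutation -/

namespace TPRS

open Finset

section ideal

variable {t n m : ℕ}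

theorem pad_injective (hmn : m ≤ n) : Function.Injective (pad n : BitStr m → BitStr n) := by
  intro x y h
  ext i
  have := congrFun h ⟨i, i.2.trans_le hmn⟩
  simpa [pad] using this

/-- The amplitudes of a subset phase state without their signs. -/
noncomputable def subsetAmp (m : ℕ) (σ : Equiv.Perm (BitStr n)) (z : BitStr n) : ℂ :=
  open Classical in if ∃ x : BitStr m, σ (pad n x) = z then 1 / (Real.sqrt 2 : ℂ) ^ m else 0

theorem subsetPhaseState_eq_sgn_mul (hmn : m ≤ n) (f : BitStr n → Bool)
    (σ : Equiv.Perm (BitStr n)) (z : BitStr n) :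
    subsetPhaseState m f σ z = (sgn (f z) : ℂ) * subsetAmp m σ z := by
  rw [subsetPhaseState_apply, subsetAmp]
  split_ifs with h
  · obtain ⟨x, rfl⟩ := h
    rw [sum_eq_single x]
    · simp [mul_comm]
    · intro y _ hy
      rw [if_neg, mul_zero]
      exact fun h => hy (pad_injective hmn (σ.injective h)).symm
    · simp
  · rw [mul_zero]
    exact sum_eq_zero fun x _ => by rw [if_neg fun hx => h ⟨x, hx.symm⟩, mul_zero]

theorem norm_subsetAmp_sq (σ : Equiv.Perm (BitStr n)) (z : BitStr n) :
    ‖subsetAmp m σ z‖ ^ 2 = open Classical in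
      if ∃ x : BitStr m, σ (pad n x) = z then 1 / (2 : ℝ) ^ m else 0 := by
  rw [subsetAmp]
  split_ifs
  · rw [norm_div, norm_one, norm_pow, Complex.norm_real, Real.norm_of_nonneg (Real.sqrt_nonneg _),
      div_pow, one_pow, ← pow_mul, mul_comm m 2, pow_mul, Real.sq_sqrt (by norm_num)]
  · simp

theorem sum_norm_subsetAmp (hmn : m ≤ n) (σ : Equiv.Perm (BitStr n)) :
    ∑ z, ‖subsetAmp m σ z‖ ^ 2 = 1 := by
  have h := Fintype.sum_of_injective (fun x : BitStr m => σ (pad n x))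
    (σ.injective.comp (pad_injective hmn)) (fun _ => 1 / (2 : ℝ) ^ m)
    (fun z => ‖subsetAmp m σ z‖ ^ 2) (fun z hz => by
      rw [norm_subsetAmp_sq, if_neg]
      rintro ⟨x, hx⟩
      exact hz ⟨x, hx⟩) fun x => by
      rw [norm_subsetAmp_sq, if_pos ⟨x, rfl⟩]
  rw [← h]
  simp

theorem sum_norm_subsetAmp_pow_four (hmn : m ≤ n) (σ : Equiv.Perm (BitStr n)) :
    ∑ z, (‖subsetAmp m σ z‖ ^ 2) ^ 2 = 1 / (2 : ℝ) ^ m := by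
  have h : ∀ z, (‖subsetAmp m σ z‖ ^ 2) ^ 2 = 1 / (2 : ℝ) ^ m * ‖subsetAmp m σ z‖ ^ 2 := by
    intro z
    rw [norm_subsetAmp_sq]
    split_ifs <;> ring
  simp only [h]
  rw [← mul_sum, sum_norm_subsetAmp hmn, mul_one]

theorem sum_norm_subsetPhaseState (hmn : m ≤ n) (f : BitStr n → Bool)
    (σ : Equiv.Perm (BitStr n)) : ∑ z, ‖subsetPhaseState m f σ z‖ ^ 2 = 1 := by
  rw [← sum_norm_subsetAmp hmn σ]
  refine sum_congr rfl fun z _ => ?_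
  rw [subsetPhaseState_eq_sgn_mul hmn, norm_mul, Complex.norm_real]
  cases f z <;> simp [sgn]

theorem sum_injTuples_subsetAmp (hmn : m ≤ n) (σ : Equiv.Perm (BitStr n))
    (g : (Fin t → BitStr n) → ℝ) :
    ∑ y ∈ injTuples t (BitStr n), (∏ a, ‖subsetAmp m σ (y a)‖ ^ 2) * g y =
      (1 / (2 : ℝ) ^ (t * m)) * ∑ x ∈ injTuples t (BitStr m), g fun a => σ (pad n (x a)) := by
  classical
  have hinj := σ.injective.comp (pad_injective (m := m) hmn)
  have hcomp : ∀ x : Fin t → BitStr m, Function.Injective (fun a => σ (pad n (x a))) ↔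
      Function.Injective x := fun x => hinj.of_comp_iff x
  rw [mul_sum]
  symm
  refine sum_of_injOn (fun x a => σ (pad n (x a))) ?_ ?_ ?_ ?_
  · intro x _ y _ h
    exact funext fun a => hinj (congrFun h a)
  · intro x hx
    simpa [hcomp] using hx
  · intro y hy hy'
    have hne : ∃ a, ¬ ∃ x : BitStr m, σ (pad n x) = y a := by
      by_contra! hall
      choose x hx using hall
      refine hy' ⟨x, ?_, funext hx⟩
      rw [mem_coe, mem_injTuples, ← hcomp]
      simp only [hx]
      exact mem_injTuples.1 hy
    obtain ⟨a, ha⟩ := hne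
    rw [prod_eq_zero (mem_univ a), zero_mul]
    rw [norm_subsetAmp_sq, if_neg ha]
  · intro x _
    have : ∀ a, ‖subsetAmp m σ (σ (pad n (x a)))‖ ^ 2 = 1 / (2 : ℝ) ^ m := fun a => by
      rw [norm_subsetAmp_sq, if_pos ⟨_, rfl⟩]
    simp only [this, prod_const, card_univ, Fintype.card_fin]
    rw [div_pow, one_pow, ← pow_mul, mul_comm m t]

/-- The value of an effect on the uniform mixture of the symmetric vectors of the injective tuples
of points of the subset, without normalization. -/
noncomputable def subsetAverage (m : ℕ) (Q : ((Fin t → BitStr n) → ℂ) → ℝ)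
    (Y : BitStr m → BitStr n) : ℝ :=
  (1 / (2 : ℝ) ^ (t * m)) * ∑ x ∈ injTuples t (BitStr m), symWeight Q fun a => Y (x a)

/-- The probability that `t` random strings of `m` bits are distinct. -/
noncomputable def distinctProb (t m : ℕ) : ℝ :=
  (1 / (2 : ℝ) ^ (t * m)) * #(injTuples t (BitStr m))

theorem distinctProb_nonneg : 0 ≤ distinctProb t m := by
  rw [distinctProb]; positivity

theorem one_sub_distinctProb_le : 1 - distinctProb t m ≤ t ^ 2 / 2 ^ m := by
  have h := sum_injTuples_subsetAmp (t := t) (le_refl m) (1 : Equiv.Perm (BitStr m)) fun _ => 1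
  simp only [mul_one, sum_const, nsmul_eq_mul] at h
  have h2 := collision_bound (t := t) (fun z => ‖subsetAmp m (1 : Equiv.Perm (BitStr m)) z‖ ^ 2)
    (fun z => by positivity) (sum_norm_subsetAmp le_rfl 1)
  rw [sum_norm_subsetAmp_pow_four le_rfl, h] at h2
  rw [distinctProb]
  convert h2 using 1
  ring

theorem distinctProb_le_one : distinctProb t m ≤ 1 := by
  rw [distinctProb, div_mul_eq_mul_div, one_mul, div_le_one (by positivity), mul_comm t m, pow_mul]
  have : #(injTuples t (BitStr m)) ≤ #(univ : Finset (Fin t → BitStr m)) :=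
    card_le_card (subset_univ _)
  simp only [card_univ, Fintype.card_pi, prod_const, Fintype.card_fin, Fintype.card_bool] at this
  exact_mod_cast this

variable {Q : ((Fin t → BitStr n) → ℂ) → ℝ}

theorem subsetAverage_nonneg (hQ : IsEffect Q) (Y : BitStr m → BitStr n) :
    0 ≤ subsetAverage m Q Y :=
  mul_nonneg (by positivity) (sum_nonneg fun _ _ => symWeight_nonneg hQ _)

theorem subsetAverage_le_one (hQ : IsEffect Q) {Y : BitStr m → BitStr n}
    (hY : Function.Injective Y) : subsetAverage m Q Y ≤ 1 := by
  refine le_trans ?_ (distinctProb_le_one (t := t) (m := m))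
  rw [subsetAverage, distinctProb]
  refine mul_le_mul_of_nonneg_left ?_ (by positivity)
  refine (sum_le_card_nsmul _ _ 1 fun x hx => symWeight_le_one hQ ?_).trans (by simp)
  exact hY.comp (mem_injTuples.1 hx)

/-- With random phases, `t` copies of a subset phase state are close to the uniform mixture of the
symmetric vectors of the injective tuples. -/
theorem abs_expect_phases_sub_le (hmn : m ≤ n) (hQ : IsEffect Q) (σ : Equiv.Perm (BitStr n)) :
    |(𝔼 r : BitStr n → Bool, Q fun x => ∏ a, subsetPhaseState m r σ (x a)) -
      subsetAverage m Q (fun x => σ (pad n x))| ≤ t ^ 2 / 2 ^ m := by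
  have h := expect_sign_copies (t := t) hQ (subsetAmp m σ) (sum_norm_subsetAmp hmn σ)
  have h2 := collision_bound (t := t) (fun z => ‖subsetAmp m σ z‖ ^ 2)
    (fun z => by positivity) (sum_norm_subsetAmp hmn σ)
  rw [sum_norm_subsetAmp_pow_four hmn] at h2
  simp only [subsetPhaseState_eq_sgn_mul hmn]
  rw [subsetAverage, ← sum_injTuples_subsetAmp hmn σ (symWeight Q), abs_le]
  have h3 : (t : ℝ) ^ 2 * (1 / 2 ^ m) = t ^ 2 / 2 ^ m := by ring
  dsimp only at h
  have h4 : (0 : ℝ) ≤ t ^ 2 / 2 ^ m := by positivity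
  constructor <;> linarith [h.1, h.2]

/-- Averaging over the enumerations of the subset. -/
theorem expect_subsetAverage {κ : ℕ} {Y : BitStr m → BitStr n} {u : BitStr κ → BitStr m}
    (hu : Function.Injective u) :
    (𝔼 ρ : Equiv.Perm (BitStr m), subsetAverage κ Q (fun v => Y (ρ (u v)))) =
      distinctProb t κ * 𝔼 x ∈ injTuples t (BitStr m), symWeight Q fun a => Y (x a) := by
  simp only [subsetAverage]
  rw [← mul_expect, expect_sum_comm, distinctProb, mul_assoc, ← nsmul_eq_mul, ← sum_const]
  congr 1
  refine sum_congr rfl fun i hi => ?_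
  exact expect_perm_comp (y := fun a => u (i a)) (hu.comp (mem_injTuples.1 hi))
    (fun x => symWeight Q fun a => Y (x a))

theorem subsetAverage_eq (Y : BitStr m → BitStr n) : subsetAverage m Q Y =
    distinctProb t m * 𝔼 x ∈ injTuples t (BitStr m), symWeight Q fun a => Y (x a) := by
  rw [subsetAverage, distinctProb, expect_eq_sum_div_card]
  rcases (injTuples t (BitStr m)).eq_empty_or_nonempty with h | h
  · simp [h]
  · have : (#(injTuples t (BitStr m)) : ℝ) ≠ 0 := by
      exact_mod_cast h.card_pos.ne'
    field_simp

/-- With a random permutation, the average is that over all injective tuples. -/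
theorem expect_perm_subsetAverage {κ : ℕ} {X : BitStr κ → BitStr n} (hX : Function.Injective X) :
    (𝔼 π : Equiv.Perm (BitStr n), subsetAverage κ Q (fun v => π (X v))) =
      distinctProb t κ * symAverage Q := by
  exact expect_subsetAverage (Y := id) hX

end ideal

end TPRS

/-! ### Indistinguishability from Haar-random states -/

namespace TPRS

open Finset

theorem exists_abs_expect_le {Ω : Type} [Fintype Ω] [Nonempty Ω] (g : Ω → ℝ) :
    ∃ ω, |𝔼 ω, g ω| ≤ |g ω| := by
  obtain ⟨ω, hω⟩ := Finite.exists_max fun ω => |g ω|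
  exact ⟨ω, (abs_expect_le _ _).trans (expect_le univ_nonempty fun ω' _ => hω ω')⟩

/-- The best enumeration of the subset gives an adversary against the permutations. Indices of `κ`
bits with `2 ^ κ ≥ 2 * t ^ 2` suffice, since they are distinct with probability at least `1 / 2`. -/
theorem exists_permAdversary_subsetAverage {t n m : ℕ} (hmn : m ≤ n) (A : Distinguisher (t * n))
    {K : Type} [Fintype K] [Nonempty K] (σ : K → Equiv.Perm (BitStr n)) :
    ∃ B : OracleCircuit Bool n n,
      B.size ≤ 50 * ((t + 1) * (t + 1) * ((4 * t ^ 2 + 2) * (4 * t ^ 2 + 2))) * (n + 1) + A.size ∧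
      |(𝔼 k, subsetAverage m (accept A) fun x => σ k (pad n x)) - symAverage (accept A)| ≤
        2 * |(𝔼 k, B.prob (permOracle (σ k))) -
          𝔼 π : Equiv.Perm (BitStr n), B.prob (permOracle π)| + 2 * t ^ 2 / 2 ^ m := by
  have hQ := isEffect_accept A
  have hD0 : 0 ≤ 𝔼 k, subsetAverage m (accept A) fun x => σ k (pad n x) :=
    expect_nonneg fun k _ => subsetAverage_nonneg hQ _
  have hD1 : (𝔼 k, subsetAverage m (accept A) fun x => σ k (pad n x)) ≤ 1 :=
    expect_le univ_nonempty fun k _ => subsetAverage_le_one hQ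
      ((σ k).injective.comp (pad_injective hmn))
  have hS0 := symAverage_nonneg hQ
  have hS1 := symAverage_le_one hQ
  by_cases hm : 2 * t ^ 2 ≤ 2 ^ m
  -- the least `κ` with `2 ^ κ ≥ 2 * t ^ 2`
  · obtain ⟨κ, hκ⟩ : ∃ κ, κ = Nat.clog 2 (2 * t ^ 2) := ⟨_, rfl⟩
    have hκm : κ ≤ m := hκ ▸ Nat.clog_le_of_le_pow hm
    have hκ1 : 2 * t ^ 2 ≤ 2 ^ κ := hκ ▸ Nat.le_pow_clog (by norm_num) _
    have hκ2 : 2 ^ κ ≤ 4 * t ^ 2 + 1 := by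
      rcases Nat.eq_zero_or_pos t with rfl | ht
      · simp [hκ]
      · have h1 : 1 ≤ t ^ 2 := Nat.one_le_pow _ _ ht
        have h := Nat.pow_pred_clog_lt_self (b := 2) (by norm_num) (x := 2 * t ^ 2) (by omega)
        rw [← hκ] at h
        have h2 : 2 ^ κ ≤ 2 * 2 ^ κ.pred := by
          rw [← pow_succ']
          exact Nat.pow_le_pow_right (by norm_num) (by rw [Nat.pred_eq_sub_one]; omega)
        omega
    have hX : ∀ ρ : Equiv.Perm (BitStr m),
        Function.Injective fun v : BitStr κ => pad n (ρ (pad m v)) := fun ρ =>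
      (pad_injective hmn).comp (ρ.injective.comp (pad_injective hκm))
    choose B hBsize hB using fun ρ => exists_permAdversary (hX ρ) A
    have hB' : ∀ ρ π, (B ρ).prob (permOracle π) =
        subsetAverage κ (accept A) fun v => π (pad n (ρ (pad m v))) := hB
    obtain ⟨ρ, hρ⟩ := exists_abs_expect_le fun ρ => (𝔼 k, (B ρ).prob (permOracle (σ k))) -
      𝔼 π : Equiv.Perm (BitStr n), (B ρ).prob (permOracle π)
    refine ⟨B ρ, (hBsize ρ).trans ?_, ?_⟩
    · have hlt : κ < 2 ^ κ := Nat.lt_two_pow_self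
      have h1 : (κ + 1) * 2 ^ κ ≤ (4 * t ^ 2 + 2) * (4 * t ^ 2 + 2) :=
        Nat.mul_le_mul (by omega) (by omega)
      have h2 := Nat.mul_le_mul_left (50 * ((t + 1) * (t + 1)) * (n + 1)) h1
      have e1 : 50 * ((t + 1) * (t + 1) * (κ + 1) * 2 ^ κ * (n + 1)) =
        50 * ((t + 1) * (t + 1)) * (n + 1) * ((κ + 1) * 2 ^ κ) := by ring
      have e2 : 50 * ((t + 1) * (t + 1) * ((4 * t ^ 2 + 2) * (4 * t ^ 2 + 2))) * (n + 1) =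
        50 * ((t + 1) * (t + 1)) * (n + 1) * ((4 * t ^ 2 + 2) * (4 * t ^ 2 + 2)) := by ring
      omega
    -- on average over `ρ`, distinct indices give a uniform tuple of distinct points of the subset
    · obtain ⟨V, hV⟩ : ∃ V, V = 𝔼 k, 𝔼 x ∈ injTuples t (BitStr m),
          symWeight (accept A) fun a => σ k (pad n (x a)) := ⟨_, rfl⟩
      have h1 : (𝔼 k, subsetAverage m (accept A) fun x => σ k (pad n x)) =
          distinctProb t m * V := by
        simp only [subsetAverage_eq]
        rw [← mul_expect, hV]
      have h2 : (𝔼 ρ, 𝔼 k, (B ρ).prob (permOracle (σ k))) = distinctProb t κ * V := by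
        rw [expect_comm]
        rw [hV, mul_expect]
        refine expect_congr rfl fun k _ => ?_
        simp only [hB']
        exact expect_subsetAverage (pad_injective hκm) (Y := fun x => σ k (pad n x))
      have h3 : ∀ ρ, (𝔼 π : Equiv.Perm (BitStr n), (B ρ).prob (permOracle π)) =
          distinctProb t κ * symAverage (accept A) := fun ρ => by
        simp only [hB']
        exact expect_perm_subsetAverage (hX ρ)
      rw [expect_sub_distrib, h2] at hρ
      simp only [h3] at hρ
      rw [expect_const univ_nonempty, ← mul_sub, abs_mul,
        abs_of_nonneg (distinctProb_nonneg (t := t) (m := κ))] at hρ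
      rw [h3, h1]
      have hq : 1 / 2 ≤ distinctProb t κ := by
        have := one_sub_distinctProb_le (t := t) (m := κ)
        have h4 : (t : ℝ) ^ 2 / 2 ^ κ ≤ 1 / 2 := by
          rw [div_le_iff₀ (by positivity)]
          have : (2 : ℝ) * t ^ 2 ≤ 2 ^ κ := by exact_mod_cast hκ1
          linarith
        linarith
      have h5 : |V - symAverage (accept A)| ≤ 2 * |(𝔼 k, (B ρ).prob (permOracle (σ k))) -
          distinctProb t κ * symAverage (accept A)| := by
        have := mul_le_mul_of_nonneg_right hq (abs_nonneg (V - symAverage (accept A)))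
        linarith
      have hq0 := distinctProb_nonneg (t := t) (m := m)
      have hq1 := distinctProb_le_one (t := t) (m := m)
      have hq2 := one_sub_distinctProb_le (t := t) (m := m)
      have e : distinctProb t m * V - symAverage (accept A) =
        distinctProb t m * (V - symAverage (accept A)) -
          (1 - distinctProb t m) * symAverage (accept A) := by ring
      rw [e]
      refine (abs_sub _ _).trans (add_le_add ?_ ?_)
      · rw [abs_mul, abs_of_nonneg hq0]
        exact (mul_le_of_le_one_left (abs_nonneg _) hq1).trans h5
      · rw [abs_of_nonneg (mul_nonneg (by linarith) hS0)]
        refine (mul_le_of_le_one_right (by linarith) hS1).trans (hq2.trans ?_)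
        gcongr
        nlinarith [sq_nonneg (t : ℝ)]
  -- for small subsets the bound is trivial
  · refine ⟨⟨1, [], .inr 0⟩, by simp [OracleCircuit.size], ?_⟩
    have h1 : (1 : ℝ) ≤ 2 * t ^ 2 / 2 ^ m := by
      rw [le_div_iff₀ (by positivity), one_mul]
      exact_mod_cast (not_le.1 hm).le
    have h2 : |(𝔼 k, subsetAverage m (accept A) fun x => σ k (pad n x)) -
        symAverage (accept A)| ≤ 1 := by
      rw [abs_le]
      constructor <;> linarith
    refine (h2.trans h1).trans (le_add_of_nonneg_left (by positivity))

/-- The best key of the permutation gives an adversary against the phase functions. -/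
theorem exists_phaseAdversary_expect {t n m l : ℕ} (hmn : m ≤ n) (C C' : KeyedCircuit l n n)
    (σ : BitStr l → Equiv.Perm (BitStr n))
    (hC : ∀ k x y, runGates C.gates (ket (assign k x y)) =
      ket (assign k x fun j => xor (y j) (σ k x j)))
    (hC' : ∀ k x y, runGates C'.gates (ket (assign k x y)) =
      ket (assign k x fun j => xor (y j) ((σ k).symm x j)))
    (A : Distinguisher (t * n)) {K : Type} [Fintype K] (f : K → BitStr n → Bool) :
    ∃ B : OracleCircuit Unit n 1, B.size ≤ l + t * (m + C.size + C'.size + 5) + A.size ∧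
      |(𝔼 k, 𝔼 k', A.prob (copies t (subsetPhaseState m (f k') (σ k)))) -
        𝔼 k, 𝔼 r : BitStr n → Bool, A.prob (copies t (subsetPhaseState m r (σ k)))| ≤
      |(𝔼 k', B.prob (phaseOracle (f k'))) - 𝔼 r : BitStr n → Bool, B.prob (phaseOracle r)| := by
  rw [← expect_sub_distrib]
  obtain ⟨k, hk⟩ := exists_abs_expect_le fun k =>
    (𝔼 k', A.prob (copies t (subsetPhaseState m (f k') (σ k)))) -
      𝔼 r : BitStr n → Bool, A.prob (copies t (subsetPhaseState m r (σ k)))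
  obtain ⟨B, hBsize, hB⟩ := exists_phaseAdversary hmn C C' (σ k) k (hC k) (hC' k) A
  refine ⟨B, hBsize, hk.trans (le_of_eq ?_)⟩
  simp only [hB]

theorem expect_castAdd_natAdd {a b : ℕ} (g : BitStr a → BitStr b → ℝ) :
    (𝔼 k : BitStr (a + b), g (fun i => k (Fin.castAdd b i)) fun i => k (Fin.natAdd a i)) =
      𝔼 k₂, 𝔼 k₁, g k₁ k₂ := by
  rw [expect_comm, ← expect_product', univ_product_univ]
  symm
  refine Fintype.expect_equiv (Fin.appendEquiv a b) _ _ fun k => ?_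
  simp [Fin.appendEquiv]

/-- The wire that an elementary gate may change. -/
def Gate.target {W : Type} : Gate W → W
  | .X i => i
  | .H i => i
  | .T i => i
  | .CX _ j => j
  | .CCX _ _ k => k

theorem Gate.act_eq_zero {W : Type} [DecidableEq W] (g : Gate W) {w : W} (hw : g.target ≠ w)
    {b : Bool} {ψ : State W} (hψ : ∀ z, z w ≠ b → ψ z = 0) (z : W → Bool) (hz : z w ≠ b) :
    g.act ψ z = 0 := by
  have h : ∀ i x, i ≠ w → ψ (Function.update z i x) = 0 := fun i x hi =>
    hψ _ (by rwa [Function.update_of_ne hi.symm])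
  have h' : ∀ i, i ≠ w → ψ (flipBit z i) = 0 := fun i hi => h _ _ hi
  cases g <;> simp only [Gate.target] at hw <;> simp [Gate.act, h _ _ hw, h' _ hw, hψ z hz]

theorem runGates_eq_zero {W : Type} [DecidableEq W] (C : List (Gate W)) {w : W}
    (hw : ∀ g ∈ C, g.target ≠ w) {b : Bool} {ψ : State W} (hψ : ∀ z, z w ≠ b → ψ z = 0)
    (z : W → Bool) (hz : z w ≠ b) : runGates C ψ z = 0 := by
  induction C generalizing ψ with
  | nil => exact hψ z hz
  | cons g C ih =>
    exact ih (fun g' hg' => hw g' (by simp [hg'])) fun z' hz' =>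
      g.act_eq_zero (hw g (by simp)) hψ z' hz'

/-- A circuit for a permutation has a gate with target `w` for every output wire `w`. -/
theorem le_size_of_computes {n l : ℕ} (C : KeyedCircuit l n n) (σ : Equiv.Perm (BitStr n))
    (k : BitStr l) (hC : ∀ x y, runGates C.gates (ket (assign k x y)) =
      ket (assign k x fun j => xor (y j) (σ x j))) : n ≤ C.size := by
  have h : ∀ j : Fin n, (.inr (.inr (.inl j)) : Fin l ⊕ Fin n ⊕ Fin n ⊕ Fin C.anc) ∈
      C.gates.map Gate.target := by
    intro j
    by_contra hj
    have hrun := hC (σ.symm fun _ => true) fun _ => false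
    have h0 := runGates_eq_zero C.gates (w := .inr (.inr (.inl j))) (b := false)
      (ψ := ket (assign k (σ.symm fun _ => true) fun _ => false)) (fun g hg hgt =>
        hj (List.mem_map.2 ⟨g, hg, hgt⟩)) (fun z hz => by
          rw [ket_apply, if_neg]
          rintro rfl
          exact hz rfl)
      (assign k (σ.symm fun _ => true) fun _ => true) (by simp [assign])
    rw [hrun] at h0
    simp [ket_apply] at h0
  have h2 := List.Subperm.length_le (List.subperm_of_subset
    (l₁ := (List.finRange n).map fun j =>
      (.inr (.inr (.inl j)) : Fin l ⊕ Fin n ⊕ Fin n ⊕ Fin C.anc))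
    ((List.nodup_finRange n).map fun i j h => by simpa using h) (by
      intro w hw
      obtain ⟨j, -, rfl⟩ := List.mem_map.1 hw
      exact h j))
  simpa [KeyedCircuit.size] using h2

/-- Three hybrids: random phases, a random symmetric vector of distinct points of the subset, and a
random symmetric vector of distinct basis states. -/
theorem haarIndistinguishable_subsetPhaseEnsemble {T R : Set (ℕ → ℕ)} (hTR : Admissible T R)
    {m : ℕ → ℕ} (hm : ∀ n, m n ≤ n) (hmT : (fun n => 2 ^ m n) ∈ littleOmega T) {lF lσ : ℕ → ℕ}
    {F : ∀ n, BitStr (lF n) → BitStr n → Bool} {σ : ∀ n, BitStr (lσ n) → Equiv.Perm (BitStr n)}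
    (hF : IsQPRPF T lF F) (hσ : IsQPRP T lσ σ) :
    HaarIndistinguishable T R (fun n => lF n + lσ n) (subsetPhaseEnsemble m lF lσ F σ) := by
  intro A s hs hAs t ht hst
  obtain ⟨-, -, hFsec⟩ := hF
  obtain ⟨hlσ, ⟨C, -, hCsize, hC⟩, ⟨C', -, hC'size, hC'⟩, hσsec⟩ := hσ
  -- the sizes of the adversaries involve `n`, which `𝐓` dominates because it bounds the size of `C`
  have hn : (fun n => n) ∈ bigO T := bigO_of_le
    (fun n => le_size_of_computes (C n) (σ n fun _ => false) _ (hC n _)) hCsize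
  have hconst : ∀ c, (fun n => n + c) ∈ bigO T := fun c => by
    refine bigO_of_eventually_le (s' := fun n => (c + 1) * n) ?_
      (hTR.consistent _ hn _ (hTR.const_mem (c + 1)))
    filter_upwards [Filter.eventually_ge_atTop 1] with n h1
    nlinarith
  have hA : (fun n => (A (t n * n)).size) ∈ bigO T := bigO_of_le (fun n => hAs _) hst
  choose B hBsize hB using fun n => exists_phaseAdversary_expect (hm n) (C n) (C' n) (σ n) (hC n)
    (hC' n) (A (t n * n)) (F n)
  choose D hDsize hD using fun n => exists_permAdversary_subsetAverage (hm n) (A (t n * n)) (σ n)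
  have hB1 : (fun n => (B n).size) ∈ bigO T := by
    refine bigO_of_le hBsize (hTR.bigO_add (hTR.bigO_add hlσ (hTR.consistent _ ?_ t ht)) hA)
    refine bigO_of_le (s' := fun n => (n + 5) + (C n).size + (C' n).size) (fun n => ?_)
      (hTR.bigO_add (hTR.bigO_add (hconst 5) hCsize) hC'size)
    have := hm n
    omega
  have hD1 : (fun n => (D n).size) ∈ bigO T := by
    refine bigO_of_le hDsize (hTR.bigO_add (hTR.consistent _ (hconst 1) _ ?_) hA)
    have ht1 := hTR.add_mem _ ht _ (hTR.const_mem 1)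
    have ht2 : (fun n => 4 * t n ^ 2 + 2) ∈ R := by
      simp only [sq]
      exact hTR.add_mem _ (hTR.mul_mem _ (hTR.const_mem 4) _ (hTR.mul_mem _ ht _ ht)) _
        (hTR.const_mem 2)
    exact hTR.mul_mem _ (hTR.const_mem 50) _ (hTR.mul_mem _ (hTR.mul_mem _ ht1 _ ht1) _
      (hTR.mul_mem _ ht2 _ ht2))
  have hr : (fun n => 6 * t n ^ 2 + 1) ∈ R := by
    simp only [sq]
    exact hTR.add_mem _ (hTR.mul_mem _ (hTR.const_mem 6) _ (hTR.mul_mem _ ht _ ht)) _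
      (hTR.const_mem 1)
  -- `6 * t ^ 2 = t ^ 2 + 2 * t ^ 2 + 3 * t ^ 2`, and the summand `1` makes the bound strict
  refine ⟨_, negl_add (hFsec B hB1) (negl_add (hTR.negl_mul (hσsec D hD1) (hTR.const_mem 2))
    (hTR.negl_mul (inv_two_pow_mem_negl hmT) hr)), fun n => ?_⟩
  have h1 := hB n
  have h2 := hD n
  have h3 : |(𝔼 k, 𝔼 r : BitStr n → Bool, (A (t n * n)).prob (copies (t n)
      (subsetPhaseState (m n) r (σ n k)))) - 𝔼 k, subsetAverage (m n) (accept (A (t n * n)))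
        fun x => σ n k (pad n x)| ≤ t n ^ 2 / 2 ^ m n := by
    rw [← expect_sub_distrib]
    refine (abs_expect_le _ _).trans (expect_le univ_nonempty fun k _ => ?_)
    exact abs_expect_phases_sub_le (hm n) (isEffect_accept (A (t n * n))) (σ n k)
  have h4 := haar_copies (isEffect_accept (A (t n * n)))
  have h5 : (3 : ℝ) * t n ^ 2 / 2 ^ n ≤ 3 * t n ^ 2 / 2 ^ m n := by
    gcongr
    · norm_num
    · exact hm n
  have h6 := expect_castAdd_natAdd fun k₁ k₂ => (A (t n * n)).prob (copies (t n)
    (subsetPhaseState (m n) (F n k₁) (σ n k₂)))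
  have h7 : (0 : ℝ) < 1 / 2 ^ m n := by positivity
  have e : ∀ x : ℝ, x / 2 ^ m n = x * (1 / 2 ^ m n) := fun x => by ring
  rw [e] at h2 h3 h5
  push_cast
  rw [show (fun k : BitStr (lF n + lσ n) => (A (t n * n)).prob (copies (t n)
    (subsetPhaseEnsemble m lF lσ F σ n k))) = fun k => (A (t n * n)).prob (copies (t n)
    (subsetPhaseState (m n) (F n fun i => k (Fin.castAdd (lσ n) i))
      (σ n fun i => k (Fin.natAdd (lF n) i)))) from rfl, h6]
  have h8 := abs_sub_le (𝔼 k₂, 𝔼 k₁, (A (t n * n)).prob (copies (t n)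
    (subsetPhaseState (m n) (F n k₁) (σ n k₂)))) (𝔼 k, 𝔼 r : BitStr n → Bool,
      (A (t n * n)).prob (copies (t n) (subsetPhaseState (m n) r (σ n k))))
      (∫ φ, (A (t n * n)).prob (copies (t n) (φ : EuclideanSpace ℂ (BitStr n)).ofLp)
            ∂(haarState n))
  have h9 := abs_sub_le (𝔼 k, 𝔼 r : BitStr n → Bool,
      (A (t n * n)).prob (copies (t n) (subsetPhaseState (m n) r (σ n k))))
      (𝔼 k, subsetAverage (m n) (accept (A (t n * n))) fun x => σ n k (pad n x))
      (∫ φ, (A (t n * n)).prob (copies (t n) (φ : EuclideanSpace ℂ (BitStr n)).ofLp)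
            ∂(haarState n))
  have h10 := abs_sub_le (𝔼 k, subsetAverage (m n) (accept (A (t n * n)))
      fun x => σ n k (pad n x)) (symAverage (accept (A (t n * n))))
      (∫ φ, (A (t n * n)).prob (copies (t n) (φ : EuclideanSpace ℂ (BitStr n)).ofLp)
            ∂(haarState n))
  have h11 : |symAverage (accept (A (t n * n))) -
      ∫ φ, (A (t n * n)).prob (copies (t n) (φ : EuclideanSpace ℂ (BitStr n)).ofLp)
            ∂(haarState n)| ≤ 3 * t n ^ 2 / 2 ^ n := by
    rw [abs_sub_comm]
    exact h4
  linarith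

end TPRS

/-! ### Programs that print circuits -/

namespace TPRS

theorem Gate.map_map {U V W : Type} (f : U → V) (h : V → W) (g : Gate U) :
    (g.map f).map h = g.map (h ∘ f) := by
  cases g <;> rfl

/-- The program with its stacks renamed by `e` and its wire expressions changed by `ρ`. -/
def Prog.rename (e : ℕ → ℕ) (ρ : Block × List ℕ → Block × List ℕ) : Prog → Prog
  | .skip => .skip
  | .push r b => .push (e r) b
  | .pop r => .pop (e r)
  | .print g => .print (g.map ρ)
  | .seq p q => .seq (p.rename e ρ) (q.rename e ρ)
  | .cond r p q s => .cond (e r) (p.rename e ρ) (q.rename e ρ) (s.rename e ρ)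
  | .loop r p => .loop (e r) (p.rename e ρ)

/-- The program without its output. -/
def Prog.mute : Prog → Prog
  | .skip => .skip
  | .push r b => .push r b
  | .pop r => .pop r
  | .print _ => .skip
  | .seq p q => .seq p.mute q.mute
  | .cond r p q s => .cond r p.mute q.mute s.mute
  | .loop r p => .loop r p.mute

theorem Run.mute {P : Prog} {st st' : Store} {o : List (Gate (Block × ℕ))} {c : ℕ}
    (h : Run P st st' o c) : Run P.mute st st' [] c := by
  induction h with
  | skip st => exact .skip st
  | push st r b => exact .push st r b
  | pop st r => exact .pop st r
  | print st g => exact .skip st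
  | seq _ _ ih ih' => exact .seq ih ih'
  | cond_true h _ ih => exact .cond_true h ih
  | cond_false h _ ih => exact .cond_false h ih
  | cond_empty h _ ih => exact .cond_empty h ih
  | loop_done h => exact .loop_done h
  | loop_step h _ _ ih ih' => exact .loop_step h ih ih'

theorem Run.length_output_le {P : Prog} {st st' : Store} {o : List (Gate (Block × ℕ))} {c : ℕ}
    (h : Run P st st' o c) : o.length ≤ c := by
  induction h with
  | skip | push | pop | print | loop_done => simp
  | cond_true _ _ ih | cond_false _ _ ih | cond_empty _ _ ih => omega
  | seq _ _ ih ih' | loop_step _ _ _ ih ih' => rw [List.length_append]; omega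

theorem Run.length_stack_le {P : Prog} {st st' : Store} {o : List (Gate (Block × ℕ))} {c : ℕ}
    (h : Run P st st' o c) (r : ℕ) : (st' r).length ≤ (st r).length + c := by
  induction h with
  | push st r' b =>
    by_cases hr : r = r'
    · subst hr; simp
    · simp [hr]
  | pop st r' =>
    by_cases hr : r = r'
    · subst hr; simp; omega
    · simp [hr]
  | _ => omega

theorem update_extend {e : ℕ → ℕ} (he : Function.Injective e) (st S : Store) (r : ℕ)
    (x : List Bool) : Function.update (Function.extend e st S) (e r) x =
      Function.extend e (Function.update st r x) S := by
  ext1 i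
  by_cases hi : ∃ j, e j = i
  · obtain ⟨j, rfl⟩ := hi
    simp only [he.extend_apply, Function.update_apply, he.eq_iff]
  · rw [Function.extend_apply' _ _ _ hi, Function.update_of_ne, Function.extend_apply' _ _ _ hi]
    rintro rfl
    exact hi ⟨r, rfl⟩

/-- Renaming the stacks injectively leaves the computation unchanged, and the other stacks `S`
untouched. -/
theorem Run.rename {e : ℕ → ℕ} (he : Function.Injective e) {ρ : Block × List ℕ → Block × List ℕ}
    {ρ' : Block × ℕ → Block × ℕ} {S : Store}
    (hρ : ∀ st w, wireVal (Function.extend e st S) (ρ w) = ρ' (wireVal st w)) {P : Prog}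
    {st st' : Store} {o : List (Gate (Block × ℕ))} {c : ℕ} (h : Run P st st' o c) :
    Run (P.rename e ρ) (Function.extend e st S) (Function.extend e st' S)
      (o.map (Gate.map ρ')) c := by
  have hst : ∀ (st : Store) r, Function.extend e st S (e r) = st r := fun st r =>
    he.extend_apply st S r
  induction h with
  | skip st => exact .skip _
  | push st r b =>
    have := Run.push (Function.extend e st S) (e r) b
    rwa [hst, update_extend he] at this
  | pop st r =>
    have := Run.pop (Function.extend e st S) (e r)
    rwa [hst, update_extend he] at this
  | print st g =>
    have := Run.print (Function.extend e st S) (g.map ρ)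
    rw [Gate.map_map, funext (f := wireVal _ ∘ ρ) fun w => hρ st w] at this
    rw [List.map_singleton, Gate.map_map]
    exact this
  | seq _ _ ih ih' =>
    rw [List.map_append]
    exact .seq ih ih'
  | cond_true h _ ih => exact .cond_true (by rwa [hst]) ih
  | cond_false h _ ih => exact .cond_false (by rwa [hst]) ih
  | cond_empty h _ ih => exact .cond_empty (by rwa [hst]) ih
  | loop_done h => exact .loop_done (by rwa [hst])
  | loop_step h _ _ ih ih' =>
    rw [List.map_append]
    exact .loop_step (by rwa [hst]) ih ih'

/-- The wire expressions of a program whose stacks are renamed by `e`, for a circuit whose register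
`b` is placed in the register `β b`, shifted by the total height of the stacks `off b`. -/
def rewire (e : ℕ → ℕ) (β : Block → Block) (off : Block → List ℕ) (w : Block × List ℕ) :
    Block × List ℕ := (β w.1, w.2.map e ++ off w.1)

/-- The effect of `rewire` on wires. -/
def shiftWire (S : Store) (β : Block → Block) (off : Block → List ℕ) (w : Block × ℕ) : Block × ℕ :=
  (β w.1, w.2 + ((off w.1).map fun r => (S r).length).sum)

/-- A program run on renamed stacks, as part of a larger program. -/
theorem Run.subroutine {e : ℕ → ℕ} (he : Function.Injective e) (β : Block → Block)
    {off : Block → List ℕ} (hoff : ∀ b, ∀ r ∈ off b, r ∉ Set.range e) {P : Prog}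
    {st st' : Store} {o : List (Gate (Block × ℕ))} {c : ℕ} (h : Run P st st' o c) {S : Store}
    (hS : ∀ r, S (e r) = st r) :
    ∃ S', Run (P.rename e (rewire e β off)) S S' (o.map (Gate.map (shiftWire S β off))) c ∧
      (∀ r, S' (e r) = st' r) ∧ ∀ r, r ∉ Set.range e → S' r = S r := by
  have hSe : Function.extend e st S = S := by
    ext1 i
    by_cases hi : ∃ j, e j = i
    · obtain ⟨j, rfl⟩ := hi
      rw [he.extend_apply, hS]
    · rw [Function.extend_apply' _ _ _ hi]
  refine ⟨Function.extend e st' S, ?_, he.extend_apply st' S, fun r hr =>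
    Function.extend_apply' _ _ _ hr⟩
  have := h.rename he (S := S) (ρ := rewire e β off) (ρ' := shiftWire S β off) fun st w => by
    simp only [wireVal, rewire, shiftWire, List.map_append, List.map_map, List.sum_append]
    congr 2
    · congr 1
      refine List.map_congr_left fun r _ => ?_
      rw [Function.comp, he.extend_apply]
    · congr 1
      refine List.map_congr_left fun r hr => ?_
      rw [Function.extend_apply' _ _ _ (hoff _ r hr)]
  rwa [hSe] at this

/-- Push `true` on each of the stacks in a list. -/
def Prog.pushAll : List ℕ → Prog
  | [] => .skip
  | r :: L => .seq (.push r true) (pushAll L)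

theorem run_pushAll (L : List ℕ) (hL : L.Nodup) (S : Store) :
    Run (.pushAll L) S (fun r => if r ∈ L then true :: S r else S r) [] (L.length + 1) := by
  induction L generalizing S with
  | nil => simpa [Prog.pushAll] using Run.skip S
  | cons i L ih =>
    rw [List.nodup_cons] at hL
    have h := Run.seq (Run.push S i true) (ih hL.2 (Function.update S i (true :: S i)))
    have e1 : (fun r => if r ∈ L then true :: Function.update S i (true :: S i) r
        else Function.update S i (true :: S i) r) =
        fun r => if r ∈ i :: L then true :: S r else S r := by
      ext1 r
      by_cases hr : r = i
      · subst hr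
        simp [hL.1]
      · simp [hr]
    rw [e1, show 1 + (L.length + 1) = (i :: L).length + 1 by simp; omega] at h
    exact h

/-- Empty stack `s`, and push its height in unary on each of the stacks in a list. -/
def Prog.transfer (s : ℕ) (L : List ℕ) : Prog := .loop s (.seq (.pop s) (.pushAll L))

theorem run_transfer {s : ℕ} {L : List ℕ} (hL : L.Nodup) (hs : s ∉ L) (S : Store) {k : ℕ}
    (hk : (S s).length = k) : ∃ S', Run (.transfer s L) S S' [] (k * (L.length + 3) + 1) ∧
      S' s = [] ∧ (∀ r, r ∈ L → S' r = List.replicate k true ++ S r) ∧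
      ∀ r, r ∉ L → r ≠ s → S' r = S r := by
  induction k generalizing S with
  | zero =>
    have h0 : S s = [] := List.length_eq_zero_iff.1 hk
    exact ⟨S, by simpa [Prog.transfer] using Run.loop_done h0, h0,
      fun r _ => by simp, fun r _ _ => rfl⟩
  | succ k ih =>
    have hne : S s ≠ [] := fun h => by rw [h] at hk; simp at hk
    have hbody := Run.seq (Run.pop S s) (run_pushAll L hL (Function.update S s (S s).tail))
    obtain ⟨S', h, h1, h2, h3⟩ := ih
      (fun r => if r ∈ L then true :: Function.update S s (S s).tail r
        else Function.update S s (S s).tail r) (by simp [hs, hk])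
    refine ⟨S', ?_, h1, fun r hr => ?_, fun r hr hrs => ?_⟩
    · have := Run.loop_step hne hbody h
      rw [show 1 + (L.length + 1) + (k * (L.length + 3) + 1) + 1 =
        (k + 1) * (L.length + 3) + 1 by ring] at this
      exact this
    · have hrs : r ≠ s := fun h => hs (h ▸ hr)
      rw [h2 r hr, if_pos hr, Function.update_of_ne hrs, List.replicate_succ', List.append_assoc]
      rfl
    · rw [h3 r hr hrs, if_neg hr, Function.update_of_ne hrs]

/-- Print Hadamard gates on the first ancillas, as many as the height of stack `s`. -/
def Prog.hadamards (s : ℕ) : Prog := .loop s (.seq (.pop s) (.print (.H (.anc, [s]))))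

theorem run_hadamards (s : ℕ) (S : Store) {k : ℕ} (hk : (S s).length = k) :
    ∃ S', Run (.hadamards s) S S' ((List.range k).reverse.map fun i => .H (.anc, i)) (3 * k + 1) ∧
      ∀ r, r ≠ s → S' r = S r := by
  induction k generalizing S with
  | zero =>
    have h0 : S s = [] := List.length_eq_zero_iff.1 hk
    exact ⟨S, by simpa [Prog.hadamards] using Run.loop_done h0, fun r _ => rfl⟩
  | succ k ih =>
    have hne : S s ≠ [] := fun h => by rw [h] at hk; simp at hk
    have hbody := Run.seq (Run.pop S s)
      (Run.print (Function.update S s (S s).tail) (.H (.anc, [s])))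
    obtain ⟨S', h, h1⟩ := ih (Function.update S s (S s).tail) (by simp [hk])
    refine ⟨S', ?_, fun r hrs => ?_⟩
    · have := Run.loop_step hne hbody h
      have ho : [] ++ [(Gate.H (.anc, [s])).map (wireVal (Function.update S s (S s).tail))] ++
          ((List.range k).reverse.map fun i => .H (.anc, i)) =
          (List.range (k + 1)).reverse.map fun i => .H (.anc, i) := by
        rw [List.range_succ, List.reverse_append]
        simp [Gate.map, wireVal, hk]
      rw [ho, show 1 + 1 + (3 * k + 1) + 1 = 3 * (k + 1) + 1 by ring] at this
      exact this
    · rw [h1 r hrs, Function.update_of_ne hrs]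

end TPRS

/-! ### The generator -/

namespace TPRS

open Finset

/-- The wires of the generator: a key of the phase function and a key of the permutation, the
output, and ancillas. The first `n` ancillas hold the argument of the permutation, and the next one
is the target of the phase function. -/
abbrev GenWire (a b n A : ℕ) : Type := Fin (a + b) ⊕ Fin 0 ⊕ Fin n ⊕ Fin (n + 1 + A)

namespace GenWire

variable {a b n A : ℕ}

/-- The argument and the value of the permutation. -/
def regs : (Fin 1 × Fin n) ⊕ (Fin 1 × Fin n) ↪ GenWire a b n A where
  toFun := Sum.elim (fun q => .inr (.inr (.inr ⟨q.2, by omega⟩))) fun q => .inr (.inr (.inl q.2))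
  inj' := by
    rintro (⟨i, j⟩ | ⟨i, j⟩) (⟨i', j'⟩ | ⟨i', j'⟩) h
    · simp only [Sum.elim_inl, Sum.inr.injEq, Fin.mk.injEq] at h
      rw [Subsingleton.elim i i', Fin.ext h]
    · simp at h
    · simp at h
    · simp only [Sum.elim_inr, Sum.inr.injEq, Sum.inl.injEq] at h
      rw [Subsingleton.elim i i', h]

/-- The target of the phase function. -/
def phase : GenWire a b n A := .inr (.inr (.inr ⟨n, by omega⟩))

/-- The wires of the circuit for the permutation. -/
def fwd {d : ℕ} (hd : d ≤ A) : Fin b ⊕ Fin n ⊕ Fin n ⊕ Fin d ↪ GenWire a b n A where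
  toFun := Sum.elim (fun i => .inl (Fin.natAdd a i))
    (Sum.elim (fun j => .inr (.inr (.inr ⟨j, by omega⟩)))
      (Sum.elim (fun j => .inr (.inr (.inl j))) fun i => .inr (.inr (.inr ⟨n + 1 + i, by omega⟩))))
  inj' := by
    rintro (i | i | i | i) (j | j | j | j) h <;> simp [Fin.ext_iff] at h ⊢ <;> omega

/-- The wires of the circuit for the inverse permutation. -/
def bwd {d : ℕ} (hd : d ≤ A) : Fin b ⊕ Fin n ⊕ Fin n ⊕ Fin d ↪ GenWire a b n A where
  toFun := Sum.elim (fun i => .inl (Fin.natAdd a i))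
    (Sum.elim (fun j => .inr (.inr (.inl j))) (Sum.elim (fun j => .inr (.inr (.inr ⟨j, by omega⟩)))
      fun i => .inr (.inr (.inr ⟨n + 1 + i, by omega⟩))))
  inj' := by
    rintro (i | i | i | i) (j | j | j | j) h <;> simp [Fin.ext_iff] at h ⊢ <;> omega

/-- The wires of the circuit for the phase function. -/
def sign {d : ℕ} (hd : d ≤ A) : Fin a ⊕ Fin n ⊕ Fin 1 ⊕ Fin d ↪ GenWire a b n A where
  toFun := Sum.elim (fun i => .inl (Fin.castAdd b i))
    (Sum.elim (fun j => .inr (.inr (.inl j)))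
      (Sum.elim (fun _ => phase) fun i => .inr (.inr (.inr ⟨n + 1 + i, by omega⟩))))
  inj' := by
    rintro (i | i | i | i) (j | j | j | j) h <;> simp [Fin.ext_iff, phase] at h ⊢ <;> omega

theorem mem_range_regs (w : GenWire a b n A) : w ∈ Set.range regs ↔
    (∃ j : Fin n, w = .inr (.inr (.inr ⟨j, by omega⟩))) ∨ ∃ j, w = .inr (.inr (.inl j)) := by
  constructor
  · rintro ⟨⟨i, j⟩ | ⟨i, j⟩, rfl⟩
    · exact .inl ⟨j, rfl⟩
    · exact .inr ⟨j, rfl⟩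
  · rintro (⟨j, rfl⟩ | ⟨j, rfl⟩)
    · exact ⟨.inl (0, j), rfl⟩
    · exact ⟨.inr (0, j), rfl⟩

theorem key_notMem (i : Fin (a + b)) : (.inl i : GenWire a b n A) ∉ Set.range regs := by
  rw [mem_range_regs]; simp

theorem anc_notMem {j : ℕ} (hj : j < n + 1 + A) (hn : n ≤ j) :
    (.inr (.inr (.inr ⟨j, hj⟩)) : GenWire a b n A) ∉ Set.range regs := by
  rw [mem_range_regs]
  rintro (⟨i, h⟩ | ⟨i, h⟩)
  · simp only [Sum.inr.injEq, Fin.mk.injEq] at h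
    have := i.2
    omega
  · simp at h

theorem phase_notMem : (phase : GenWire a b n A) ∉ Set.range regs := anc_notMem _ le_rfl

end GenWire

open GenWire in
/-- The gates of the generator of subset phase states. -/
def genGates {a b n m : ℕ} (hmn : m ≤ n) (C C' : KeyedCircuit b n n) (D : KeyedCircuit a n 1) :
    List (Gate (GenWire a b n (C.anc + C'.anc + D.anc))) :=
  ((List.finRange m).reverse.map fun j => .H (regs (.inl (0, Fin.castLE hmn j)))) ++
    (C.gates.map (Gate.map (fwd (by omega))) ++ (C'.gates.map (Gate.map (bwd (by omega))) ++
    ([.X phase, .H phase] ++ (D.gates.map (Gate.map (sign (by omega))) ++ [.H phase, .X phase]))))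

open GenWire in
/-- The generator is the preparation of a single copy. -/
theorem runGates_genGates {a b n m : ℕ} (hmn : m ≤ n) (C C' : KeyedCircuit b n n)
    (D : KeyedCircuit a n 1) (k : BitStr (a + b)) (f : BitStr n → Bool)
    (σ : Equiv.Perm (BitStr n))
    (hC : ∀ x y, runGates C.gates (ket (assign (fun i => k (Fin.natAdd a i)) x y)) =
      ket (assign (fun i => k (Fin.natAdd a i)) x fun j => xor (y j) (σ x j)))
    (hC' : ∀ x y, runGates C'.gates (ket (assign (fun i => k (Fin.natAdd a i)) x y)) =
      ket (assign (fun i => k (Fin.natAdd a i)) x fun j => xor (y j) (σ.symm x j)))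
    (hD : ∀ x y, runGates D.gates (ket (assign (fun i => k (Fin.castAdd b i)) x y)) =
      ket (assign (fun i => k (Fin.castAdd b i)) x fun j => xor (y j) (f x))) :
    runGates (genGates hmn C C' D) (ket (assign k Fin.elim0 fun _ => false)) =
      ∑ z, subsetPhaseState m f σ z • ket (assign k Fin.elim0 z) := by
  have hgates : (genGates hmn C C' D).map (OracleGate.elem (ι := Empty) (a := 0) (b := 0)) =
      prepGates regs ((List.finRange m).reverse.map fun j => ((0 : Fin 1), j)) hmn phase
        (fun _ => C.place (fwd (by omega))) (fun _ => C'.place (bwd (by omega)))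
        (fun _ => D.place (sign (by omega))) := by
    have h1 : List.finRange 1 = [0] := rfl
    simp [genGates, prepGates, KeyedCircuit.place, Function.comp_def, h1]
  have hnd : ((List.finRange m).reverse.map fun j => ((0 : Fin 1), j)).Nodup :=
    (List.nodup_reverse.2 (List.nodup_finRange m)).map fun i j h => by simpa using h
  have hmem : ∀ q : Fin 1 × Fin m, q ∈ (List.finRange m).reverse.map fun j => ((0 : Fin 1), j) := by
    rintro ⟨i, j⟩
    simp [Subsingleton.elim i 0]
  rw [← runLin_elem (ι := Empty) (a := 0) (b := 0) (fun i => i.elim), hgates,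
    runLin_prepGates regs _ _ _ hnd hmem hmn phase phase_notMem _ _ _ f σ]
  · refine Fintype.sum_equiv (Equiv.funUnique (Fin 1) (BitStr n)) _ _ fun v => ?_
    rw [Fin.prod_univ_one]
    congr 2
    ext w
    rcases w with i | i | j | j
    · rw [regCfg_of_notMem _ _ _ _ (key_notMem i)]
      rfl
    · exact i.elim0
    · exact regCfg_inr regs _ (fun _ _ => false) v (0, j)
    · by_cases hj : (j : ℕ) < n
      · exact regCfg_inl regs _ (fun _ _ => false) v (0, ⟨j, hj⟩)
      · rw [regCfg_of_notMem _ _ _ _ (anc_notMem j.2 (not_lt.1 hj))]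
        rfl
  · rintro (q | q) <;> rfl
  · rfl
  · intro i z hz
    refine (C.runLin_place (G := fun x => σ x) hC (fwd (by omega)) _ z (fun j => ?_)
      fun j => ?_).trans ?_
    · exact hz _ (key_notMem _)
    · exact hz _ (anc_notMem _ (by omega))
    · congr 2
  · intro i z hz
    refine (C'.runLin_place (G := fun x => σ.symm x) hC' (bwd (by omega)) _ z (fun j => ?_)
      fun j => ?_).trans ?_
    · exact hz _ (key_notMem _)
    · exact hz _ (anc_notMem _ (by omega))
    · congr 2
  · intro i z hz
    refine (D.runLin_place (G := fun x _ => f x) hD (sign (by omega)) _ z (fun j => ?_)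
      fun j => ?_).trans ?_
    · exact hz _ (key_notMem _) Sum.inl_ne_inr
    · refine hz _ (anc_notMem _ (by omega)) ?_
      intro h
      have h' : (⟨n + 1 + j, by omega⟩ : Fin (n + 1 + (C.anc + C'.anc + D.anc))) =
        ⟨n, by omega⟩ := Sum.inr.inj (Sum.inr.inj (Sum.inr.inj h))
      rw [Fin.mk.injEq] at h'
      omega
    · congr 2

/-- Stack `r` of subroutine `i < 6`. Different subroutines have different stacks, and the stacks
below `6` belong to none of them. -/
def slot (i r : ℕ) : ℕ := 6 * (r + 1) + i

theorem slot_injective (i : ℕ) : Function.Injective (slot i) := fun r r' h => by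
  simp only [slot] at h; omega

theorem slot_notMem {i j : ℕ} (hi : i < 6) (hj : j < 6) (hij : i ≠ j) (r : ℕ) :
    slot j r ∉ Set.range (slot i) := by
  rintro ⟨r', h⟩
  simp only [slot] at h
  omega

theorem notMem_slot {i s : ℕ} (hs : s < 6) : s ∉ Set.range (slot i) := by
  rintro ⟨r', h⟩
  simp only [slot] at h
  omega

/-- The registers of the generator that hold those of the circuit for the permutation. -/
def fwdBlock : Block → Block
  | .key => .key
  | .input => .anc
  | .output => .output
  | .anc => .anc

/-- The registers of the generator that hold those of the circuit for the inverse permutation. -/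
def bwdBlock : Block → Block
  | .key => .key
  | .input => .output
  | .output => .anc
  | .anc => .anc

/-- The stacks that contain the offsets of the registers of the circuits for the permutation and its
inverse: the key length of the phase function, `n` and `1`. -/
def permOffset : Block → List ℕ
  | .key => [slot 1 1]
  | .anc => [2, 3]
  | _ => []

/-- The stacks that contain the offsets of the registers of the circuit for the phase function. -/
def signOffset : Block → List ℕ
  | .output => [2]
  | .anc => [2, 3]
  | _ => []

/-- The program that prints the generator: copies of the input for five subroutines, the computation
of `m`, the Hadamard gates, a silent run of the program for the phase function in order to learn its
key length, the three circuits, and the addition of the key lengths. -/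
def genProg (Pm PF Pσ Pσ' : Prog) : Prog :=
  .seq (.transfer 0 [2, slot 0 0, slot 1 0, slot 2 0, slot 3 0, slot 4 0]) <|
  .seq (.push 3 true) <|
  .seq (Pm.rename (slot 0) (rewire (slot 0) id fun _ => [])) <|
  .seq (.hadamards (slot 0 1)) <|
  .seq (PF.mute.rename (slot 1) (rewire (slot 1) id fun _ => [])) <|
  .seq (Pσ.rename (slot 2) (rewire (slot 2) fwdBlock permOffset)) <|
  .seq (Pσ'.rename (slot 3) (rewire (slot 3) bwdBlock permOffset)) <|
  .seq (.print (.X (.anc, [2]))) <|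
  .seq (.print (.H (.anc, [2]))) <|
  .seq (PF.rename (slot 4) (rewire (slot 4) bwdBlock signOffset)) <|
  .seq (.print (.H (.anc, [2]))) <|
  .seq (.print (.X (.anc, [2]))) <|
  .seq (.transfer (slot 1 1) [1]) (.transfer (slot 2 1) [1])

/-- The wires of the generator that hold those of the circuit for the permutation (`β = fwdBlock`)
or its inverse (`β = bwdBlock`). -/
def permName (β : Block → Block) (a n : ℕ) (w : Block × ℕ) : Block × ℕ :=
  (β w.1, w.2 + match w.1 with
    | .key => a
    | .anc => n + 1
    | _ => 0)

/-- The wires of the generator that hold those of the circuit for the phase function. -/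
def signName (n : ℕ) (w : Block × ℕ) : Block × ℕ :=
  (bwdBlock w.1, w.2 + match w.1 with
    | .output => n
    | .anc => n + 1
    | _ => 0)

/-- The subroutines work on the disjoint families of stacks `slot 0`, …, `slot 4`; stacks `2` and
`3` keep `n` and `1` for the offsets of the wires. -/
theorem run_genProg {Pm PF Pσ Pσ' : Prog} {n m a b : ℕ} {stm stF stσ stσ' : Store}
    {oF oσ oσ' : List (Gate (Block × ℕ))} {cm cF cσ cσ' : ℕ}
    (hm : Run Pm (unaryStore n) stm [] cm) (hml : (stm 1).length = m)
    (hF : Run PF (unaryStore n) stF oF cF) (hFl : (stF 1).length = a)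
    (hσ : Run Pσ (unaryStore n) stσ oσ cσ) (hσl : (stσ 1).length = b)
    (hσ' : Run Pσ' (unaryStore n) stσ' oσ' cσ') :
    ∃ S c, Run (genProg Pm PF Pσ Pσ') (unaryStore n) S
      (((List.range m).reverse.map fun i => .H (.anc, i)) ++
        (oσ.map (Gate.map (permName fwdBlock a n)) ++ (oσ'.map (Gate.map (permName bwdBlock a n)) ++
        ([.X (.anc, n), .H (.anc, n)] ++ (oF.map (Gate.map (signName n)) ++
          [.H (.anc, n), .X (.anc, n)]))))) c ∧
      (S 1).length = a + b ∧
      c ≤ 9 * n + cm + 3 * m + 2 * cF + cσ + cσ' + 4 * a + 4 * b + 9 := by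
  obtain ⟨S1, h1, -, h1L, h1n⟩ := run_transfer (s := 0)
    (L := [2, slot 0 0, slot 1 0, slot 2 0, slot 3 0, slot 4 0]) (by decide) (by decide)
    (unaryStore n) (k := n) (by simp [unaryStore])
  have hready : ∀ i < 5, ∀ r, S1 (slot i r) = unaryStore n r := by
    intro i hi r
    rcases Nat.eq_zero_or_pos r with rfl | hr
    · rw [h1L _ (by interval_cases i <;> simp)]
      simp [unaryStore, slot]
    · rw [h1n]
      · have h0 : slot i r ≠ 0 := by simp only [slot]; omega
        simp [unaryStore, h0, hr.ne']
      · simp only [List.mem_cons, List.not_mem_nil, or_false, slot]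
        omega
      · simp only [slot]
        omega
  have h2 := Run.push S1 3 true
  obtain ⟨S2, hS2⟩ : ∃ S2, S2 = Function.update S1 3 (true :: S1 3) := ⟨_, rfl⟩
  rw [← hS2] at h2
  have hS2' : ∀ r, r ≠ 3 → S2 r = S1 r := fun r hr => by rw [hS2, Function.update_of_ne hr]
  have h23 : (S2 3).length = 1 := by
    rw [hS2, Function.update_self, h1n 3 (by decide) (by decide)]
    simp [unaryStore]
  have h22 : (S2 2).length = n := by
    rw [hS2' 2 (by decide), h1L 2 (by decide)]
    simp [unaryStore]
  have h21 : S2 1 = [] := by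
    rw [hS2' 1 (by decide), h1n 1 (by decide) (by decide)]
    simp [unaryStore]
  have hr2 : ∀ i < 5, ∀ r, S2 (slot i r) = unaryStore n r := fun i hi r => by
    rw [hS2' _ (by simp only [slot]; omega), hready i hi]
  obtain ⟨S3, h3, h3e, h3n⟩ := hm.subroutine (slot_injective 0) id (off := fun _ => []) (by simp)
    (hr2 0 (by decide))
  obtain ⟨S4, h4, h4n⟩ := run_hadamards (slot 0 1) S3 (by rw [h3e, hml])
  have h4s : ∀ s < 6, S4 s = S2 s := fun s hs => by
    rw [h4n _ (by simp only [slot]; omega), h3n _ (notMem_slot hs)]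
  have h4r : ∀ i < 5, i ≠ 0 → ∀ r, S4 (slot i r) = unaryStore n r := fun i hi h0 r => by
    rw [h4n _ (by simp only [slot]; omega), h3n _ (slot_notMem (by decide) (by omega) h0.symm r),
      hr2 i hi]
  obtain ⟨S5, h5, h5e, h5n⟩ := hF.mute.subroutine (slot_injective 1) id (off := fun _ => [])
    (by simp) (h4r 1 (by decide) (by decide))
  have hoffσ : ∀ i, i < 6 → i ≠ 1 → ∀ b, ∀ r ∈ permOffset b, r ∉ Set.range (slot i) := by
    intro i hi h1 b r hr
    cases b <;> simp only [permOffset, List.mem_cons, List.not_mem_nil, or_false] at hr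
    · rw [hr]
      exact slot_notMem hi (by decide) h1 1
    · rcases hr with rfl | rfl <;> exact notMem_slot (by decide)
  obtain ⟨S6, h6, h6e, h6n⟩ := hσ.subroutine (slot_injective 2) fwdBlock
    (hoffσ 2 (by decide) (by decide)) (S := S5) fun r => by
      rw [h5n _ (slot_notMem (by decide) (by decide) (by decide) r),
        h4r 2 (by decide) (by decide)]
  obtain ⟨S7, h7, h7e, h7n⟩ := hσ'.subroutine (slot_injective 3) bwdBlock
    (hoffσ 3 (by decide) (by decide)) (S := S6) fun r => by
      rw [h6n _ (slot_notMem (by decide) (by decide) (by decide) r),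
        h5n _ (slot_notMem (by decide) (by decide) (by decide) r),
        h4r 3 (by decide) (by decide)]
  obtain ⟨S8, h8, h8e, h8n⟩ := hF.subroutine (slot_injective 4) bwdBlock
    (off := signOffset) (by
      intro b r hr
      cases b <;> simp only [signOffset, List.mem_cons, List.not_mem_nil, or_false] at hr
      · rw [hr]
        exact notMem_slot (by decide)
      · rcases hr with rfl | rfl <;> exact notMem_slot (by decide)) (S := S7) fun r => by
      rw [h7n _ (slot_notMem (by decide) (by decide) (by decide) r),
        h6n _ (slot_notMem (by decide) (by decide) (by decide) r),
        h5n _ (slot_notMem (by decide) (by decide) (by decide) r),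
        h4r 4 (by decide) (by decide)]
  have h5s : ∀ s < 6, S5 s = S2 s := fun s hs => by rw [h5n _ (notMem_slot hs), h4s s hs]
  have h6s : ∀ s < 6, S6 s = S2 s := fun s hs => by rw [h6n _ (notMem_slot hs), h5s s hs]
  have h7s : ∀ s < 6, S7 s = S2 s := fun s hs => by rw [h7n _ (notMem_slot hs), h6s s hs]
  have h8s : ∀ s < 6, S8 s = S2 s := fun s hs => by rw [h8n _ (notMem_slot hs), h7s s hs]
  have h5a : (S5 (slot 1 1)).length = a := by rw [h5e, hFl]
  have h6a : (S6 (slot 1 1)).length = a := by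
    rw [h6n _ (slot_notMem (by decide) (by decide) (by decide) _), h5a]
  have h8a : (S8 (slot 1 1)).length = a := by
    rw [h8n _ (slot_notMem (by decide) (by decide) (by decide) _),
      h7n _ (slot_notMem (by decide) (by decide) (by decide) _), h6a]
  have h8b : (S8 (slot 2 1)).length = b := by
    rw [h8n _ (slot_notMem (by decide) (by decide) (by decide) _),
      h7n _ (slot_notMem (by decide) (by decide) (by decide) _), h6e, hσl]
  obtain ⟨S9, h9, -, h9L, h9n⟩ := run_transfer (s := slot 1 1) (L := [1]) (by simp) (by decide) S8
    h8a
  obtain ⟨S10, h10, -, h10L, -⟩ := run_transfer (s := slot 2 1) (L := [1]) (by simp) (by decide) S9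
    (k := b) (by rw [h9n _ (by decide) (by decide), h8b])
  have n6 : shiftWire S5 fwdBlock permOffset = permName fwdBlock a n := by
    ext1 ⟨β, i⟩
    cases β <;> simp [shiftWire, permName, permOffset, h5a, h5s, h22, h23]
  have n7 : shiftWire S6 bwdBlock permOffset = permName bwdBlock a n := by
    ext1 ⟨β, i⟩
    cases β <;> simp [shiftWire, permName, permOffset, h6a, h6s, h22, h23]
  have n8 : shiftWire S7 bwdBlock signOffset = signName n := by
    ext1 ⟨β, i⟩
    cases β <;> simp [shiftWire, signName, signOffset, h7s, h22, h23]
  have w7 : wireVal S7 (.anc, [2]) = (.anc, n) := by simp [wireVal, h7s, h22]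
  have w8 : wireVal S8 (.anc, [2]) = (.anc, n) := by simp [wireVal, h8s, h22]
  rw [n6] at h6
  rw [n7] at h7
  rw [n8] at h8
  have hrun := Run.seq h1 (.seq h2 (.seq h3 (.seq h4 (.seq h5 (.seq h6 (.seq h7
    (.seq (.print S7 (.X (.anc, [2]))) (.seq (.print S7 (.H (.anc, [2]))) (.seq h8
    (.seq (.print S8 (.H (.anc, [2]))) (.seq (.print S8 (.X (.anc, [2])))
      (.seq h9 h10))))))))))))
  simp only [Gate.map, w7, w8, List.map_nil, List.nil_append, List.append_nil,
    List.cons_append] at hrun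
  refine ⟨S10, _, hrun, ?_, ?_⟩
  · rw [h10L 1 (by simp), h9L 1 (by simp), h8s 1 (by decide), h21]
    simp [add_comm]
  · simp only [List.length_cons, List.length_nil]
    omega

open GenWire in
/-- The output of `genProg` is the list of gates of the generator. -/
theorem wireName_genGates {a b n m : ℕ} (hmn : m ≤ n) (C C' : KeyedCircuit b n n)
    (D : KeyedCircuit a n 1) : (genGates hmn C C' D).map (Gate.map wireName) =
      ((List.range m).reverse.map fun i => .H (.anc, i)) ++
        ((C.gates.map (Gate.map wireName)).map (Gate.map (permName fwdBlock a n)) ++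
        ((C'.gates.map (Gate.map wireName)).map (Gate.map (permName bwdBlock a n)) ++
        ([.X (.anc, n), .H (.anc, n)] ++ ((D.gates.map (Gate.map wireName)).map
          (Gate.map (signName n)) ++ [.H (.anc, n), .X (.anc, n)])))) := by
  have hf : ∀ (d A : ℕ) (hd : d ≤ A), permName fwdBlock a n ∘ wireName =
      wireName ∘ (fwd hd : Fin b ⊕ Fin n ⊕ Fin n ⊕ Fin d ↪ GenWire a b n A) := by
    intro d A hd
    ext1 w
    rcases w with i | i | i | i
    · exact congrArg (Prod.mk Block.key) (Nat.add_comm _ _)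
    · rfl
    · rfl
    · exact congrArg (Prod.mk Block.anc) (Nat.add_comm _ _)
  have hb : ∀ (d A : ℕ) (hd : d ≤ A), permName bwdBlock a n ∘ wireName =
      wireName ∘ (bwd hd : Fin b ⊕ Fin n ⊕ Fin n ⊕ Fin d ↪ GenWire a b n A) := by
    intro d A hd
    ext1 w
    rcases w with i | i | i | i
    · exact congrArg (Prod.mk Block.key) (Nat.add_comm _ _)
    · rfl
    · rfl
    · exact congrArg (Prod.mk Block.anc) (Nat.add_comm _ _)
  have hs : ∀ (d A : ℕ) (hd : d ≤ A), signName n ∘ wireName =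
      wireName ∘ (sign hd : Fin a ⊕ Fin n ⊕ Fin 1 ⊕ Fin d ↪ GenWire a b n A) := by
    intro d A hd
    ext1 w
    rcases w with i | i | i | i
    · rfl
    · rfl
    · rw [Subsingleton.elim i 0]
      exact congrArg (Prod.mk Block.anc) (Nat.zero_add n)
    · exact congrArg (Prod.mk Block.anc) (Nat.add_comm _ _)
  have hh : ((List.range m).reverse.map fun i => Gate.H (Block.anc, i)) =
      (List.finRange m).reverse.map fun j : Fin m => Gate.H (Block.anc, (j : ℕ)) := by
    rw [← List.map_coe_finRange_eq_range, ← List.map_reverse, List.map_map]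
    rfl
  simp only [genGates, List.map_append, List.map_map, Function.comp_def, Gate.map_map] at hf hb hs ⊢
  rw [hh]
  simp only [hf _ _ (show C.anc ≤ C.anc + C'.anc + D.anc by omega),
    hb _ _ (show C'.anc ≤ C.anc + C'.anc + D.anc by omega),
    hs _ _ (show D.anc ≤ C.anc + C'.anc + D.anc by omega)]
  rfl

/-- The generator is printed in polynomial time because the circuits of which it consists are. -/
theorem exists_generator {T : Set (ℕ → ℕ)} {m lF lσ : ℕ → ℕ} (hm : ∀ n, m n ≤ n)
    (hmtime : PolyTimeLength m) {F : ∀ n, BitStr (lF n) → BitStr n → Bool}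
    {σ : ∀ n, BitStr (lσ n) → Equiv.Perm (BitStr n)}
    (hF : ComputableInTime T lF (fun _ => 1) fun n k x _ => F n k x)
    (hσ : ComputableInTime T lσ id fun n k x => σ n k x)
    (hσ' : ComputableInTime T lσ id fun n k x => (σ n k).symm x) :
    ∃ G : ∀ n, KeyedCircuit (lF n + lσ n) 0 n,
      Uniform G ∧ (fun n => (G n).size) ∈ bigO poly ∧
        ∀ n k, runGates (G n).gates (ket (assign k Fin.elim0 fun _ => false)) =
          ∑ z, subsetPhaseEnsemble m lF lσ F σ n k z • ket (assign k Fin.elim0 z) := by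
  obtain ⟨Pm, τm, hPm⟩ := hmtime
  obtain ⟨D, ⟨PF, τF, hPF⟩, -, hD⟩ := hF
  obtain ⟨C, ⟨Pσ, τσ, hPσ⟩, -, hC⟩ := hσ
  obtain ⟨C', ⟨Pσ', τσ', hPσ'⟩, -, hC'⟩ := hσ'
  obtain ⟨τ, hτ⟩ : ∃ τ : Polynomial ℕ, τ = Polynomial.C 12 * Polynomial.X + τm +
    Polynomial.C 6 * τF + Polynomial.C 5 * τσ + τσ' + Polynomial.C 9 := ⟨_, rfl⟩
  have hτn : ∀ n, τ.eval n = 12 * n + τm.eval n + 6 * τF.eval n + 5 * τσ.eval n + τσ'.eval n + 9 :=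
    fun n => by rw [hτ]; simp
  have hrun : ∀ n, ∃ S c, Run (genProg Pm PF Pσ Pσ') (unaryStore n) S
      ((genGates (hm n) (C n) (C' n) (D n)).map (Gate.map wireName)) c ∧
      (S 1).length = lF n + lσ n ∧ c ≤ τ.eval n := by
    intro n
    obtain ⟨stm, cm, hm1, hm2, hm3⟩ := hPm n
    obtain ⟨stF, cF, hF1, hF2, hF3⟩ := hPF n
    obtain ⟨stσ, cσ, hσ1, hσ2, hσ3⟩ := hPσ n
    obtain ⟨stσ', cσ', hσ'1, -, hσ'3⟩ := hPσ' n
    obtain ⟨S, c, h1, h2, h3⟩ := run_genProg hm1 hm2 hF1 hF2 hσ1 hσ2 hσ'1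
    refine ⟨S, c, ?_, h2, ?_⟩
    · rw [wireName_genGates]
      exact h1
    · have hlF := hF1.length_stack_le 1
      have hlσ := hσ1.length_stack_le 1
      have h0 : (unaryStore n 1).length = 0 := rfl
      have := hm n
      rw [hτn]
      omega
  refine ⟨fun n => ⟨_, genGates (hm n) (C n) (C' n) (D n)⟩, ⟨_, τ, hrun⟩,
    ⟨_, ⟨τ, rfl⟩, Asymptotics.IsBigO.of_bound 1 (Filter.Eventually.of_forall fun n => ?_)⟩,
    fun n k => ?_⟩
  · obtain ⟨S, c, h1, -, h3⟩ := hrun n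
    have h := h1.length_output_le
    rw [List.length_map] at h
    rw [Real.norm_natCast, Real.norm_natCast, one_mul]
    exact_mod_cast h.trans h3
  · exact runGates_genGates (hm n) (C n) (C' n) (D n) k _ _ (hC n _) (hC' n _) fun x y => hD n _ x y

/-- Subset phase states are pseudorandom for every admissible class of running times. -/
theorem isPRS_subsetPhaseEnsemble {T R : Set (ℕ → ℕ)} (hTR : Admissible T R)
    {m : ℕ → ℕ} (hm : ∀ n, m n ≤ n) (hmtime : PolyTimeLength m)
    (hmT : (fun n => 2 ^ m n) ∈ littleOmega T) {lF lσ : ℕ → ℕ}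
    {F : ∀ n, BitStr (lF n) → BitStr n → Bool} {σ : ∀ n, BitStr (lσ n) → Equiv.Perm (BitStr n)}
    (hF : IsQPRPF T lF F) (hσ : IsQPRP T lσ σ) :
    IsPRS T R R (fun n => lF n + lσ n) (subsetPhaseEnsemble m lF lσ F σ) where
  normalized n _ := sum_norm_subsetPhaseState (hm n) _ _
  keyLength := hTR.bigO_add hF.1 hσ.1
  generator := exists_generator hm hmtime hF.2.1 hσ.2.1 hσ.2.2.1
  indistinguishable := haarIndistinguishable_subsetPhaseEnsemble hTR hm hmT hF hσ
  closure := hTR.closure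
  consistent := hTR.consistent

end TPRS

theorem mainTheorem1 (f : ℕ → ℕ) (hf : Monotone f) (hfpoly : f ∈ bigO poly)
    (m : ℕ → ℕ) (hm : ∀ n, m n ≤ n) (hmtime : PolyTimeLength m)
    (lF lσ : ℕ → ℕ) (F : ∀ n, BitStr (lF n) → BitStr n → Bool)
    (σ : ∀ n, BitStr (lσ n) → Equiv.Perm (BitStr n)) :
    ((fun n => 2 ^ m n) ∈ littleOmega {f} → IsQPRPF {f} lF F → IsQPRP {f} lσ σ →
      IsPRS {f} bigOOne bigOOne (fun n => lF n + lσ n) (subsetPhaseEnsemble m lF lσ F σ)) ∧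
    ((fun n => 2 ^ m n) ∈ littleOmega (polyOf f) →
      IsQPRPF (polyOf f) lF F → IsQPRP (polyOf f) lσ σ →
      IsPRS (polyOf f) (bigO (polyOf f)) (bigO (polyOf f)) (fun n => lF n + lσ n)
        (subsetPhaseEnsemble m lF lσ F σ)) :=
  ⟨fun h2m hF hσ => isPRS_subsetPhaseEnsemble (admissible_singleton f) hm hmtime h2m hF hσ,
    fun h2m hF hσ => isPRS_subsetPhaseEnsemble (admissible_polyOf f) hm hmtime h2m hF hσ⟩
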